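/- Let $H$ be the real Heisenberg group of matrices $\gamma(x,y,z)=\begin{pmatrix}1&x&z\\0&1&y\\0&0&1\end{pmatrix}$, $\Gamma=\{\gamma(x,y,z):x,y,z\in\mathbb Z\}$ and $M=\Gamma\backslash H$. Let $g$ be the metric on $M$ whose lift to $H$ is the left-invariant metric $dx^2+dy^2+(dz-x\,dy)^2$, and let $\mathcal F$ be the one-dimensional foliation of $M$ by the orbits of the left-invariant vector field $X(1,0,0)=\partial/\partial x$. With $F=T\mathcal F$ and $g=g_F+g_{F^\perp}$ put $g_h=g_F+h^{-2}g_{F^\perp}$, $h>0$, let $\Delta_h^r$ be the Laplace operator of $g_h$ on smooth real $r$-forms on $M$, and let $\lambda_0^r(h)\le\lambda_1^r(h)\le\dots$ be its eigenvalues, counted with multiplicities. Let $\Omega^r$ be the space of smooth real $r$-forms on $M$ with the $C^\infty$ topology, let $\Omega^r_k\subset\Omega^r$ consist of the $r$-forms $\omega$ with $i_{X_1\wedge\dots\wedge X_{r-k+1}}\omega=0$ for all vector fields $X_i$ tangent to the leaves ($\Omega^r_k=\Omega^r$ for $k\le 0$, $\Omega_k^r=0$ for $k>r$), and let $Z_k^{u,v}=\Omega_u^{u+v}\cap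 d^{-1}(\Omega_{u+k}^{u+v+1})$, $B_k^{u,v}=\Omega_u^{u+v}\cap d(\Omega_{u-k}^{u+v-1})$, $Z_\infty^{u,v}=\Omega_u^{u+v}\cap\ker d$, $B_\infty^{u,v}=\Omega_u^{u+v}\cap\operatorname{Im}d$, $E_k^{u,v}=Z_k^{u,v}/(Z_{k-1}^{u+1,v-1}+B_{k-1}^{u,v})$, $E_\infty^{u,v}=Z_\infty^{u,v}/(Z_\infty^{u+1,v-1}+B_\infty^{u,v})$ be the differentiable spectral sequence of $\mathcal F$. Let $\widehat E_1^{u,v}$ be the quotient of $E_1^{u,v}$ by the closure of $0$, and let $E_k^r=\bigoplus_{u+v=r}E_k^{u,v}$, $\widehat E_1^r=\bigoplus_{u+v=r}\widehat E_1^{u,v}$. Then, all $O(\cdot)$ being as $h\to0^+$: 1. For $r=0$ and $r=3$: $\lambda_0^r(h)=0$ for all $h>0$, $$\dim\widehat E_1^r=\sharp\{i:\lambda_i^r(h)=O(h^2)\}=\infty,\qquad \dim E_k^r=\sharp\{i:\lambda_i^r(h)=O(h^{2k})\}=1\quad(k\ge2).$$ 2. For $r=1$ and $r=2$: $\lambda_0^r(h)=\lambda_1^r(h)=0$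 for all $h>0$, $$\dim\widehat E_1^r=\sharp\{i:\lambda_i^r(h)=O(h^2)\}=\infty,\qquad \dim E_2^r=\sharp\{i:\lambda_i^r(h)=O(h^4)\}=\infty,$$ $$\dim E_k^r=\sharp\{i:\lambda_i^r(h)=O(h^{2k})\}=2\quad(k\ge3).$$ 3. $E_k=E_\infty$ for all $k\ge3$. 4. $\dim E_2^{0,0}=\dim E_2^{1,0}=1$, and $f\mapsto[f(y)\,dy\wedge dz]$ is a linear isomorphism from $C^\infty(S^1)$, $S^1=\mathbb R/\mathbb Z$, onto $E_2^{2,0}$. -/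

import Mathlib

open Filter Topology MeasureTheory
open scoped ContDiff UniformConvergence

noncomputable section

namespace HeisenbergFoliation

/-! ### The Heisenberg group and its left-invariant vector fields -/

/-- The real Heisenberg group in the global coordinates `(x, y, z) = (p 0, p 1, p 2)`. -/
abbrev Heis : Type := Fin 3 → ℝ

/-- The matrix `γ(x, y, z)`. -/
def toMatrix (p : Heis) : Matrix (Fin 3) (Fin 3) ℝ :=
  !![1, p 0, p 2; 0, 1, p 1; 0, 0, 1]

/-- The group law of the Heisenberg group in coordinates. -/
def hmul (a p : Heis) : Heis := ![a 0 + p 0, a 1 + p 1, a 2 + p 2 + a 0 * p 1]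

theorem toMatrix_hmul (a p : Heis) : toMatrix (hmul a p) = toMatrix a * toMatrix p := by
  ext i j
  fin_cases i <;> fin_cases j <;>
    simp [toMatrix, hmul, Matrix.mul_apply, Fin.sum_univ_three] <;> ring

/-- The lattice `Γ` of integer points. -/
def lattice : Set Heis := {a | ∀ i, ∃ n : ℤ, a i = n}

/-- The differential of the left translation by `a`. -/
def leftDeriv (a : Heis) : Heis →L[ℝ] Heis :=
  ContinuousLinearMap.pi ![ContinuousLinearMap.proj 0, ContinuousLinearMap.proj 1,
    ContinuousLinearMap.proj 2 + a 0 • ContinuousLinearMap.proj 1]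

theorem hasFDerivAt_hmul (a p : Heis) : HasFDerivAt (hmul a) (leftDeriv a) p := by
  have h : hmul a = fun q => a + leftDeriv a q := by
    funext q
    ext i
    fin_cases i <;> simp [hmul, leftDeriv, add_assoc]
  rw [h]
  exact (leftDeriv a).hasFDerivAt.const_add a

theorem fderiv_hmul (a p : Heis) : fderiv ℝ (hmul a) p = leftDeriv a :=
  (hasFDerivAt_hmul a p).fderiv

theorem contDiff_hmul (a : Heis) : ContDiff ℝ ∞ (hmul a) := by
  have h : hmul a = fun q => a + leftDeriv a q := by
    funext q
    ext i
    fin_cases i <;> simp [hmul, leftDeriv, add_assoc]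
  rw [h]
  fun_prop

/-- The left-invariant vector field on `H` whose value at the identity is `v`; under the
coordinates, `v = (v 0, v 1, v 2)` is the Lie algebra element `X(v 0, v 1, v 2)`. -/
def leftField (v : Heis) (p : Heis) : Heis := fderiv ℝ (hmul p) 0 v

theorem leftField_eq (v p : Heis) : leftField v p = ![v 0, v 1, v 2 + p 0 * v 1] := by
  rw [leftField, fderiv_hmul]
  ext i
  fin_cases i <;> simp [leftDeriv]

/-! ### The foliation and the metrics -/

/-- The field `X(1,0,0)`, whose orbits are the leaves. -/
def leafField (p : Heis) : Heis := leftField ![1, 0, 0] p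

/-- The tangent bundle `F` of the foliation. -/
def leafTangent (p : Heis) : Submodule ℝ Heis := Submodule.span ℝ {leafField p}

/-- The left-invariant metric `g = dx² + dy² + (dz - x dy)²` (identity matrix at the identity). -/
def metric (p v w : Heis) : ℝ :=
  v 0 * w 0 + v 1 * w 1 + (v 2 - p 0 * v 1) * (w 2 - p 0 * w 1)

theorem metric_leftInvariant (a p v w : Heis) :
    metric (hmul a p) (fderiv ℝ (hmul a) p v) (fderiv ℝ (hmul a) p w) = metric p v w := by
  rw [fderiv_hmul]
  simp [metric, hmul, leftDeriv]
  ring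

theorem metric_one (v w : Heis) : metric 0 v w = ∑ i, v i * w i := by
  simp [metric, Fin.sum_univ_three]

/-- The `g`-orthogonal projection of a tangent vector at `p` onto `F`. -/
def leafPart (p v : Heis) : Heis :=
  (metric p v (leafField p) / metric p (leafField p) (leafField p)) • leafField p

/-- The adiabatic metrics `g_h = g_F + h⁻² g_H`, where `H = F^⊥`. -/
def metricH (h : ℝ) (p v w : Heis) : ℝ :=
  metric p (leafPart p v) (leafPart p w)
    + h⁻¹ ^ 2 * metric p (v - leafPart p v) (w - leafPart p w)

/-- A left-invariant frame `X, hY, hZ` of the tangent bundle. -/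
def frame (h : ℝ) (p : Heis) : Fin 3 → Heis :=
  ![leftField ![1, 0, 0] p, h • leftField ![0, 1, 0] p, h • leftField ![0, 0, 1] p]

/-- The frame is orthonormal for `g_h`. -/
theorem frame_orthonormal {h : ℝ} (hh : h ≠ 0) (p : Heis) (i j : Fin 3) :
    metricH h p (frame h p i) (frame h p j) = if i = j then 1 else 0 := by
  fin_cases i <;> fin_cases j <;>
    simp [metricH, frame, leafPart, leafField, leftField_eq, metric] <;> field_simp <;> simp

/-- The density of the Riemannian volume of `g_h` with respect to `dx dy dz`. -/
def volDensity (h : ℝ) (p : Heis) : ℝ :=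
  Real.sqrt (Matrix.det (Matrix.of fun i j : Fin 3 =>
    metricH h p (Pi.single i 1) (Pi.single j 1)))

theorem volDensity_eq (h : ℝ) (p : Heis) : volDensity h p = h⁻¹ ^ 2 := by
  have : Matrix.det (Matrix.of fun i j : Fin 3 =>
      metricH h p (Pi.single i 1) (Pi.single j 1)) = (h⁻¹ ^ 2) ^ 2 := by
    simp [Matrix.det_fin_three, metricH, leafPart, leafField, leftField_eq, metric]
    ring
  rw [volDensity, this, Real.sqrt_sq (by positivity)]

/-! ### Differential forms on `M = Γ \ H` -/

/-- Pull-back of a differential form on `ℝ³`. -/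
def pullback {r : ℕ} (f : Heis → Heis) (ξ : Heis → Heis [⋀^Fin r]→L[ℝ] ℝ) :
    Heis → Heis [⋀^Fin r]→L[ℝ] ℝ :=
  fun p => (ξ (f p)).compContinuousLinearMap (fderiv ℝ f p)

/-- Smooth `Γ`-invariant `r`-forms on `H`. -/
def formSubmodule (r : ℕ) : Submodule ℝ (Heis → Heis [⋀^Fin r]→L[ℝ] ℝ) where
  carrier := {ξ | ContDiff ℝ ∞ ξ ∧ ∀ a ∈ lattice, pullback (hmul a) ξ = ξ}
  zero_mem' := ⟨contDiff_const, fun a _ => by ext; simp [pullback]⟩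
  add_mem' := by
    rintro ξ η ⟨h1, h2⟩ ⟨h3, h4⟩
    refine ⟨h1.add h3, fun a ha => ?_⟩
    conv_rhs => rw [← h2 a ha, ← h4 a ha]
    ext
    simp [pullback]
  smul_mem' := by
    rintro c ξ ⟨h1, h2⟩
    refine ⟨contDiff_const.smul h1, fun a ha => ?_⟩
    conv_rhs => rw [← h2 a ha]
    ext
    simp [pullback]

/-- `Ω^r`, the real smooth `r`-forms on `M = Γ \ H`, identified by pull-back along the
covering `H → Γ \ H` with the smooth `Γ`-invariant `r`-forms on `H`. -/
def Form (r : ℕ) : Type := formSubmodule r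

instance (r : ℕ) : AddCommGroup (Form r) := inferInstanceAs (AddCommGroup (formSubmodule r))
instance (r : ℕ) : Module ℝ (Form r) := inferInstanceAs (Module ℝ (formSubmodule r))

/-- The form on `H` underlying an element of `Ω^r`. -/
def Form.toFun {r : ℕ} : Form r →ₗ[ℝ] (Heis → Heis [⋀^Fin r]→L[ℝ] ℝ) := (formSubmodule r).subtype

theorem Form.contDiff {r : ℕ} (ξ : Form r) : ContDiff ℝ ∞ ξ.toFun := ξ.2.1

theorem Form.invariant {r : ℕ} (ξ : Form r) {a : Heis} (ha : a ∈ lattice) :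
    pullback (hmul a) ξ.toFun = ξ.toFun := ξ.2.2 a ha

theorem extDeriv_mem {r : ℕ} (ξ : Form r) : extDeriv ξ.toFun ∈ formSubmodule (r + 1) := by
  refine ⟨?_, fun a ha => ?_⟩
  · have h : ContDiff ℝ ∞ (fderiv ℝ ξ.toFun) := ξ.contDiff.fderiv_right (by simp)
    exact (ContinuousAlternatingMap.alternatizeUncurryFinCLM ℝ Heis ℝ).contDiff.comp h
  · funext p
    have hd : DifferentiableAt ℝ ξ.toFun (hmul a p) := ξ.contDiff.differentiable (by simp) _
    have h := extDeriv_pullback (r := ∞) (x := p) (f := hmul a) hd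
      (contDiff_hmul a).contDiffAt (by simpa using WithTop.coe_le_coe.2 (le_top : (2 : ℕ∞) ≤ ⊤))
    have h2 := ξ.invariant ha
    unfold pullback at h2 ⊢
    rw [h2] at h
    exact h.symm

/-- The de Rham differential `d : Ω^r → Ω^{r+1}`. -/
def d (r : ℕ) : Form r →ₗ[ℝ] Form (r + 1) where
  toFun ξ := ⟨extDeriv ξ.toFun, extDeriv_mem ξ⟩
  map_add' ξ η := Subtype.ext <| funext fun p => by
    have h := extDeriv_add (x := p) (ξ.contDiff.differentiable (by simp) p)
      (η.contDiff.differentiable (by simp) p)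
    rw [← map_add] at h
    exact h
  map_smul' c ξ := Subtype.ext <| funext fun p => by
    have h : extDeriv (c • ξ.toFun) p = c • extDeriv ξ.toFun p :=
      extDeriv_smul c _
    rw [← map_smul] at h
    exact h

/-! ### The `C^∞` topology -/

/-- The `n`-th iterated derivative of a form. -/
def iterD (r n : ℕ) :
    Form r →ₗ[ℝ] (Heis →ᵤ[{K | IsCompact K}] (Heis [×n]→L[ℝ] (Heis [⋀^Fin r]→L[ℝ] ℝ))) where
  toFun ξ := UniformOnFun.ofFun {K | IsCompact K} (iteratedFDeriv ℝ n ξ.toFun)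
  map_add' ξ η := by
    rw [map_add, iteratedFDeriv_add (ξ.contDiff.of_le (by exact_mod_cast le_top))
      (η.contDiff.of_le (by exact_mod_cast le_top))]
    rfl
  map_smul' c ξ := by
    have : iteratedFDeriv ℝ n (c • ξ.toFun) = c • iteratedFDeriv ℝ n ξ.toFun := funext fun p =>
      iteratedFDeriv_const_smul_apply (ξ.contDiff.of_le (by exact_mod_cast le_top)).contDiffAt
    rw [map_smul, this]
    rfl

/-- The `C^∞` topology on `Ω^r`: uniform convergence, on compact sets of the covering space `H`,
of all derivatives. -/
instance (r : ℕ) : TopologicalSpace (Form r) :=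
  ⨅ n, TopologicalSpace.induced (iterD r n) inferInstance

instance (r : ℕ) : IsTopologicalAddGroup (Form r) :=
  topologicalAddGroup_iInf fun n => topologicalAddGroup_induced (iterD r n)

instance (r : ℕ) : ContinuousSMul ℝ (Form r) := by
  refine continuousSMul_iInf fun n => ?_
  let _ : TopologicalSpace (Form r) := TopologicalSpace.induced (iterD r n) inferInstance
  refine UniformOnFun.continuousSMul_induced_of_image_bounded ℝ Heis
    (Heis [×n]→L[ℝ] (Heis [⋀^Fin r]→L[ℝ] ℝ)) (Form r) (iterD r n) ⟨rfl⟩ fun ξ K hK => ?_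
  have hc : Continuous (iteratedFDeriv ℝ n ξ.toFun) :=
    ξ.contDiff.continuous_iteratedFDeriv (by exact_mod_cast le_top)
  exact (IsCompact.image hK hc).isVonNBounded ℝ

/-! ### The Laplace operators and their eigenvalues -/

/-- The pointwise inner product of `r`-forms induced by `g_h`. -/
def innerAt (h : ℝ) {r : ℕ} (α β : Form r) (p : Heis) : ℝ :=
  (1 / (r.factorial : ℝ)) * ∑ i : Fin r → Fin 3,
    α.toFun p (fun k => frame h p (i k)) * β.toFun p (fun k => frame h p (i k))

/-- The `L²` inner product on `Ω^r` defined by `g_h`; the unit cube is a fundamental domain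
of `Γ`. -/
def innerL2 (h : ℝ) {r : ℕ} (α β : Form r) : ℝ :=
  ∫ p in Set.Icc (0 : Heis) 1, innerAt h α β p * volDensity h p

theorem continuous_frame (h : ℝ) (i : Fin 3) : Continuous fun p => frame h p i := by
  fin_cases i <;> simp [frame, leftField_eq] <;> fun_prop

theorem innerL2_integrable (h : ℝ) {r : ℕ} (α β : Form r) :
    IntegrableOn (fun p => innerAt h α β p * volDensity h p) (Set.Icc (0 : Heis) 1) := by
  refine ContinuousOn.integrableOn_compact isCompact_Icc (Continuous.continuousOn ?_)
  have hev : ∀ (ξ : Form r) (i : Fin r → Fin 3),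
      Continuous fun p => ξ.toFun p (fun k => frame h p (i k)) := fun ξ i =>
    (continuous_eval.comp (ξ.contDiff.continuous.prodMk
      (continuous_pi fun k => continuous_frame h (i k))) :)
  simp only [volDensity_eq, innerAt]
  exact (continuous_const.mul
    (continuous_finsetSum _ fun i _ => (hev α i).mul (hev β i))).mul continuous_const

theorem innerL2_add_right (h : ℝ) {r : ℕ} (α β γ : Form r) :
    innerL2 h α (β + γ) = innerL2 h α β + innerL2 h α γ := by
  unfold innerL2
  rw [← integral_add (innerL2_integrable h α β) (innerL2_integrable h α γ)]
  congr 1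
  funext p
  simp [innerAt, mul_add, Finset.sum_add_distrib, add_mul]

theorem innerL2_smul_right (h : ℝ) {r : ℕ} (c : ℝ) (α β : Form r) :
    innerL2 h α (c • β) = c * innerL2 h α β := by
  unfold innerL2
  rw [← integral_const_mul]
  congr 1
  funext p
  simp only [innerAt, map_smul, Pi.smul_apply, ContinuousAlternatingMap.smul_apply, smul_eq_mul]
  rw [Finset.sum_congr rfl fun i _ => mul_left_comm _ c _, ← Finset.mul_sum]
  ring

/-- `α = δ_h β`, where the codifferential `δ_h` is the formal adjoint of `d` with respect to
`g_h`. -/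
def IsCodiff (h : ℝ) {r : ℕ} (β : Form (r + 1)) (α : Form r) : Prop :=
  ∀ φ : Form r, innerL2 h (d r φ) β = innerL2 h φ α

/-- `η = Δ_h ξ`, where `Δ_h = d δ_h + δ_h d`. -/
def IsLaplacian (h : ℝ) : (r : ℕ) → Form r → Form r → Prop
  | 0, ξ, η => IsCodiff h (d 0 ξ) η
  | r + 1, ξ, η => ∃ (α : Form r) (β : Form (r + 1)),
      IsCodiff h ξ α ∧ IsCodiff h (d (r + 1) ξ) β ∧ η = d r α + β

theorem IsCodiff.add {h : ℝ} {r : ℕ} {β β' : Form (r + 1)} {α α' : Form r}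
    (h1 : IsCodiff h β α) (h2 : IsCodiff h β' α') : IsCodiff h (β + β') (α + α') := fun φ => by
  rw [innerL2_add_right, innerL2_add_right, h1 φ, h2 φ]

theorem IsCodiff.smul {h : ℝ} {r : ℕ} {β : Form (r + 1)} {α : Form r} (c : ℝ)
    (h1 : IsCodiff h β α) : IsCodiff h (c • β) (c • α) := fun φ => by
  rw [innerL2_smul_right, innerL2_smul_right, h1 φ]

theorem IsLaplacian.add {h : ℝ} {r : ℕ} {ξ ξ' η η' : Form r} (h1 : IsLaplacian h r ξ η)
    (h2 : IsLaplacian h r ξ' η') : IsLaplacian h r (ξ + ξ') (η + η') := by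
  cases r with
  | zero =>
    have := IsCodiff.add h1 h2
    rwa [← map_add] at this
  | succ r =>
    obtain ⟨α, β, ha, hb, rfl⟩ := h1
    obtain ⟨α', β', ha', hb', rfl⟩ := h2
    refine ⟨α + α', β + β', ha.add ha', ?_, ?_⟩
    · rw [map_add]
      exact hb.add hb'
    · rw [map_add]
      abel

theorem IsLaplacian.smul {h : ℝ} {r : ℕ} {ξ η : Form r} (c : ℝ) (h1 : IsLaplacian h r ξ η) :
    IsLaplacian h r (c • ξ) (c • η) := by
  cases r with
  | zero =>
    have := IsCodiff.smul c h1
    rwa [← map_smul] at this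
  | succ r =>
    obtain ⟨α, β, ha, hb, rfl⟩ := h1
    refine ⟨c • α, c • β, ha.smul c, ?_, ?_⟩
    · rw [map_smul]
      exact hb.smul c
    · rw [map_smul, smul_add]

theorem innerL2_zero_right (h : ℝ) {r : ℕ} (α : Form r) : innerL2 h α 0 = 0 := by
  simpa using innerL2_smul_right h 0 α 0

theorem IsLaplacian.zero (h : ℝ) (r : ℕ) : IsLaplacian h r 0 0 := by
  have h0 : ∀ k : ℕ, IsCodiff h (0 : Form (k + 1)) (0 : Form k) := fun k φ => by
    rw [innerL2_zero_right, innerL2_zero_right]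
  cases r with
  | zero =>
    have := h0 0
    rw [← map_zero (d 0)] at this
    exact this
  | succ r => exact ⟨0, 0, h0 r, by simpa using h0 (r + 1), by simp⟩

/-- The eigenspace of `Δ_h` on `Ω^r` for the eigenvalue `s`. -/
def eigenspace (h : ℝ) (r : ℕ) (s : ℝ) : Submodule ℝ (Form r) where
  carrier := {ξ | IsLaplacian h r ξ (s • ξ)}
  zero_mem' := by simpa using IsLaplacian.zero h r
  add_mem' h1 h2 := by simpa [smul_add] using IsLaplacian.add h1 h2
  smul_mem' c ξ h1 := by
    have := IsLaplacian.smul c h1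
    rwa [smul_comm] at this

/-- The number of eigenvalues of `Δ_h` on `Ω^r` that are `≤ t`, counted with multiplicities. -/
def countingFunction (h : ℝ) (r : ℕ) (t : ℝ) : Cardinal :=
  Module.rank ℝ (⨆ s : Set.Iic t, eigenspace h r s : Submodule ℝ (Form r))

/-- The branch `λ_i^r(h)`: the `i`-th (`i = 0, 1, 2, …`) eigenvalue of `Δ_h` on `Ω^r` in
nondecreasing order and counted with multiplicities, that is, the least `t` such that there are
at least `i + 1` eigenvalues `≤ t`. It would be `⊤` if there were no such `t`. -/
def eigenvalueBranch (r i : ℕ) (h : ℝ) : EReal :=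
  sInf {x : EReal | ∃ t : ℝ, x = t ∧ ((i + 1 : ℕ) : Cardinal) ≤ countingFunction h r t}

/-- `λ(h) = O(h^m)` as `h → 0`, `h > 0`. -/
def IsBigOPow (lam : ℝ → EReal) (m : ℕ) : Prop :=
  ∃ C : ℝ, ∀ᶠ h in 𝓝[>] (0 : ℝ), (lam h).abs ≤ ENNReal.ofReal (C * h ^ m)

/-- The number of indices `i` with `λ_i^r(h) = O(h^m)` as `h → 0`. -/
def smallCount (r m : ℕ) : ℕ∞ := {i : ℕ | IsBigOPow (eigenvalueBranch r i) m}.encard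

/-! ### The differentiable spectral sequence -/

open Classical in
/-- `Ω_k^r`: the `r`-forms of filtration degree `≥ k`, i.e. those which vanish as soon as
`r - k + 1` (or more) of the arguments are tangent to the leaves. -/
def filt (k : ℤ) (r : ℕ) : Submodule ℝ (Form r) where
  carrier := {ξ | ∀ (p : Heis) (v : Fin r → Heis),
    (r : ℤ) - k + 1 ≤ (Finset.univ.filter fun j => v j ∈ leafTangent p).card → ξ.toFun p v = 0}
  zero_mem' := fun p v _ => by simp
  add_mem' := fun h1 h2 p v hv => by simp [h1 p v hv, h2 p v hv]
  smul_mem' := fun c ξ h1 p v hv => by simp [h1 p v hv]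

/-- `Z_k^{u,r-u} = Ω_u^r ∩ d⁻¹(Ω_{u+k}^{r+1})`. -/
def ssZ (k u : ℤ) (r : ℕ) : Submodule ℝ (Form r) :=
  filt u r ⊓ (filt (u + k) (r + 1)).comap (d r)

/-- `Z_∞^{u,r-u} = Ω_u^r ∩ ker d`. -/
def ssZInf (u : ℤ) (r : ℕ) : Submodule ℝ (Form r) := filt u r ⊓ LinearMap.ker (d r)

/-- `B_k^{u,r-u} = Ω_u^r ∩ d(Ω_{u-k}^{r-1})` for `k ≥ 0`, and `B_{-1} = 0`. -/
def ssB (k u : ℤ) : (r : ℕ) → Submodule ℝ (Form r)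
  | 0 => ⊥
  | r + 1 => if k < 0 then ⊥ else filt u (r + 1) ⊓ (filt (u - k) r).map (d r)

/-- `B_∞^{u,r-u} = Ω_u^r ∩ im d`. -/
def ssBInf (u : ℤ) : (r : ℕ) → Submodule ℝ (Form r)
  | 0 => ⊥
  | r + 1 => filt u (r + 1) ⊓ LinearMap.range (d r)

/-- The denominator of `E_k^{u,r-u}`. -/
def ssDen (k u : ℤ) (r : ℕ) : Submodule ℝ (Form r) := ssZ (k - 1) (u + 1) r ⊔ ssB (k - 1) u r

/-- The denominator of `E_∞^{u,r-u}`. -/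
def ssDenInf (u : ℤ) (r : ℕ) : Submodule ℝ (Form r) := ssZInf (u + 1) r ⊔ ssBInf u r

/-- The term `E_k^{u,r-u}` of the spectral sequence (second index: `u`, third: total degree). -/
abbrev ssE (k u : ℤ) (r : ℕ) : Type :=
  ssZ k u r ⧸ (ssDen k u r).comap (ssZ k u r).subtype

/-- The Hausdorff term `Ê_k^{u,r-u}`, the quotient of `E_k^{u,r-u}` (with the topology induced
from the `C^∞` topology) by the closure of its trivial subspace. -/
abbrev ssEHat (k u : ℤ) (r : ℕ) : Type :=
  ssE k u r ⧸ (⊥ : Submodule ℝ (ssE k u r)).topologicalClosure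

/-- `dim E_k^r = ∑_{u+v=r} dim E_k^{u,v}`. -/
def dimE (k : ℤ) (r : ℕ) : ℕ∞ :=
  ∑ u ∈ Finset.range (r + 1), Cardinal.toENat (Module.rank ℝ (ssE k u r))

/-- `dim Ê_k^r = ∑_{u+v=r} dim Ê_k^{u,v}`. -/
def dimEHat (k : ℤ) (r : ℕ) : ℕ∞ :=
  ∑ u ∈ Finset.range (r + 1), Cardinal.toENat (Module.rank ℝ (ssEHat k u r))

/-- `C^∞(S¹)` for `S¹ = ℝ / ℤ`. -/
def circleFunctions : Submodule ℝ (ℝ → ℝ) where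
  carrier := {f | ContDiff ℝ ∞ f ∧ Function.Periodic f 1}
  zero_mem' := ⟨contDiff_const, fun _ => rfl⟩
  add_mem' h1 h2 := ⟨h1.1.add h2.1, h1.2.add h2.2⟩
  smul_mem' c _ h1 := ⟨contDiff_const.smul h1.1, fun x => by simp [h1.2 x]⟩

end HeisenbergFoliation

end

noncomputable section

namespace HeisenbergFoliation

/-! Let α = dx, β = dy, θ = dz - x dy be the coframe dual to the left-invariant fields X, Y, Z. Then
[X, Y] = Z, dθ = -α ∧ β, and X, Y, Z are skew-adjoint for the integral over M. In this frame `d`,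
the codifferential and the inner products are explicit; up to the volume factor h⁻², each transverse
covector β or θ contributes a weight h² to the square norm.

Lower bounds on eigenvalues. A closed form without periods has a primitive bounded in the L² norm of
h = 1 (`exists_primitive_one`, `exists_primitive_two`, `exists_primitive_three`), built by averaging
along Z, then X, then Y. Comparing weights (`exists_primitive`), the square norm loses a factor h²
for `d` on functions and on 2-forms, and h⁴ for `d` on 1-forms. A form orthogonal to ker d is the
shortest primitive of its differential, so nonzero eigenvalues are at least c h² in degrees 0 and 3,
which do not see `d` on 1-forms, and at least c h⁴ in degrees 1 and 2 (`harmonic_of_lt_gap`).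
Harmonic forms are determined by their periods; the class of α ∧ β is exact, which leaves dimensions
1, 2, 2, 1.

Upper bounds come from eigenforms depending on y only: cos(my) in degrees 0 and 3, with eigenvalue
m²h², and m cos(my) α + q sin(my) θ with h²q² + q = m², together with its differential, with
eigenvalue h⁴q² ≤ m⁴h⁴. Completeness of the eigenforms plays no role.

Spectral sequence. Leaves have dimension 1 and codimension 2, so `filt k r` is zero or everything
except for `filt 1 1` and `filt 2 2`; this forces `degeneration` at the third term. A function
constant along the leaves depends on y alone (`dZ_eq_zero_of_dX_eq_zero`), and such functions give
the infinite-dimensional terms, detected by continuous functionals that vanish on the denominators.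
On E_2 the classes of f α - f' θ and of f β ∧ θ are infinite families, and d_2 sends the former to
-f'' β ∧ θ: this is the counterpart of the eigenvalues of order h⁴. From the third term on,
dimensions are read off from periods. -/

/-! ### Weighted averages along translations -/

section TransAvg

variable {E : Type} [NormedAddCommGroup E] [NormedSpace ℝ E]

/-- The weighted average of `f` along the segment from `p` to `p + v`. -/
def transAvg (w : ℝ → ℝ) (v : Heis) (f : Heis → E) (p : Heis) : E :=
  ∫ s in (0 : ℝ)..1, w s • f (p + s • v)

theorem continuous_transAvg_integrand {w : ℝ → ℝ} (hw : Continuous w) (v : Heis) {f : Heis → E}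
    (hf : Continuous f) : Continuous fun z : Heis × ℝ => w z.2 • f (z.1 + z.2 • v) := by
  fun_prop

theorem intervalIntegrable_transAvg {w : ℝ → ℝ} (hw : Continuous w) (v : Heis) {f : Heis → E}
    (hf : Continuous f) (p : Heis) (a b : ℝ) :
    IntervalIntegrable (fun s => w s • f (p + s • v)) volume a b :=
  Continuous.intervalIntegrable (by fun_prop) _ _

theorem hasFDerivAt_transAvg {w : ℝ → ℝ} (hw : Continuous w) (v : Heis) {f : Heis → E}
    (hf : ContDiff ℝ 1 f) (p : Heis) :
    HasFDerivAt (transAvg w v f) (transAvg w v (fderiv ℝ f) p) p := by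
  have hf' : Continuous (fderiv ℝ f) := hf.continuous_fderiv one_ne_zero
  -- The dominating constant: the derivative of the integrand is continuous, hence bounded on the
  -- compact product of a ball and [0, 1].
  obtain ⟨C, hC⟩ := ((isCompact_closedBall p 1).prod (isCompact_Icc (a := (0 : ℝ)) (b := 1))
    ).exists_bound_of_continuousOn (continuous_transAvg_integrand hw v hf').continuousOn
  refine intervalIntegral.hasFDerivAt_integral_of_dominated_of_fderiv_le
    (F := fun p s => w s • f (p + s • v)) (F' := fun p s => w s • fderiv ℝ f (p + s • v))
    (bound := fun _ => C) (Metric.closedBall_mem_nhds p one_pos) ?_ ?_ ?_ ?_ (by simp) ?_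
  · refine Eventually.of_forall fun x => Continuous.aestronglyMeasurable ?_
    have := hf.continuous
    fun_prop
  · exact intervalIntegrable_transAvg hw v hf.continuous p _ _
  · exact Continuous.aestronglyMeasurable (by fun_prop)
  · refine Eventually.of_forall fun t ht x hx => hC (x, t) ⟨hx, ?_⟩
    rw [Set.uIoc_of_le zero_le_one] at ht
    exact ⟨ht.1.le, ht.2⟩
  · refine Eventually.of_forall fun t _ x _ => ?_
    have h1 : HasFDerivAt f (fderiv ℝ f (x + t • v)) (x + t • v) :=
      (hf.differentiable one_ne_zero _).hasFDerivAt
    have h2 : HasFDerivAt (fun y : Heis => y + t • v) (ContinuousLinearMap.id ℝ Heis) x :=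
      (hasFDerivAt_id x).add_const _
    exact (h1.comp x h2).const_smul (w t)

/-- The induction passes from `f` to `fderiv ℝ f`, whose values lie in another space; hence the
quantifier over `E` inside the statement. -/
theorem contDiff_nat_transAvg {w : ℝ → ℝ} (hw : Continuous w) (v : Heis) (n : ℕ) :
    ∀ {E : Type} [NormedAddCommGroup E] [NormedSpace ℝ E] {f : Heis → E},
      ContDiff ℝ ∞ f → ContDiff ℝ n (transAvg w v f) := by
  induction n with
  | zero =>
    intro E _ _ f hf
    have : ContDiff ℝ 1 f := hf.of_le (by exact_mod_cast le_top)
    have hd : Differentiable ℝ (transAvg w v f) := fun p =>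
      (hasFDerivAt_transAvg hw v this p).differentiableAt
    exact contDiff_zero.2 hd.continuous
  | succ n ih =>
    intro E _ _ f hf
    have h1 : ContDiff ℝ 1 f := hf.of_le (by exact_mod_cast le_top)
    have h2 : ContDiff ℝ ∞ (fderiv ℝ f) := hf.fderiv_right (by simp)
    have : fderiv ℝ (transAvg w v f) = transAvg w v (fderiv ℝ f) := funext fun p =>
      (hasFDerivAt_transAvg hw v h1 p).fderiv
    push_cast
    refine contDiff_succ_iff_fderiv.2 ⟨fun p =>
      (hasFDerivAt_transAvg hw v h1 p).differentiableAt, by simp, ?_⟩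
    rw [this]
    exact ih h2

theorem contDiff_transAvg {w : ℝ → ℝ} (hw : Continuous w) (v : Heis) {f : Heis → E}
    (hf : ContDiff ℝ ∞ f) : ContDiff ℝ ∞ (transAvg w v f) :=
  contDiff_infty.2 fun n => contDiff_nat_transAvg hw v n hf

end TransAvg

theorem fderiv_transAvg {w : ℝ → ℝ} (hw : Continuous w) (v : Heis) {f : Heis → ℝ}
    (hf : ContDiff ℝ 1 f) (p u : Heis) :
    fderiv ℝ (transAvg w v f) p u = transAvg w v (fun q => fderiv ℝ f q u) p := by
  have hf' : Continuous (fderiv ℝ f) := hf.continuous_fderiv one_ne_zero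
  rw [(hasFDerivAt_transAvg hw v hf p).fderiv, transAvg,
    ContinuousLinearMap.intervalIntegral_apply (intervalIntegrable_transAvg hw v hf' p _ _)]
  rfl

theorem hasDerivAt_line {f : Heis → ℝ} (hf : ContDiff ℝ 1 f) (p v : Heis) (s : ℝ) :
    HasDerivAt (fun s : ℝ => f (p + s • v)) (fderiv ℝ f (p + s • v) v) s := by
  have h1 : HasFDerivAt f (fderiv ℝ f (p + s • v)) (p + s • v) :=
    (hf.differentiable one_ne_zero _).hasFDerivAt
  have h2 : HasDerivAt (fun s : ℝ => p + s • v) v s := by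
    simpa using ((hasDerivAt_id s).smul_const v).const_add p
  exact h1.comp_hasDerivAt s h2

theorem fderiv_transAvg_one (v : Heis) {f : Heis → ℝ} (hf : ContDiff ℝ 1 f) (p : Heis) :
    fderiv ℝ (transAvg (fun _ => 1) v f) p v = f (p + v) - f p := by
  have hf' : Continuous (fderiv ℝ f) := hf.continuous_fderiv one_ne_zero
  rw [fderiv_transAvg continuous_const v hf, transAvg]
  simp only [one_smul]
  rw [intervalIntegral.integral_eq_sub_of_hasDerivAt (fun s _ => hasDerivAt_line hf p v s)
    (Continuous.intervalIntegrable (by fun_prop) _ _)]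
  simp

/-- Integration by parts: the weight s - 1/2 has derivative 1 and end values ±1/2. For `f` periodic
along `v` the right side is `f` minus its average, so this weight inverts the derivative up to
averages. -/
theorem fderiv_transAvg_sub_half (v : Heis) {f : Heis → ℝ} (hf : ContDiff ℝ 1 f) (p : Heis) :
    fderiv ℝ (transAvg (fun s => s - 1 / 2) v f) p v =
      (f (p + v) + f p) / 2 - transAvg (fun _ => 1) v f p := by
  have hf' : Continuous (fderiv ℝ f) := hf.continuous_fderiv one_ne_zero
  have hc := hf.continuous
  rw [fderiv_transAvg (by fun_prop) v hf, transAvg, transAvg, eq_sub_iff_add_eq,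
    ← intervalIntegral.integral_add (Continuous.intervalIntegrable (by fun_prop) _ _)
      (Continuous.intervalIntegrable (by fun_prop) _ _)]
  have h : ∀ s : ℝ, HasDerivAt (fun s : ℝ => (s - 1 / 2) * f (p + s • v))
      ((s - 1 / 2) • fderiv ℝ f (p + s • v) v + (1 : ℝ) • f (p + s • v)) s := fun s => by
    have := ((hasDerivAt_id s).sub_const (1 / 2)).mul (hasDerivAt_line hf p v s)
    refine this.congr_deriv ?_
    simp [add_comm]
  rw [intervalIntegral.integral_eq_sub_of_hasDerivAt (fun s _ => h s)
    (Continuous.intervalIntegrable (by fun_prop) _ _)]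
  simp
  ring

/-- The variance of the integrand over [0, 1] is nonnegative. -/
theorem sq_transAvg_le {w : ℝ → ℝ} (hw : Continuous w) (hw1 : ∀ s ∈ Set.Icc (0 : ℝ) 1, |w s| ≤ 1)
    (v : Heis) {f : Heis → ℝ} (hf : Continuous f) (p : Heis) :
    transAvg w v f p ^ 2 ≤ transAvg (fun _ => 1) v (fun q => f q * f q) p := by
  set m := transAvg w v f p with hm
  have h1 : 0 ≤ ∫ s in (0 : ℝ)..1, (w s • f (p + s • v) - m) ^ 2 :=
    intervalIntegral.integral_nonneg zero_le_one fun s _ => sq_nonneg _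
  have h2 : ∫ s in (0 : ℝ)..1, (w s • f (p + s • v) - m) ^ 2 =
      (∫ s in (0 : ℝ)..1, (w s • f (p + s • v)) ^ 2) - 2 * m * m + m ^ 2 := by
    have : ∀ s : ℝ, (w s • f (p + s • v) - m) ^ 2 =
        (w s • f (p + s • v)) ^ 2 - (2 * m) * (w s • f (p + s • v)) + m ^ 2 := fun s => by ring
    simp_rw [this]
    rw [intervalIntegral.integral_add (Continuous.intervalIntegrable (by fun_prop) _ _)
      (Continuous.intervalIntegrable (by fun_prop) _ _),
      intervalIntegral.integral_sub (Continuous.intervalIntegrable (by fun_prop) _ _)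
      (Continuous.intervalIntegrable (by fun_prop) _ _), intervalIntegral.integral_const_mul]
    simp [hm, transAvg]
  have h3 : ∫ s in (0 : ℝ)..1, (w s • f (p + s • v)) ^ 2 ≤
      transAvg (fun _ => 1) v (fun q => f q * f q) p := by
    refine intervalIntegral.integral_mono_on zero_le_one
      (Continuous.intervalIntegrable (by fun_prop) _ _)
      (Continuous.intervalIntegrable (by fun_prop) _ _) fun s hs => ?_
    have h4 : w s ^ 2 ≤ 1 := by
      rw [← sq_abs]
      exact pow_le_one₀ (abs_nonneg _) (hw1 s hs)
    have := mul_le_mul_of_nonneg_right h4 (sq_nonneg (f (p + s • v)))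
    simp only [smul_eq_mul, one_mul, mul_pow]
    linarith
  nlinarith

/-! ### Integration over the unit cube -/

/-- Divergence theorem for the field `f` times the `i`-th unit vector; periodicity makes the two
opposite faces cancel. -/
theorem integral_cube_fderiv_eq_zero (i : Fin 3) {f : Heis → ℝ} (hf : ContDiff ℝ 1 f)
    (hper : ∀ p, f (p + Pi.single i 1) = f p) :
    ∫ p in Set.Icc (0 : Heis) 1, fderiv ℝ f p (Pi.single i 1) = 0 := by
  have hf' : Continuous (fderiv ℝ f) := hf.continuous_fderiv one_ne_zero
  have h := integral_divergence_of_hasFDerivAt_off_countable' (E := ℝ) (n := 2) (0 : Heis) 1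
    zero_le_one (fun j => if j = i then f else 0) (fun j => if j = i then fderiv ℝ f else 0) ∅
    Set.countable_empty ?_ ?_ ?_
  · have h1 : ∀ x : Heis, ∑ j, (if j = i then fderiv ℝ f else 0) x (Pi.single j 1) =
        fderiv ℝ f x (Pi.single i 1) := fun x => by
      rw [Finset.sum_eq_single i] <;> simp +contextual
    simp only [h1] at h
    rw [h]
    refine Finset.sum_eq_zero fun j _ => ?_
    split_ifs with hj
    · subst hj
      rw [sub_eq_zero]
      congr 1
      funext x
      have h2 : (Fin.insertNth j ((1 : Heis) j) x : Heis) =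
          (Fin.insertNth j ((0 : Heis) j) x : Heis) + Pi.single j 1 := by
        ext k
        rcases eq_or_ne k j with rfl | hk
        · simp
        · obtain ⟨l, rfl⟩ := Fin.exists_succAbove_eq hk
          simp
      rw [h2, hper]
    · simp
  · intro j
    split_ifs
    · exact hf.continuous.continuousOn
    · exact continuousOn_const
  · intro x _ j
    split_ifs
    · exact (hf.differentiable one_ne_zero _).hasFDerivAt
    · exact hasFDerivAt_const (0 : ℝ) x
  · refine ContinuousOn.integrableOn_compact isCompact_Icc (Continuous.continuousOn ?_)
    refine continuous_finsetSum _ fun j _ => ?_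
    split_ifs
    · fun_prop
    · exact continuous_const

/-! ### Smooth functions on `M` -/

/-- `C^∞(M)`, as the algebra of smooth `Γ`-invariant functions on `H`. -/
def invariantFunctions : Subalgebra ℝ (Heis → ℝ) where
  carrier := {f | ContDiff ℝ ∞ f ∧ ∀ a ∈ lattice, ∀ p, f (hmul a p) = f p}
  mul_mem' h1 h2 := ⟨h1.1.mul h2.1, fun a ha p => by simp [h1.2 a ha, h2.2 a ha]⟩
  add_mem' h1 h2 := ⟨h1.1.add h2.1, fun a ha p => by simp [h1.2 a ha, h2.2 a ha]⟩
  algebraMap_mem' c := ⟨contDiff_const, fun _ _ _ => rfl⟩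

/-- `C^∞(M)` as a type. -/
abbrev InvFun : Type := invariantFunctions

namespace InvFun

theorem contDiff (f : InvFun) : ContDiff ℝ ∞ f.1 := f.2.1

theorem contDiff_one (f : InvFun) : ContDiff ℝ 1 f.1 := f.contDiff.of_le (by exact_mod_cast le_top)

theorem continuous (f : InvFun) : Continuous f.1 := f.contDiff.continuous

theorem differentiable (f : InvFun) : Differentiable ℝ f.1 := f.contDiff.differentiable (by simp)

theorem invariant (f : InvFun) {a : Heis} (ha : a ∈ lattice) (p : Heis) :
    f.1 (hmul a p) = f.1 p := f.2.2 a ha p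

theorem fderiv_invariant (f : InvFun) {a : Heis} (ha : a ∈ lattice) (p v : Heis) :
    fderiv ℝ f.1 (hmul a p) (leftDeriv a v) = fderiv ℝ f.1 p v := by
  have h1 : HasFDerivAt (fun q => f.1 (hmul a q)) ((fderiv ℝ f.1 (hmul a p)).comp (leftDeriv a)) p :=
    (f.differentiable _).hasFDerivAt.comp p (hasFDerivAt_hmul a p)
  have h2 : (fun q => f.1 (hmul a q)) = f.1 := funext fun q => f.invariant ha q
  rw [h2] at h1
  rw [h1.fderiv]
  rfl

end InvFun

theorem leftDeriv_leftField (a v p : Heis) :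
    leftDeriv a (leftField v p) = leftField v (hmul a p) := by
  rw [leftField_eq, leftField_eq]
  ext i
  fin_cases i <;> simp [leftDeriv, hmul]
  ring

theorem contDiff_leftField (v : Heis) : ContDiff ℝ ∞ (leftField v) := by
  have : leftField v = fun p => ![v 0, v 1, v 2 + p 0 * v 1] := funext (leftField_eq v)
  rw [this]
  refine contDiff_pi.2 fun i => ?_
  fin_cases i <;> simp <;> fun_prop

/-- The derivation of `C^∞(M)` given by a left-invariant vector field. -/
def lieDer (v : Heis) : InvFun →ₗ[ℝ] InvFun where
  toFun f := ⟨fun p => fderiv ℝ f.1 p (leftField v p),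
    (f.contDiff.fderiv_right (by simp)).clm_apply (contDiff_leftField v), fun a ha p => by
      beta_reduce
      rw [← leftDeriv_leftField, f.fderiv_invariant ha]⟩
  map_add' f g := Subtype.ext <| funext fun p => by
    change fderiv ℝ (f.1 + g.1) p _ = fderiv ℝ f.1 p _ + fderiv ℝ g.1 p _
    rw [fderiv_add (f.differentiable p) (g.differentiable p)]
    rfl
  map_smul' c f := Subtype.ext <| funext fun p => by
    change fderiv ℝ (c • f.1) p _ = c * fderiv ℝ f.1 p _
    rw [fderiv_const_smul (f.differentiable p)]
    rfl

/-- The derivation `X`. -/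
abbrev dX : InvFun →ₗ[ℝ] InvFun := lieDer ![1, 0, 0]
/-- The derivation `Y`. -/
abbrev dY : InvFun →ₗ[ℝ] InvFun := lieDer ![0, 1, 0]
/-- The derivation `Z`. -/
abbrev dZ : InvFun →ₗ[ℝ] InvFun := lieDer ![0, 0, 1]

theorem lieDer_mul (v : Heis) (f g : InvFun) : lieDer v (f * g) = lieDer v f * g + f * lieDer v g :=
  Subtype.ext <| funext fun p => by
    change fderiv ℝ (f.1 * g.1) p _ = fderiv ℝ f.1 p _ * g.1 p + f.1 p * fderiv ℝ g.1 p _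
    rw [fderiv_mul (f.differentiable p) (g.differentiable p)]
    simp
    ring

theorem lieDer_algebraMap (v : Heis) (c : ℝ) : lieDer v (algebraMap ℝ InvFun c) = 0 :=
  Subtype.ext <| funext fun p => by
    change fderiv ℝ (fun _ => c) p _ = 0
    simp

theorem dX_apply (f : InvFun) (p : Heis) : (dX f).1 p = fderiv ℝ f.1 p (Pi.single 0 1) := by
  change fderiv ℝ f.1 p (leftField _ p) = _
  congr 1
  rw [leftField_eq]
  ext i
  fin_cases i <;> simp

theorem dZ_apply (f : InvFun) (p : Heis) : (dZ f).1 p = fderiv ℝ f.1 p (Pi.single 2 1) := by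
  change fderiv ℝ f.1 p (leftField _ p) = _
  congr 1
  rw [leftField_eq]
  ext i
  fin_cases i <;> simp

theorem dY_apply (f : InvFun) (p : Heis) :
    (dY f).1 p = fderiv ℝ f.1 p (Pi.single 1 1) + p 0 * fderiv ℝ f.1 p (Pi.single 2 1) := by
  change fderiv ℝ f.1 p (leftField _ p) = _
  rw [← smul_eq_mul, ← map_smul, ← map_add]
  congr 1
  rw [leftField_eq]
  ext i
  fin_cases i <;> simp

theorem fderiv_eq_frame (f : InvFun) (p v : Heis) : fderiv ℝ f.1 p v =
    (dX f).1 p * v 0 + (dY f).1 p * v 1 + (dZ f).1 p * (v 2 - p 0 * v 1) := by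
  have : v = v 0 • Pi.single 0 1 + v 1 • Pi.single 1 1 + v 2 • Pi.single 2 1 := by
    ext i
    fin_cases i <;> simp
  conv_lhs => rw [this]
  rw [map_add, map_add, map_smul, map_smul, map_smul, dX_apply, dY_apply, dZ_apply]
  simp only [smul_eq_mul]
  ring

/-! ### Commutation relations -/

theorem fderiv_fderiv_apply {f : Heis → ℝ} (hf : ContDiff ℝ ∞ f) (p u v : Heis) :
    fderiv ℝ (fun q => fderiv ℝ f q u) p v = fderiv ℝ (fderiv ℝ f) p v u := by
  have : DifferentiableAt ℝ (fderiv ℝ f) p :=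
    (hf.fderiv_right (m := ∞) (by simp)).differentiable (by simp) p
  rw [fderiv_clm_apply this (differentiableAt_const u)]
  simp

theorem fderiv_fderiv_comm {f : Heis → ℝ} (hf : ContDiff ℝ ∞ f) (p u v : Heis) :
    fderiv ℝ (fderiv ℝ f) p u v = fderiv ℝ (fderiv ℝ f) p v u :=
  (hf.contDiffAt.isSymmSndFDerivAt (by simpa using WithTop.coe_le_coe.2 (le_top : (2 : ℕ∞) ≤ ⊤))).eq u v

theorem differentiable_fderiv_apply {f : Heis → ℝ} (hf : ContDiff ℝ ∞ f) (u : Heis) :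
    Differentiable ℝ (fun q => fderiv ℝ f q u) :=
  ((hf.fderiv_right (m := ∞) (by simp)).differentiable (by simp)).clm_apply
    (differentiable_const u)

theorem fderiv_dX (f : InvFun) (p v : Heis) :
    fderiv ℝ (dX f).1 p v = fderiv ℝ (fderiv ℝ f.1) p v (Pi.single 0 1) := by
  rw [show (dX f).1 = _ from funext (dX_apply f), fderiv_fderiv_apply f.contDiff]

theorem fderiv_dZ (f : InvFun) (p v : Heis) :
    fderiv ℝ (dZ f).1 p v = fderiv ℝ (fderiv ℝ f.1) p v (Pi.single 2 1) := by
  rw [show (dZ f).1 = _ from funext (dZ_apply f), fderiv_fderiv_apply f.contDiff]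

/-- The last term comes from differentiating the coefficient x of Y = ∂_y + x ∂_z; it produces [X,
Y] = Z. -/
theorem fderiv_dY (f : InvFun) (p v : Heis) :
    fderiv ℝ (dY f).1 p v = fderiv ℝ (fderiv ℝ f.1) p v (Pi.single 1 1)
      + p 0 * fderiv ℝ (fderiv ℝ f.1) p v (Pi.single 2 1)
      + v 0 * fderiv ℝ f.1 p (Pi.single 2 1) := by
  have h0 : HasFDerivAt (fun q : Heis => q 0) (ContinuousLinearMap.proj (R := ℝ) 0) p :=
    (ContinuousLinearMap.proj (R := ℝ) (φ := fun _ : Fin 3 => ℝ) 0).hasFDerivAt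
  have h1 := (differentiable_fderiv_apply f.contDiff (Pi.single 1 1) p).hasFDerivAt
  have h2 := (differentiable_fderiv_apply f.contDiff (Pi.single 2 1) p).hasFDerivAt
  rw [show (dY f).1 = _ from funext (dY_apply f)]
  rw [(h1.fun_add (h0.fun_mul h2)).fderiv]
  simp [fderiv_fderiv_apply f.contDiff]
  ring

theorem dX_dZ (f : InvFun) : dX (dZ f) = dZ (dX f) := Subtype.ext <| funext fun p => by
  rw [dX_apply, dZ_apply, fderiv_dX, fderiv_dZ, fderiv_fderiv_comm f.contDiff]

theorem dX_dY (f : InvFun) : dX (dY f) = dY (dX f) + dZ f := Subtype.ext <| funext fun p => by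
  change (dX (dY f)).1 p = (dY (dX f)).1 p + (dZ f).1 p
  rw [dX_apply, dY_apply, dZ_apply, fderiv_dY, fderiv_dX, fderiv_dX,
    fderiv_fderiv_comm f.contDiff p (Pi.single 1 1),
    fderiv_fderiv_comm f.contDiff p (Pi.single 2 1)]
  simp

/-! ### Periodicity -/

theorem single_mem_lattice (i : Fin 3) : (Pi.single i 1 : Heis) ∈ lattice := fun j => by
  rcases eq_or_ne j i with rfl | h
  · exact ⟨1, by simp⟩
  · exact ⟨0, by simp [h]⟩

theorem InvFun.add_single_one (f : InvFun) (p : Heis) : f.1 (p + Pi.single 1 1) = f.1 p := by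
  rw [← f.invariant (single_mem_lattice 1) p]
  refine congrArg f.1 ?_
  ext i
  fin_cases i <;> simp [hmul, add_comm]

theorem InvFun.add_single_two (f : InvFun) (p : Heis) : f.1 (p + Pi.single 2 1) = f.1 p := by
  rw [← f.invariant (single_mem_lattice 2) p]
  refine congrArg f.1 ?_
  ext i
  fin_cases i <;> simp [hmul, add_comm]

theorem add_smul_eq_of_fderiv {f : Heis → ℝ} (hf : ContDiff ℝ 1 f) {v : Heis}
    (h : ∀ p, fderiv ℝ f p v = 0) (p : Heis) (s : ℝ) : f (p + s • v) = f p := by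
  have := is_const_of_deriv_eq_zero (f := fun s : ℝ => f (p + s • v))
    (fun s => (hasDerivAt_line hf p v s).differentiableAt)
    (fun s => by rw [(hasDerivAt_line hf p v s).deriv, h]) s 0
  simpa using this

theorem InvFun.add_smul_two {f : InvFun} (hf : dZ f = 0) (p : Heis) (s : ℝ) :
    f.1 (p + s • Pi.single 2 1) = f.1 p :=
  add_smul_eq_of_fderiv f.contDiff_one (fun q => by rw [← dZ_apply, hf]; rfl) p s

theorem InvFun.add_smul_zero {f : InvFun} (hf : dX f = 0) (p : Heis) (s : ℝ) :
    f.1 (p + s • Pi.single 0 1) = f.1 p :=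
  add_smul_eq_of_fderiv f.contDiff_one (fun q => by rw [← dX_apply, hf]; rfl) p s

/-- The lattice element (1, 0, 0) acts by (x, y, z) ↦ (x + 1, y, z + y), and a Z-invariant function
does not see the shift of z. Such functions live on the torus with coordinates x, y. -/
theorem InvFun.add_single_zero {f : InvFun} (hf : dZ f = 0) (p : Heis) :
    f.1 (p + Pi.single 0 1) = f.1 p := by
  rw [← f.invariant (single_mem_lattice 0) p, ← InvFun.add_smul_two hf _ (p 1)]
  refine congrArg f.1 ?_
  ext i
  fin_cases i <;> simp [hmul, add_comm]

/-! ### Averages along the centre and along the leaves -/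

/-- Averaging along a translation in the `(x, z)`-plane, as an operator on `C^∞(M)`. -/
def transOp (w : ℝ → ℝ) (hw : Continuous w) (v : Heis) (hv : v 1 = 0) : InvFun →ₗ[ℝ] InvFun where
  toFun f := ⟨transAvg w v f.1, contDiff_transAvg hw v f.contDiff, fun a ha p => by
    -- Left translation adds `a 0 * p 1` to the last coordinate, so it commutes with translations
    -- that fix y.
    have h : ∀ s : ℝ, hmul a p + s • v = hmul a (p + s • v) := fun s => by
      ext i
      fin_cases i <;> simp [hmul, hv] <;> ring
    simp only [transAvg, h, f.invariant ha]⟩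
  map_add' f g := Subtype.ext <| funext fun p => by
    change ∫ s in (0 : ℝ)..1, w s • (f.1 (p + s • v) + g.1 (p + s • v)) =
      (∫ s in (0 : ℝ)..1, w s • f.1 (p + s • v)) + ∫ s in (0 : ℝ)..1, w s • g.1 (p + s • v)
    rw [← intervalIntegral.integral_add (intervalIntegrable_transAvg hw v f.continuous p _ _)
      (intervalIntegrable_transAvg hw v g.continuous p _ _)]
    simp only [smul_add]
  map_smul' c f := Subtype.ext <| funext fun p => by
    change ∫ s in (0 : ℝ)..1, w s • (c * f.1 (p + s • v)) =
      c * ∫ s in (0 : ℝ)..1, w s • f.1 (p + s • v)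
    rw [← intervalIntegral.integral_const_mul]
    congr 1
    funext s
    simp only [smul_eq_mul]
    ring

/-- The average over the centre. -/
def avgZ : InvFun →ₗ[ℝ] InvFun := transOp (fun _ => 1) continuous_const (Pi.single 2 1) (by simp)
/-- A primitive along the centre. -/
def primZ : InvFun →ₗ[ℝ] InvFun :=
  transOp (fun s => s - 1 / 2) (by fun_prop) (Pi.single 2 1) (by simp)
/-- The average over the segments of length one of the leaves. -/
def avgX : InvFun →ₗ[ℝ] InvFun := transOp (fun _ => 1) continuous_const (Pi.single 0 1) (by simp)
/-- A primitive along the leaves. -/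
def primX : InvFun →ₗ[ℝ] InvFun :=
  transOp (fun s => s - 1 / 2) (by fun_prop) (Pi.single 0 1) (by simp)

section

variable {w : ℝ → ℝ} {hw : Continuous w} {v : Heis} {hv : v 1 = 0}

theorem fderiv_transOp (f : InvFun) (p u : Heis) :
    fderiv ℝ (transOp w hw v hv f).1 p u = transAvg w v (fun q => fderiv ℝ f.1 q u) p :=
  fderiv_transAvg hw v f.contDiff_one p u

theorem dX_transOp (f : InvFun) : dX (transOp w hw v hv f) = transOp w hw v hv (dX f) :=
  Subtype.ext <| funext fun p => by
    rw [dX_apply, fderiv_transOp]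
    change _ = transAvg w v (dX f).1 p
    rw [show (dX f).1 = _ from funext (dX_apply f)]

theorem dZ_transOp (f : InvFun) : dZ (transOp w hw v hv f) = transOp w hw v hv (dZ f) :=
  Subtype.ext <| funext fun p => by
    rw [dZ_apply, fderiv_transOp]
    change _ = transAvg w v (dZ f).1 p
    rw [show (dZ f).1 = _ from funext (dZ_apply f)]

/-- The coefficient x of Y changes under translation in x, which creates a Z-derivative; either
hypothesis removes it. -/
theorem dY_transOp (f : InvFun) (h : v 0 = 0 ∨ dZ f = 0) :
    dY (transOp w hw v hv f) = transOp w hw v hv (dY f) :=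
  Subtype.ext <| funext fun p => by
    have hf' : Continuous (fderiv ℝ f.1) := f.contDiff_one.continuous_fderiv one_ne_zero
    rw [dY_apply, fderiv_transOp, fderiv_transOp]
    change _ = transAvg w v (dY f).1 p
    rw [show (dY f).1 = _ from funext (dY_apply f), transAvg, transAvg, transAvg,
      ← intervalIntegral.integral_const_mul, ← intervalIntegral.integral_add
        (Continuous.intervalIntegrable (by fun_prop) _ _)
        (Continuous.intervalIntegrable (by fun_prop) _ _)]
    congr 1
    funext s
    rcases h with h | h
    · simp [h]
      ring
    · rw [← dZ_apply, h]
      simp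

end

theorem dZ_primZ (f : InvFun) : dZ (primZ f) = f - avgZ f := Subtype.ext <| funext fun p => by
  rw [dZ_apply]
  refine (fderiv_transAvg_sub_half _ f.contDiff_one p).trans ?_
  rw [f.add_single_two]
  change _ = f.1 p - (avgZ f).1 p
  simp only [avgZ, transOp, LinearMap.coe_mk, AddHom.coe_mk]
  ring

theorem dZ_avgZ (f : InvFun) : dZ (avgZ f) = 0 := Subtype.ext <| funext fun p => by
  rw [dZ_apply]
  refine (fderiv_transAvg_one _ f.contDiff_one p).trans ?_
  rw [f.add_single_two, sub_self]
  rfl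

theorem dX_primX {f : InvFun} (hf : dZ f = 0) : dX (primX f) = f - avgX f :=
  Subtype.ext <| funext fun p => by
    rw [dX_apply]
    refine (fderiv_transAvg_sub_half _ f.contDiff_one p).trans ?_
    rw [f.add_single_zero hf]
    change _ = f.1 p - (avgX f).1 p
    simp only [avgX, transOp, LinearMap.coe_mk, AddHom.coe_mk]
    ring

theorem dX_avgX {f : InvFun} (hf : dZ f = 0) : dX (avgX f) = 0 := Subtype.ext <| funext fun p => by
  rw [dX_apply]
  refine (fderiv_transAvg_one _ f.contDiff_one p).trans ?_
  rw [f.add_single_zero hf, sub_self]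
  rfl

theorem dX_primZ (f : InvFun) : dX (primZ f) = primZ (dX f) := dX_transOp f
theorem dY_primZ (f : InvFun) : dY (primZ f) = primZ (dY f) := dY_transOp f (by simp)
theorem dX_avgZ (f : InvFun) : dX (avgZ f) = avgZ (dX f) := dX_transOp f
theorem dY_avgZ (f : InvFun) : dY (avgZ f) = avgZ (dY f) := dY_transOp f (by simp)
theorem dZ_primX (f : InvFun) : dZ (primX f) = primX (dZ f) := dZ_transOp f
theorem dZ_avgX (f : InvFun) : dZ (avgX f) = avgX (dZ f) := dZ_transOp f
theorem dX_primX_comm (f : InvFun) : dX (primX f) = primX (dX f) := dX_transOp f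
theorem dZ_primZ_comm (f : InvFun) : dZ (primZ f) = primZ (dZ f) := dZ_transOp f
theorem dY_primX {f : InvFun} (hf : dZ f = 0) : dY (primX f) = primX (dY f) :=
  dY_transOp f (Or.inr hf)

theorem dY_avgX {f : InvFun} (hf : dZ f = 0) : dY (avgX f) = avgX (dY f) :=
  dY_transOp f (Or.inr hf)

/-! ### Integration over `M` -/

/-- The integral over `M` with respect to `dx dy dz`. -/
def integ : InvFun →ₗ[ℝ] ℝ where
  toFun f := ∫ p in Set.Icc (0 : Heis) 1, f.1 p
  map_add' f g := integral_add (f.continuous.continuousOn.integrableOn_compact isCompact_Icc)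
    (g.continuous.continuousOn.integrableOn_compact isCompact_Icc)
  map_smul' c _ := integral_const_mul c _

theorem integ_algebraMap (c : ℝ) : integ (algebraMap ℝ InvFun c) = c := by
  change ∫ p in Set.Icc (0 : Heis) 1, c = c
  simp [Measure.real, Real.volume_Icc_pi]

theorem integ_one : integ 1 = 1 := by simpa using integ_algebraMap 1

theorem integ_dZ (f : InvFun) : integ (dZ f) = 0 := by
  change ∫ p in Set.Icc (0 : Heis) 1, (dZ f).1 p = 0
  simp only [dZ_apply]
  exact integral_cube_fderiv_eq_zero 2 f.contDiff_one f.add_single_two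

theorem integ_dY (f : InvFun) : integ (dY f) = 0 := by
  change ∫ p in Set.Icc (0 : Heis) 1, (dY f).1 p = 0
  have hf' : Continuous (fderiv ℝ f.1) := f.contDiff_one.continuous_fderiv one_ne_zero
  -- Since x does not depend on z, x ∂_z f = ∂_z (x f), and x f is still periodic in z.
  have h2 : ∀ p : Heis, p 0 * fderiv ℝ f.1 p (Pi.single 2 1) =
      fderiv ℝ (fun q : Heis => q 0 * f.1 q) p (Pi.single 2 1) := fun p => by
    have h0 : HasFDerivAt (fun q : Heis => q 0) (ContinuousLinearMap.proj (R := ℝ) 0) p :=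
      (ContinuousLinearMap.proj (R := ℝ) (φ := fun _ : Fin 3 => ℝ) 0).hasFDerivAt
    rw [(h0.fun_mul (f.differentiable p).hasFDerivAt).fderiv]
    simp
  simp only [dY_apply, h2]
  rw [integral_add, integral_cube_fderiv_eq_zero 1 f.contDiff_one f.add_single_one,
    integral_cube_fderiv_eq_zero 2, add_zero]
  · have := f.contDiff_one
    fun_prop
  · intro p
    rw [f.add_single_two]
    simp
  · exact Continuous.integrableOn_Icc (by fun_prop)
  · simp only [← h2]
    exact Continuous.integrableOn_Icc (by fun_prop)

/-- An invariant function need not be periodic in x. Its average over the centre is, and the rest is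
a Z-derivative, which X preserves because it commutes with Z. -/
theorem integ_dX (f : InvFun) : integ (dX f) = 0 := by
  have h : f = avgZ f + dZ (primZ f) := by rw [dZ_primZ]; abel
  rw [h, map_add, map_add, dX_dZ, integ_dZ, add_zero]
  change ∫ p in Set.Icc (0 : Heis) 1, (dX (avgZ f)).1 p = 0
  simp only [dX_apply]
  exact integral_cube_fderiv_eq_zero 0 (avgZ f).contDiff_one (InvFun.add_single_zero (dZ_avgZ f))

theorem integ_dX_mul (f g : InvFun) : integ (dX f * g) = -integ (f * dX g) := by
  rw [eq_neg_iff_add_eq_zero, ← map_add, ← lieDer_mul, integ_dX]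

theorem integ_dY_mul (f g : InvFun) : integ (dY f * g) = -integ (f * dY g) := by
  rw [eq_neg_iff_add_eq_zero, ← map_add, ← lieDer_mul, integ_dY]

theorem integ_dZ_mul (f g : InvFun) : integ (dZ f * g) = -integ (f * dZ g) := by
  rw [eq_neg_iff_add_eq_zero, ← map_add, ← lieDer_mul, integ_dZ]

theorem integ_mono {f g : InvFun} (h : ∀ p, f.1 p ≤ g.1 p) : integ f ≤ integ g :=
  integral_mono (f.continuous.continuousOn.integrableOn_compact isCompact_Icc)
    (g.continuous.continuousOn.integrableOn_compact isCompact_Icc) h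

/-- The squared `L²` norm. -/
def nsq (f : InvFun) : ℝ := integ (f * f)

theorem nsq_nonneg (f : InvFun) : 0 ≤ nsq f :=
  (map_zero integ).symm.le.trans (integ_mono fun p => mul_self_nonneg (f.1 p))

theorem exists_lattice_hmul_mem_cube (p : Heis) :
    ∃ a ∈ lattice, hmul a p ∈ Set.Icc (0 : Heis) 1 := by
  refine ⟨![-⌊p 0⌋, -⌊p 1⌋, -⌊p 2 - ⌊p 0⌋ * p 1⌋], ?_, ?_⟩
  · intro i
    fin_cases i
    exacts [⟨-⌊p 0⌋, by simp⟩, ⟨-⌊p 1⌋, by simp⟩, ⟨-⌊p 2 - ⌊p 0⌋ * p 1⌋, by simp⟩]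
  · have h := fun x : ℝ => And.intro (Int.floor_le x) (Int.lt_floor_add_one x).le
    constructor <;> intro i <;> fin_cases i <;> simp [hmul]
    · exact (h (p 0)).1
    · exact (h (p 1)).1
    · linarith [(h (p 2 - ⌊p 0⌋ * p 1)).1]
    · exact (h (p 0)).2
    · linarith [(h (p 1)).2]
    · linarith [(h (p 2 - ⌊p 0⌋ * p 1)).2]

/-- Vanishing almost everywhere on the cube becomes vanishing on all of it, as the cube is the
closure of its interior; lattice translates then reach every point. -/
theorem eq_zero_of_nsq {f : InvFun} (h : nsq f = 0) : f = 0 := by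
  have hc := f.continuous
  have h1 : (fun p => f.1 p * f.1 p) =ᵐ[volume.restrict (Set.Icc (0 : Heis) 1)] 0 := by
    rw [← integral_eq_zero_iff_of_nonneg (fun p => mul_self_nonneg _)
      (Continuous.integrableOn_Icc (hc.mul hc))]
    exact h
  have h2 : Set.EqOn (fun p => f.1 p * f.1 p) 0 (Set.Icc (0 : Heis) 1) := by
    refine Measure.eqOn_of_ae_eq h1 (hc.mul hc).continuousOn continuousOn_const ?_
    rw [← Set.pi_univ_Icc, interior_pi_set Set.finite_univ, closure_pi_set]
    refine Set.pi_mono fun i _ => ?_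
    simp
  refine Subtype.ext <| funext fun p => ?_
  obtain ⟨a, ha, hp⟩ := exists_lattice_hmul_mem_cube p
  rw [← f.invariant ha]
  exact mul_self_eq_zero.1 (h2 hp)

theorem nsq_neg (f : InvFun) : nsq (-f) = nsq f := by rw [nsq, nsq, show -f * -f = f * f by ring]

theorem nsq_add_le (f g : InvFun) : nsq (f + g) ≤ 2 * nsq f + 2 * nsq g := by
  have h := nsq_nonneg (f - g)
  have : nsq (f + g) + nsq (f - g) = 2 * nsq f + 2 * nsq g := by
    simp only [nsq]
    rw [← map_add, show (f + g) * (f + g) + (f - g) * (f - g) = f * f + f * f + (g * g + g * g) by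
      ring]
    simp only [map_add]
    ring
  linarith

theorem nsq_algebraMap (c : ℝ) : nsq (algebraMap ℝ InvFun c) = c ^ 2 := by
  rw [nsq, ← map_mul, integ_algebraMap, sq]

theorem integ_algebraMap_mul (c : ℝ) (f : InvFun) : integ (algebraMap ℝ InvFun c * f) = c * integ f := by
  rw [← Algebra.smul_def, map_smul, smul_eq_mul]

theorem sq_integ_le (f : InvFun) : integ f ^ 2 ≤ nsq f := by
  have h := nsq_nonneg (f - algebraMap ℝ InvFun (integ f))
  have h2 : (f - algebraMap ℝ InvFun (integ f)) * (f - algebraMap ℝ InvFun (integ f)) =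
      f * f - algebraMap ℝ InvFun (integ f) * f - algebraMap ℝ InvFun (integ f) * f
        + algebraMap ℝ InvFun (integ f) * algebraMap ℝ InvFun (integ f) := by ring
  rw [nsq, h2, map_add, map_sub, map_sub, integ_algebraMap_mul, integ_algebraMap_mul,
    integ_algebraMap] at h
  rw [nsq]
  nlinarith

/-! ### L² bounds for averages and primitives. -/

theorem abs_sub_half_le_one : ∀ s ∈ Set.Icc (0 : ℝ) 1, |s - 1 / 2| ≤ 1 := fun s hs => by
  rw [abs_le]
  constructor <;> linarith [hs.1, hs.2]

theorem integ_avgZ (f : InvFun) : integ (avgZ f) = integ f := by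
  rw [← sub_eq_zero, ← neg_eq_zero, neg_sub, ← map_sub, ← dZ_primZ, integ_dZ]

theorem integ_avgX {f : InvFun} (hf : dZ f = 0) : integ (avgX f) = integ f := by
  rw [← sub_eq_zero, ← neg_eq_zero, neg_sub, ← map_sub, ← dX_primX hf, integ_dX]

theorem dZ_mul_self {f : InvFun} (hf : dZ f = 0) : dZ (f * f) = 0 := by
  rw [lieDer_mul, hf]
  simp

/-- The pointwise bound of the square by the average of the squares suffices, because averaging
preserves the integral. The next three bounds have the same proof. -/
theorem nsq_primZ_le (f : InvFun) : nsq (primZ f) ≤ nsq f := by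
  rw [nsq, nsq, ← integ_avgZ (f * f)]
  refine integ_mono fun p => ?_
  exact (sq _).symm.le.trans (sq_transAvg_le (by fun_prop) abs_sub_half_le_one _ f.continuous p)

theorem nsq_avgZ_le (f : InvFun) : nsq (avgZ f) ≤ nsq f := by
  rw [nsq, nsq, ← integ_avgZ (f * f)]
  refine integ_mono fun p => ?_
  exact (sq _).symm.le.trans (sq_transAvg_le (by fun_prop) (by simp) _ f.continuous p)

theorem nsq_primX_le {f : InvFun} (hf : dZ f = 0) : nsq (primX f) ≤ nsq f := by
  rw [nsq, nsq, ← integ_avgX (dZ_mul_self hf)]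
  refine integ_mono fun p => ?_
  exact (sq _).symm.le.trans (sq_transAvg_le (by fun_prop) abs_sub_half_le_one _ f.continuous p)

theorem nsq_avgX_le {f : InvFun} (hf : dZ f = 0) : nsq (avgX f) ≤ nsq f := by
  rw [nsq, nsq, ← integ_avgX (dZ_mul_self hf)]
  refine integ_mono fun p => ?_
  exact (sq _).symm.le.trans (sq_transAvg_le (by fun_prop) (by simp) _ f.continuous p)

/-! ### Functions constant along the leaves -/

/-- Here Zf = XYf - YXf = XYf, so the square norm of Zf is -⟨Yf, XZf⟩ = -⟨Yf, ZXf⟩ = 0. -/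
theorem dZ_eq_zero_of_dX_eq_zero {f : InvFun} (hf : dX f = 0) : dZ f = 0 := by
  have h1 : dZ f = dX (dY f) := by rw [dX_dY, hf]; simp
  refine eq_zero_of_nsq ?_
  rw [nsq]
  nth_rw 1 [h1]
  rw [integ_dX_mul, dX_dZ, hf]
  simp

/-- X is skew-adjoint, so its kernel and its image are orthogonal. -/
theorem eq_zero_of_dX_eq {k g : InvFun} (hk : dX k = 0) (h : dX g = k) : k = 0 := by
  refine eq_zero_of_nsq ?_
  rw [nsq]
  nth_rw 1 [← h]
  rw [integ_dX_mul, hk]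
  simp

theorem eq_algebraMap_integ {f : InvFun} (hX : dX f = 0) (hY : dY f = 0) (hZ : dZ f = 0) :
    f = algebraMap ℝ InvFun (integ f) := by
  have h : ∀ p, fderiv ℝ f.1 p = 0 := fun p => by
    ext v
    rw [fderiv_eq_frame, hX, hY, hZ]
    simp
  have hc : f = algebraMap ℝ InvFun (f.1 0) := Subtype.ext <| funext fun p =>
    is_const_of_fderiv_eq_zero f.differentiable h p 0
  rw [hc, integ_algebraMap]

/-- The function `f(y)` on `M`. -/
def circlePull : circleFunctions →ₗ[ℝ] InvFun where
  toFun f := ⟨fun p => f.1 (p 1), f.2.1.comp (contDiff_apply ℝ ℝ 1), fun a ha p => by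
    obtain ⟨n, hn⟩ := ha 1
    have := f.2.2.int_mul n (p 1)
    simpa [hmul, hn, add_comm] using this⟩
  map_add' _ _ := rfl
  map_smul' _ _ := rfl

theorem circlePull_apply (f : circleFunctions) (p : Heis) : (circlePull f).1 p = f.1 (p 1) := rfl

theorem circlePull_injective : Function.Injective circlePull := fun _ _ h =>
  Subtype.ext <| funext fun t => congrFun (congrArg Subtype.val h) (fun _ => t)

theorem hasFDerivAt_circlePull (f : circleFunctions) (p : Heis) :
    HasFDerivAt (circlePull f).1 (deriv f.1 (p 1) • ContinuousLinearMap.proj (R := ℝ) 1) p := by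
  have h0 : HasFDerivAt (fun q : Heis => q 1) (ContinuousLinearMap.proj (R := ℝ) 1) p :=
    (ContinuousLinearMap.proj (R := ℝ) (φ := fun _ : Fin 3 => ℝ) 1).hasFDerivAt
  exact (f.2.1.differentiable (by simp) (p 1)).hasDerivAt.comp_hasFDerivAt p h0

theorem dX_circlePull (f : circleFunctions) : dX (circlePull f) = 0 :=
  Subtype.ext <| funext fun p => by
    rw [dX_apply, (hasFDerivAt_circlePull f p).fderiv]
    simp

theorem dZ_circlePull (f : circleFunctions) : dZ (circlePull f) = 0 :=
  Subtype.ext <| funext fun p => by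
    rw [dZ_apply, (hasFDerivAt_circlePull f p).fderiv]
    simp

/-- The derivative of functions on the circle. -/
def circleDeriv : circleFunctions →ₗ[ℝ] circleFunctions where
  toFun f := ⟨deriv f.1, (contDiff_infty_iff_deriv.1 f.2.1).2, fun t => by
    rw [← deriv_comp_add_const]
    exact congrArg (fun g => deriv g t) (funext f.2.2)⟩
  map_add' f g := Subtype.ext <| funext fun t =>
    deriv_add (f.2.1.differentiable (by simp) t) (g.2.1.differentiable (by simp) t)
  map_smul' c f := Subtype.ext <| funext fun t =>
    deriv_const_smul c (f.2.1.differentiable (by simp) t)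

theorem dY_circlePull (f : circleFunctions) : dY (circlePull f) = circlePull (circleDeriv f) :=
  Subtype.ext <| funext fun p => by
    rw [dY_apply, (hasFDerivAt_circlePull f p).fderiv]
    simp [circlePull_apply, circleDeriv]

/-- Invariance along x and z leaves only the restriction of `f` to the y-axis. -/
theorem exists_circlePull_eq {f : InvFun} (hf : dX f = 0) : ∃ g, circlePull g = f := by
  have hZ := dZ_eq_zero_of_dX_eq_zero hf
  refine ⟨⟨fun t => f.1 (t • Pi.single 1 1), f.contDiff.comp (contDiff_id.smul contDiff_const),
    fun t => ?_⟩, Subtype.ext <| funext fun p => ?_⟩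
  · beta_reduce
    rw [add_smul, one_smul, f.add_single_one]
  · rw [circlePull_apply]
    beta_reduce
    rw [← InvFun.add_smul_zero hf _ (p 0), ← InvFun.add_smul_two hZ _ (p 2)]
    refine congrArg f.1 ?_
    ext i
    fin_cases i <;> simp

/-- The hypotheses make `f` a function of y, so this is the primitive of a mean-zero function on the
circle, again with weight s - 1/2. -/
theorem exists_primitive_dY {f : InvFun} (hX : dX f = 0) (hZ : dZ f = 0) :
    ∃ g, dX g = 0 ∧ dZ g = 0 ∧ dY g = f - algebraMap ℝ InvFun (integ f) ∧ nsq g ≤ nsq f := by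
  -- Translation in y commutes with left translation only up to a central translation, which is
  -- invisible to Z-invariant functions. Hence the average `T` below needs `dZ k = 0`.
  have hsingle : ∀ a p : Heis, ∀ s : ℝ, hmul a p + s • Pi.single 1 1 =
      hmul a (p + s • Pi.single 1 1) + (-(a 0 * s)) • Pi.single 2 1 := fun a p s => by
    ext i
    fin_cases i <;> simp [hmul] <;> ring
  have hinv : ∀ {k : InvFun}, dZ k = 0 → ∀ a ∈ lattice, ∀ (p : Heis) (s : ℝ),
      k.1 (hmul a p + s • Pi.single 1 1) = k.1 (p + s • Pi.single 1 1) := fun hk a ha p s => by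
    rw [hsingle, InvFun.add_smul_two hk, InvFun.invariant _ ha]
  let T (w : ℝ → ℝ) (hw : Continuous w) (k : InvFun) (hk : dZ k = 0) : InvFun :=
    ⟨transAvg w (Pi.single 1 1) k.1, contDiff_transAvg hw _ k.contDiff, fun a ha p => by
      simp only [transAvg, hinv hk a ha]⟩
  have hTX : ∀ w hw k hk, dX k = 0 → dX (T w hw k hk) = 0 := fun w hw k hk hkX =>
    Subtype.ext <| funext fun p => by
      rw [dX_apply]
      refine (fderiv_transAvg hw _ k.contDiff_one p _).trans ?_
      simp only [← dX_apply, hkX]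
      simp [transAvg]
  have hTZ : ∀ w hw k hk, dZ (T w hw k hk) = 0 := fun w hw k hk =>
    Subtype.ext <| funext fun p => by
      rw [dZ_apply]
      refine (fderiv_transAvg hw _ k.contDiff_one p _).trans ?_
      simp only [← dZ_apply, hk]
      simp [transAvg]
  have hYapply : ∀ k : InvFun, dZ k = 0 → ∀ p,
      (dY k).1 p = fderiv ℝ k.1 p (Pi.single 1 1) := fun k hk p => by
    rw [dY_apply, ← dZ_apply, hk]
    simp
  have hG : ∀ k hk, dY (T (fun s => s - 1 / 2) (by fun_prop) k hk) =
      k - T (fun _ => 1) continuous_const k hk := fun k hk => Subtype.ext <| funext fun p => by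
    rw [hYapply _ (hTZ _ (by fun_prop) k hk)]
    refine (fderiv_transAvg_sub_half _ k.contDiff_one p).trans ?_
    rw [k.add_single_one]
    change _ = k.1 p - transAvg (fun _ => 1) _ k.1 p
    ring
  have hA : ∀ k hk, dX k = 0 → T (fun _ => 1) continuous_const k hk =
      algebraMap ℝ InvFun (integ k) := fun k hk hkX => by
    have h1 : dY (T (fun _ => 1) continuous_const k hk) = 0 := Subtype.ext <| funext fun p => by
      rw [hYapply _ (hTZ _ (by fun_prop) k hk)]
      refine (fderiv_transAvg_one _ k.contDiff_one p).trans ?_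
      rw [k.add_single_one, sub_self]
      rfl
    have h2 := eq_algebraMap_integ (hTX _ continuous_const k hk hkX) h1
      (hTZ _ continuous_const k hk)
    have h3 : integ (T (fun _ => 1) continuous_const k hk) = integ k := by
      rw [← sub_eq_zero, ← neg_eq_zero, neg_sub, ← map_sub, ← hG k hk, integ_dY]
    rw [h2, h3]
  have hw : Continuous fun s : ℝ => s - 1 / 2 := by fun_prop
  refine ⟨T (fun s => s - 1 / 2) hw f hZ, hTX _ hw f hZ hX, hTZ _ hw f hZ, ?_, ?_⟩
  · rw [hG f hZ, hA f hZ hX]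
  · have hX2 : dX (f * f) = 0 := by rw [lieDer_mul, hX]; simp
    have h1 : nsq f = integ (T (fun _ => 1) continuous_const (f * f) (dZ_mul_self hZ)) := by
      rw [hA _ (dZ_mul_self hZ) hX2, integ_algebraMap, nsq]
    rw [h1, nsq]
    refine integ_mono fun p => ?_
    exact (sq _).symm.le.trans (sq_transAvg_le (by fun_prop) abs_sub_half_le_one _ f.continuous p)

/-! ### Primitives of closed forms, in terms of coefficients -/

/-- Telescoping: w minus its Z-average is a Z-derivative, that average minus its X-average is an
X-derivative, and what remains is a mean-zero function of y. -/
theorem exists_primitive_three {w : InvFun} (hw : integ w = 0) :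
    ∃ a b c, dZ a - dY b + dX c = w ∧ nsq a ≤ nsq w ∧ nsq b ≤ nsq w ∧ nsq c ≤ nsq w := by
  have hZ := dZ_avgZ w
  have hXZ : dZ (avgX (avgZ w)) = 0 := by rw [dZ_avgX, hZ, map_zero]
  obtain ⟨b, -, -, hb, hb2⟩ := exists_primitive_dY (dX_avgX hZ) hXZ
  have h1 := nsq_avgZ_le w
  refine ⟨primZ w, -b, primX (avgZ w), ?_, nsq_primZ_le w, ?_, (nsq_primX_le hZ).trans h1⟩
  · rw [dZ_primZ, dX_primX hZ, map_neg, hb, integ_avgX hZ, integ_avgZ, hw, map_zero]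
    abel
  · rw [nsq_neg]
    exact hb2.trans ((nsq_avgX_le hZ).trans h1)

/-- The X-average of b is constant, since its Y-derivative is X applied to the X-average of c; the
period makes it zero. Thus `primX b` settles the X-direction, and the remaining error in Y is a
function of y. -/
theorem exists_primitive_torus_one {b c : InvFun} (hb : dZ b = 0) (hc : dZ c = 0)
    (hbc : dX c = dY b) (hb0 : integ b = 0) (hc0 : integ c = 0) :
    ∃ k, dZ k = 0 ∧ dX k = b ∧ dY k = c ∧ nsq k ≤ 2 * nsq b + 2 * nsq c := by
  have hb1 : avgX b = 0 := by
    have h1 : dY (avgX b) = 0 := by rw [dY_avgX hb, ← hbc, avgX, ← dX_transOp, ← avgX, dX_avgX hc]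
    have h2 : dZ (avgX b) = 0 := by rw [dZ_avgX, hb, map_zero]
    rw [eq_algebraMap_integ (dX_avgX hb) h1 h2, integ_avgX hb, hb0, map_zero]
  have hc1 : dZ (avgX c) = 0 := by rw [dZ_avgX, hc, map_zero]
  obtain ⟨k, hkX, hkZ, hkY, hk⟩ := exists_primitive_dY (dX_avgX hc) hc1
  refine ⟨primX b + k, ?_, ?_, ?_, ?_⟩
  · rw [map_add, dZ_primX, hb, map_zero, hkZ, add_zero]
  · rw [map_add, dX_primX hb, hb1, hkX]
    simp
  · rw [map_add, dY_primX hb, ← hbc, ← dX_primX_comm, dX_primX hc, hkY, integ_avgX hc, hc0,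
      map_zero]
    abel
  · have := nsq_add_le (primX b) k
    linarith [nsq_primX_le hb, nsq_avgX_le hc]

theorem exists_primitive_torus_two {w : InvFun} (hw : dZ w = 0) :
    ∃ f g, dZ f = 0 ∧ dZ g = 0 ∧ dX g - dY f = w - algebraMap ℝ InvFun (integ w) ∧
      nsq f ≤ nsq w ∧ nsq g ≤ nsq w := by
  have h1 : dZ (avgX w) = 0 := by rw [dZ_avgX, hw, map_zero]
  obtain ⟨k, hkX, hkZ, hkY, hk⟩ := exists_primitive_dY (dX_avgX hw) h1
  refine ⟨-k, primX w, by rw [map_neg, hkZ, neg_zero], by rw [dZ_primX, hw, map_zero], ?_, ?_,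
    nsq_primX_le hw⟩
  · rw [dX_primX hw, map_neg, hkY, integ_avgX hw]
    abel
  · rw [nsq_neg]
    exact hk.trans (nsq_avgX_le hw)

/-- `primZ` removes the parts of b and c with zero Z-average, leaving a closed 1-form on the torus
with primitive k. No condition on the integral of a is needed: only the derivatives of k matter for
b and c, so k may be shifted by a constant, which reflects α ∧ β = -dθ. The constant 100 is crude.
-/
theorem exists_primitive_two {a b c : InvFun} (hcl : dZ a - dY b + dX c = 0) (hb0 : integ b = 0)
    (hc0 : integ c = 0) :
    ∃ f g k, dX g - dY f - k = a ∧ dX k - dZ f = b ∧ dY k - dZ g = c ∧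
      nsq f + nsq g + nsq k ≤ 100 * (nsq a + nsq b + nsq c) := by
  have hza : primZ (dX c) - primZ (dY b) = -(a - avgZ a) := by
    rw [← dZ_primZ, dZ_primZ_comm, ← map_sub, ← map_neg]
    congr 1
    rw [← sub_eq_zero, ← hcl]
    abel
  have hcl' : dX (avgZ c) = dY (avgZ b) := by
    have : avgZ (dZ a - dY b + dX c) = 0 := by rw [hcl, map_zero]
    rw [map_add, map_sub, ← dX_avgZ, ← dY_avgZ,
      show avgZ (dZ a) = 0 by rw [avgZ, ← dZ_transOp, ← avgZ, dZ_avgZ]] at this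
    rw [← sub_eq_zero, ← this]
    abel
  obtain ⟨k, hkZ, hkX, hkY, hk⟩ := exists_primitive_torus_one (dZ_avgZ b) (dZ_avgZ c) hcl'
    (by rw [integ_avgZ, hb0]) (by rw [integ_avgZ, hc0])
  set w := avgZ a + k with hw
  have hwZ : dZ w = 0 := by rw [hw, map_add, dZ_avgZ, hkZ, add_zero]
  obtain ⟨f, g, hfZ, hgZ, hfg, hf, hg⟩ := exists_primitive_torus_two hwZ
  -- The shift by `integ w` cancels the constant that obstructs solving dX g - dY f = w.
  refine ⟨-primZ b + f, -primZ c + g, k + -algebraMap ℝ InvFun (integ w), ?_, ?_, ?_, ?_⟩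
  · simp only [map_add, map_neg, dX_primZ, dY_primZ]
    rw [show -primZ (dX c) + dX g - (-primZ (dY b) + dY f) - (k + -algebraMap ℝ InvFun (integ w)) =
      -(primZ (dX c) - primZ (dY b)) + (dX g - dY f) - (k + -algebraMap ℝ InvFun (integ w)) by
        abel, hza, hfg, hw]
    abel
  · simp only [map_add, map_neg, hkX, hfZ, lieDer_algebraMap, dZ_primZ]
    abel
  · simp only [map_add, map_neg, hkY, hgZ, lieDer_algebraMap, dZ_primZ]
    abel
  · have h1 := nsq_add_le (-primZ b) f
    have h2 := nsq_add_le (-primZ c) g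
    have h3 := nsq_add_le k (-algebraMap ℝ InvFun (integ w))
    have h4 := nsq_add_le (avgZ a) k
    rw [← hw] at h4
    rw [nsq_neg, nsq_algebraMap] at h3
    rw [nsq_neg] at h1 h2
    have h5 := sq_integ_le w
    linarith [nsq_primZ_le b, nsq_primZ_le c, nsq_avgZ_le a, nsq_avgZ_le b, nsq_avgZ_le c,
      nsq_nonneg a, nsq_nonneg b, nsq_nonneg c]

/-- The Z-average of k is constant by closedness, and k = Xg - Yf has integral zero; hence k is the
Z-derivative of `primZ k`, and the rest lives on the torus. -/
theorem exists_primitive_one {f g k : InvFun} (h1 : dX g - dY f = k) (h2 : dX k = dZ f)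
    (h3 : dY k = dZ g) (hf : integ f = 0) (hg : integ g = 0) :
    ∃ φ, dX φ = f ∧ dY φ = g ∧ dZ φ = k ∧ nsq φ ≤ 100 * (nsq f + nsq g + nsq k) := by
  have hk : avgZ k = 0 := by
    have hX : dX (avgZ k) = 0 := by rw [dX_avgZ, h2, avgZ, ← dZ_transOp, ← avgZ, dZ_avgZ]
    have hY : dY (avgZ k) = 0 := by rw [dY_avgZ, h3, avgZ, ← dZ_transOp, ← avgZ, dZ_avgZ]
    rw [eq_algebraMap_integ hX hY (dZ_avgZ k), integ_avgZ, ← h1, map_sub, integ_dX, integ_dY]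
    simp
  have hfg : dX (avgZ g) = dY (avgZ f) := by
    rw [dX_avgZ, dY_avgZ, ← sub_eq_zero, ← map_sub, h1, hk]
  obtain ⟨φ, hφZ, hφX, hφY, hφ⟩ := exists_primitive_torus_one (dZ_avgZ f) (dZ_avgZ g) hfg
    (by rw [integ_avgZ, hf]) (by rw [integ_avgZ, hg])
  refine ⟨primZ k + φ, ?_, ?_, ?_, ?_⟩
  · rw [map_add, dX_primZ, h2, ← dZ_primZ_comm, dZ_primZ, hφX]
    abel
  · rw [map_add, dY_primZ, h3, ← dZ_primZ_comm, dZ_primZ, hφY]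
    abel
  · rw [map_add, dZ_primZ, hφZ, hk]
    simp
  · have := nsq_add_le (primZ k) φ
    linarith [nsq_primZ_le k, nsq_avgZ_le f, nsq_avgZ_le g, nsq_nonneg f, nsq_nonneg g,
      nsq_nonneg k]

/-! ### Coefficients of differential forms -/

/-- The constant form `dx_{I 0} ∧ ⋯ ∧ dx_{I (r - 1)}`. -/
def coordForm {r : ℕ} (I : Fin r → Fin 3) : Heis [⋀^Fin r]→L[ℝ] ℝ :=
  { Matrix.detRowAlternating.compLinearMap (LinearMap.funLeft ℝ ℝ I) with
    cont := by
      change Continuous fun v : Fin r → Heis => Matrix.det (Matrix.of fun i j => v i (I j))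
      exact Continuous.matrix_det (by fun_prop) }

theorem coordForm_apply {r : ℕ} (I : Fin r → Fin 3) (v : Fin r → Heis) :
    coordForm I v = Matrix.det (Matrix.of fun i j => v i (I j)) := rfl

/-- Multilinear expansion in coordinates reduces the claim to evaluation at constant vectors, which
is a continuous linear map on alternating forms. -/
theorem contDiff_alternating_apply {r : ℕ} {ξ : Heis → Heis [⋀^Fin r]→L[ℝ] ℝ}
    (hξ : ContDiff ℝ ∞ ξ) {V : Fin r → Heis → Heis} (hV : ∀ k, ContDiff ℝ ∞ (V k)) :
    ContDiff ℝ ∞ fun p => ξ p fun k => V k p := by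
  have h : ∀ p, ξ p (fun k => V k p) =
      ∑ J : Fin r → Fin 3, (∏ k, V k p (J k)) • ξ p (fun k => Pi.single (J k) 1) := fun p => by
    have h1 : (fun k => V k p) = fun k => ∑ j : Fin 3, V k p j • (Pi.single j 1 : Heis) := by
      ext k i
      fin_cases i <;> simp [Fin.sum_univ_three]
    rw [h1]
    refine ((ξ p).toMultilinearMap.map_sum _).trans (Finset.sum_congr rfl fun J _ => ?_)
    exact (ξ p).toMultilinearMap.map_smul_univ _ _
  simp only [h]
  refine ContDiff.sum fun J _ => ?_
  have h2 : ContDiff ℝ ∞ fun p => ∏ k, V k p (J k) :=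
    contDiff_prod fun k _ => (contDiff_apply ℝ ℝ (J k)).comp (hV k)
  exact h2.smul ((ContinuousAlternatingMap.apply ℝ Heis ℝ
    (fun k => (Pi.single (J k) 1 : Heis))).contDiff.comp hξ)

theorem Form.apply_invariant {r : ℕ} (ξ : Form r) {a : Heis} (ha : a ∈ lattice) (p : Heis)
    (v : Fin r → Heis) : ξ.toFun (hmul a p) (fun k => leftDeriv a (v k)) = ξ.toFun p v := by
  conv_rhs => rw [← ξ.invariant ha]
  simp only [pullback, fderiv_hmul]
  rfl

/-- The coefficient of a form with respect to the left-invariant frame `X, Y, Z`. -/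
def frameCoef {r : ℕ} (I : Fin r → Fin 3) : Form r →ₗ[ℝ] InvFun where
  toFun ξ := ⟨fun p => ξ.toFun p fun k => leftField (Pi.single (I k) 1) p,
    contDiff_alternating_apply ξ.contDiff fun _ => contDiff_leftField _, fun a ha p => by
      simp only [← leftDeriv_leftField]
      exact ξ.apply_invariant ha p _⟩
  map_add' ξ η := Subtype.ext <| funext fun p => by simp
  map_smul' c ξ := Subtype.ext <| funext fun p => by simp

theorem frameCoef_apply {r : ℕ} (I : Fin r → Fin 3) (ξ : Form r) (p : Heis) :
    (frameCoef I ξ).1 p = ξ.toFun p fun k => leftField (Pi.single (I k) 1) p := rfl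

theorem frameCoef_perm {r : ℕ} (I : Fin r → Fin 3) (σ : Equiv.Perm (Fin r)) (ξ : Form r) :
    frameCoef (I ∘ σ) ξ = (Equiv.Perm.sign σ : ℤ) • frameCoef I ξ :=
  Subtype.ext <| funext fun p => by
    have := (ξ.toFun p).toAlternatingMap.map_perm
      (fun k => leftField (Pi.single (I k) 1) p) σ
    rw [Units.smul_def] at this
    exact this.trans (by simp [frameCoef_apply])

theorem Form.ext_apply {r : ℕ} {ξ η : Form r} (h : ∀ p v, ξ.toFun p v = η.toFun p v) : ξ = η :=
  Subtype.ext <| funext fun p => ContinuousAlternatingMap.ext (h p)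

theorem leftField_eq_leftDeriv (v p : Heis) : leftField v p = leftDeriv p v := by
  rw [leftField, fderiv_hmul]

/-- `leftDeriv p` carries the standard basis to the left-invariant frame at `p`, so an alternating
form is determined by its values on injective choices of frame vectors. -/
theorem eq_zero_of_frameCoef {r : ℕ} {ξ : Form r}
    (h : ∀ I, Function.Injective I → frameCoef I ξ = 0) : ξ = 0 := by
  refine Form.ext_apply fun p v => ?_
  have h1 : (ξ.toFun p).toAlternatingMap.compLinearMap (leftDeriv p).toLinearMap = 0 := by
    refine Module.Basis.ext_alternating (Pi.basisFun ℝ (Fin 3)) fun I hI => ?_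
    have h2 := congrFun (congrArg Subtype.val (h I hI)) p
    rw [frameCoef_apply] at h2
    simpa [leftField_eq_leftDeriv] using h2
  have h3 : v = fun k => leftDeriv p ![v k 0, v k 1, v k 2 - p 0 * v k 1] := by
    ext k i
    fin_cases i <;> simp [leftDeriv]
  have h4 := congrArg
    (fun η : Heis [⋀^Fin r]→ₗ[ℝ] ℝ => η fun k => ![v k 0, v k 1, v k 2 - p 0 * v k 1]) h1
  rw [h3]
  simpa using h4

theorem Form.eq_zero_of_three_lt {r : ℕ} (hr : 3 < r) (ξ : Form r) : ξ = 0 :=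
  eq_zero_of_frameCoef fun I hI => by
    have := Fintype.card_le_of_injective I hI
    simp at this
    omega

theorem Form.add_apply {r : ℕ} (ξ η : Form r) (p : Heis) (v : Fin r → Heis) :
    (ξ + η).toFun p v = ξ.toFun p v + η.toFun p v := rfl

theorem Form.smul_apply {r : ℕ} (c : ℝ) (ξ : Form r) (p : Heis) (v : Fin r → Heis) :
    (c • ξ).toFun p v = c * ξ.toFun p v := rfl

theorem hmul_zero (a p : Heis) : hmul a p 0 = a 0 + p 0 := rfl

/-- Functions as forms of degree zero. -/
def form0 : InvFun →ₗ[ℝ] Form 0 where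
  toFun f := ⟨fun p => f.1 p • coordForm ![], f.contDiff.smul contDiff_const, fun a ha => by
    ext p v
    simp [pullback, f.invariant ha, coordForm_apply]⟩
  map_add' f g := Subtype.ext <| funext fun p => add_smul _ _ _
  map_smul' c f := Subtype.ext <| funext fun p => mul_smul _ _ _

theorem form0_apply (f : InvFun) (p : Heis) (v : Fin 0 → Heis) : (form0 f).toFun p v = f.1 p := by
  change (f.1 p • coordForm ![]) v = _
  simp [coordForm_apply]

/-- The form `c.1 α + c.2.1 β + c.2.2 θ`, where `α = dx`, `β = dy` and `θ = dz - x dy`. -/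
def oneForm (c : InvFun × InvFun × InvFun) : Form 1 :=
  ⟨fun p => c.1.1 p • coordForm ![0] + (c.2.1.1 p - p 0 * c.2.2.1 p) • coordForm ![1]
      + c.2.2.1 p • coordForm ![2], by
    have h1 := c.1.contDiff
    have h2 := c.2.1.contDiff
    have h3 := c.2.2.contDiff
    fun_prop, fun a ha => by
    ext p v
    simp [pullback, fderiv_hmul, c.1.invariant ha, c.2.1.invariant ha, c.2.2.invariant ha,
      coordForm_apply, leftDeriv, hmul_zero]
    ring⟩

theorem oneForm_apply (c : InvFun × InvFun × InvFun) (p : Heis) (v : Fin 1 → Heis) :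
    (oneForm c).toFun p v =
      c.1.1 p * v 0 0 + c.2.1.1 p * v 0 1 + c.2.2.1 p * (v 0 2 - p 0 * v 0 1) := by
  change (c.1.1 p • coordForm ![0] + (c.2.1.1 p - p 0 * c.2.2.1 p) • coordForm ![1]
      + c.2.2.1 p • coordForm ![2] : Heis [⋀^Fin 1]→L[ℝ] ℝ) v = _
  simp [coordForm_apply]
  ring

/-- The form `f α + g β + k θ`, linearly in `(f, g, k)`. -/
def form1 : InvFun × InvFun × InvFun →ₗ[ℝ] Form 1 where
  toFun := oneForm
  map_add' c c' := Form.ext_apply fun p v => by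
    rw [Form.add_apply, oneForm_apply, oneForm_apply, oneForm_apply]
    simp
    ring
  map_smul' t c := Form.ext_apply fun p v => by
    rw [RingHom.id_apply, Form.smul_apply, oneForm_apply, oneForm_apply]
    simp
    ring

theorem form1_apply (f g k : InvFun) (p : Heis) (v : Fin 1 → Heis) :
    (form1 (f, g, k)).toFun p v =
      f.1 p * v 0 0 + g.1 p * v 0 1 + k.1 p * (v 0 2 - p 0 * v 0 1) :=
  oneForm_apply _ _ _

/-- The form `c.1 α ∧ β + c.2.1 α ∧ θ + c.2.2 β ∧ θ`. -/
def twoForm (c : InvFun × InvFun × InvFun) : Form 2 :=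
  ⟨fun p => (c.1.1 p - p 0 * c.2.1.1 p) • coordForm ![0, 1]
      + c.2.1.1 p • coordForm ![0, 2] + c.2.2.1 p • coordForm ![1, 2], by
    have h1 := c.1.contDiff
    have h2 := c.2.1.contDiff
    have h3 := c.2.2.contDiff
    fun_prop, fun a ha => by
    ext p v
    simp [pullback, fderiv_hmul, c.1.invariant ha, c.2.1.invariant ha, c.2.2.invariant ha,
      coordForm_apply, leftDeriv, hmul_zero, Matrix.det_fin_two]
    ring⟩

theorem twoForm_apply (c : InvFun × InvFun × InvFun) (p : Heis) (v : Fin 2 → Heis) :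
    (twoForm c).toFun p v = c.1.1 p * (v 0 0 * v 1 1 - v 0 1 * v 1 0)
      + c.2.1.1 p * (v 0 0 * (v 1 2 - p 0 * v 1 1) - (v 0 2 - p 0 * v 0 1) * v 1 0)
      + c.2.2.1 p * (v 0 1 * v 1 2 - v 0 2 * v 1 1) := by
  change ((c.1.1 p - p 0 * c.2.1.1 p) • coordForm ![0, 1]
      + c.2.1.1 p • coordForm ![0, 2] + c.2.2.1 p • coordForm ![1, 2] : Heis [⋀^Fin 2]→L[ℝ] ℝ) v = _
  simp [coordForm_apply, Matrix.det_fin_two]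
  ring

/-- The form `a α ∧ β + b α ∧ θ + c β ∧ θ`, linearly in `(a, b, c)`. -/
def form2 : InvFun × InvFun × InvFun →ₗ[ℝ] Form 2 where
  toFun := twoForm
  map_add' c c' := Form.ext_apply fun p v => by
    rw [Form.add_apply, twoForm_apply, twoForm_apply, twoForm_apply]
    simp
    ring
  map_smul' t c := Form.ext_apply fun p v => by
    rw [RingHom.id_apply, Form.smul_apply, twoForm_apply, twoForm_apply]
    simp
    ring

theorem form2_apply (a b c : InvFun) (p : Heis) (v : Fin 2 → Heis) :
    (form2 (a, b, c)).toFun p v = a.1 p * (v 0 0 * v 1 1 - v 0 1 * v 1 0)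
      + b.1 p * (v 0 0 * (v 1 2 - p 0 * v 1 1) - (v 0 2 - p 0 * v 0 1) * v 1 0)
      + c.1 p * (v 0 1 * v 1 2 - v 0 2 * v 1 1) :=
  twoForm_apply _ _ _

/-- The form `w α ∧ β ∧ θ`. -/
def form3 : InvFun →ₗ[ℝ] Form 3 where
  toFun w := ⟨fun p => w.1 p • coordForm ![0, 1, 2], w.contDiff.smul contDiff_const, fun a ha => by
    ext p v
    simp [pullback, fderiv_hmul, w.invariant ha, coordForm_apply, leftDeriv,
      Matrix.det_fin_three]
    refine Or.inl ?_
    ring⟩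
  map_add' f g := Subtype.ext <| funext fun p => add_smul _ _ _
  map_smul' c f := Subtype.ext <| funext fun p => mul_smul _ _ _

theorem form3_apply (w : InvFun) (p : Heis) (v : Fin 3 → Heis) :
    (form3 w).toFun p v = w.1 p * Matrix.det (Matrix.of v) := by
  change (w.1 p • coordForm ![0, 1, 2]) v = _
  simp [coordForm_apply, Matrix.det_fin_three]

theorem frameCoef_form0 (f : InvFun) : frameCoef ![] (form0 f) = f :=
  Subtype.ext <| funext fun p => by rw [frameCoef_apply, form0_apply]

theorem frameCoef_form1_zero (f g k : InvFun) : frameCoef ![0] (form1 (f, g, k)) = f :=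
  Subtype.ext <| funext fun p => by simp [frameCoef_apply, form1_apply, leftField_eq]

theorem frameCoef_form1_one (f g k : InvFun) : frameCoef ![1] (form1 (f, g, k)) = g :=
  Subtype.ext <| funext fun p => by simp [frameCoef_apply, form1_apply, leftField_eq]

theorem frameCoef_form1_two (f g k : InvFun) : frameCoef ![2] (form1 (f, g, k)) = k :=
  Subtype.ext <| funext fun p => by simp [frameCoef_apply, form1_apply, leftField_eq]

theorem frameCoef_form2_zero_one (a b c : InvFun) : frameCoef ![0, 1] (form2 (a, b, c)) = a :=
  Subtype.ext <| funext fun p => by simp [frameCoef_apply, form2_apply, leftField_eq]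

theorem frameCoef_form2_zero_two (a b c : InvFun) : frameCoef ![0, 2] (form2 (a, b, c)) = b :=
  Subtype.ext <| funext fun p => by simp [frameCoef_apply, form2_apply, leftField_eq]

theorem frameCoef_form2_one_two (a b c : InvFun) : frameCoef ![1, 2] (form2 (a, b, c)) = c :=
  Subtype.ext <| funext fun p => by simp [frameCoef_apply, form2_apply, leftField_eq]

theorem frameCoef_form3 (w : InvFun) : frameCoef ![0, 1, 2] (form3 w) = w :=
  Subtype.ext <| funext fun p => by
    simp [frameCoef_apply, form3_apply, leftField_eq, Matrix.det_fin_three]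

theorem form0_frameCoef (ξ : Form 0) : form0 (frameCoef ![] ξ) = ξ := by
  rw [← sub_eq_zero]
  refine eq_zero_of_frameCoef fun I _ => ?_
  rw [Subsingleton.elim I ![], map_sub, frameCoef_form0, sub_self]

theorem form1_frameCoef (ξ : Form 1) :
    form1 (frameCoef ![0] ξ, frameCoef ![1] ξ, frameCoef ![2] ξ) = ξ := by
  rw [← sub_eq_zero]
  refine eq_zero_of_frameCoef fun I _ => ?_
  obtain ⟨i, rfl⟩ : ∃ i, I = ![i] := ⟨I 0, by ext j; fin_cases j; rfl⟩
  rw [map_sub]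
  fin_cases i
  · exact sub_eq_zero.2 (frameCoef_form1_zero _ _ _)
  · exact sub_eq_zero.2 (frameCoef_form1_one _ _ _)
  · exact sub_eq_zero.2 (frameCoef_form1_two _ _ _)

theorem form2_frameCoef (ξ : Form 2) :
    form2 (frameCoef ![0, 1] ξ, frameCoef ![0, 2] ξ, frameCoef ![1, 2] ξ) = ξ := by
  rw [← sub_eq_zero]
  set η := form2 (frameCoef ![0, 1] ξ, frameCoef ![0, 2] ξ, frameCoef ![1, 2] ξ) - ξ with hη
  have h01 : frameCoef ![0, 1] η = 0 := by rw [hη, map_sub, frameCoef_form2_zero_one, sub_self]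
  have h02 : frameCoef ![0, 2] η = 0 := by rw [hη, map_sub, frameCoef_form2_zero_two, sub_self]
  have h12 : frameCoef ![1, 2] η = 0 := by rw [hη, map_sub, frameCoef_form2_one_two, sub_self]
  have hsw : ∀ i j : Fin 3, frameCoef ![i, j] η = 0 → frameCoef ![j, i] η = 0 := fun i j h => by
    have : (![j, i] : Fin 2 → Fin 3) = ![i, j] ∘ Equiv.swap 0 1 := by
      ext k; fin_cases k <;> simp
    rw [this, frameCoef_perm, h, smul_zero]
  refine eq_zero_of_frameCoef fun I hI => ?_
  obtain ⟨i, j, rfl⟩ : ∃ i j, I = ![i, j] := ⟨I 0, I 1, by ext k; fin_cases k <;> rfl⟩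
  have hij : i ≠ j := fun h => by simpa using hI (show ![i, j] 0 = ![i, j] 1 from h)
  fin_cases i <;> fin_cases j
  exacts [absurd rfl hij, h01, h02, hsw _ _ h01, absurd rfl hij, h12, hsw _ _ h02, hsw _ _ h12,
    absurd rfl hij]

theorem form3_frameCoef (ξ : Form 3) : form3 (frameCoef ![0, 1, 2] ξ) = ξ := by
  rw [← sub_eq_zero]
  refine eq_zero_of_frameCoef fun I hI => ?_
  -- An injective choice of three indices out of three is a permutation, so it changes the
  -- coefficient only by a sign.
  have : I = ![0, 1, 2] ∘ Equiv.ofBijective I (Finite.injective_iff_bijective.1 hI) := by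
    ext k
    have : ∀ j : Fin 3, (![0, 1, 2] : Fin 3 → Fin 3) j = j := fun j => by fin_cases j <;> rfl
    simp [this]
  rw [this, frameCoef_perm, map_sub, frameCoef_form3, sub_self, smul_zero]

theorem exists_form0 (ξ : Form 0) : ∃ f, form0 f = ξ := ⟨_, form0_frameCoef ξ⟩
theorem exists_form1 (ξ : Form 1) : ∃ f g k, form1 (f, g, k) = ξ := ⟨_, _, _, form1_frameCoef ξ⟩
theorem exists_form2 (ξ : Form 2) : ∃ a b c, form2 (a, b, c) = ξ := ⟨_, _, _, form2_frameCoef ξ⟩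
theorem exists_form3 (ξ : Form 3) : ∃ w, form3 w = ξ := ⟨_, form3_frameCoef ξ⟩

theorem form0_inj {f f' : InvFun} : form0 f = form0 f' ↔ f = f' :=
  ⟨fun h => by rw [← frameCoef_form0 f, h, frameCoef_form0], congrArg form0⟩

theorem form1_inj {f g k f' g' k' : InvFun} :
    form1 (f, g, k) = form1 (f', g', k') ↔ f = f' ∧ g = g' ∧ k = k' := by
  refine ⟨fun h => ⟨?_, ?_, ?_⟩, by rintro ⟨rfl, rfl, rfl⟩; rfl⟩
  · rw [← frameCoef_form1_zero f g k, h, frameCoef_form1_zero]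
  · rw [← frameCoef_form1_one f g k, h, frameCoef_form1_one]
  · rw [← frameCoef_form1_two f g k, h, frameCoef_form1_two]

theorem form2_inj {a b c a' b' c' : InvFun} :
    form2 (a, b, c) = form2 (a', b', c') ↔ a = a' ∧ b = b' ∧ c = c' := by
  refine ⟨fun h => ⟨?_, ?_, ?_⟩, by rintro ⟨rfl, rfl, rfl⟩; rfl⟩
  · rw [← frameCoef_form2_zero_one a b c, h, frameCoef_form2_zero_one]
  · rw [← frameCoef_form2_zero_two a b c, h, frameCoef_form2_zero_two]
  · rw [← frameCoef_form2_one_two a b c, h, frameCoef_form2_one_two]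

theorem form3_inj {w w' : InvFun} : form3 w = form3 w' ↔ w = w' :=
  ⟨fun h => by rw [← frameCoef_form3 w, h, frameCoef_form3], congrArg form3⟩

/-! ### The de Rham differential -/

theorem d_apply {r : ℕ} (ξ : Form r) (p : Heis) (v : Fin (r + 1) → Heis) :
    (d r ξ).toFun p v =
      ∑ i, (-1) ^ i.val • fderiv ℝ (fun q => ξ.toFun q (i.removeNth v)) p (v i) :=
  extDeriv_apply (ξ.contDiff.differentiable (by simp) p) v

theorem hasFDerivAt_coord_zero (p : Heis) :
    HasFDerivAt (fun q : Heis => q 0) (ContinuousLinearMap.proj (R := ℝ) 0) p :=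
  (ContinuousLinearMap.proj (R := ℝ) (φ := fun _ : Fin 3 => ℝ) 0).hasFDerivAt

theorem d_form0 (f : InvFun) : d 0 (form0 f) = form1 (dX f, dY f, dZ f) := by
  refine Form.ext_apply fun p v => ?_
  rw [d_apply, form1_apply]
  simp only [form0_apply]
  simp [fderiv_eq_frame]

/-- The zeroth-order term `-k` is the contribution of dθ = -α ∧ β; α and β are closed. -/
theorem d_form1 (f g k : InvFun) :
    d 1 (form1 (f, g, k)) = form2 (dX g - dY f - k, dX k - dZ f, dY k - dZ g) := by
  refine Form.ext_apply fun p v => ?_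
  rw [d_apply, form2_apply]
  simp only [form1_apply]
  have h : ∀ u w : Heis, fderiv ℝ
      (fun q : Heis => f.1 q * w 0 + g.1 q * w 1 + k.1 q * (w 2 - q 0 * w 1)) p u =
      fderiv ℝ f.1 p u * w 0 + fderiv ℝ g.1 p u * w 1 + fderiv ℝ k.1 p u * (w 2 - p 0 * w 1)
        - k.1 p * (u 0 * w 1) := fun u w => by
    have hf := (f.differentiable p).hasFDerivAt
    have hg := (g.differentiable p).hasFDerivAt
    have hk := (k.differentiable p).hasFDerivAt
    rw [(((hf.mul_const (w 0)).fun_add (hg.mul_const (w 1))).fun_add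
      (hk.fun_mul (((hasFDerivAt_coord_zero p).mul_const (w 1)).const_sub (w 2)))).fderiv]
    simp
    ring
  rw [Fin.sum_univ_two, h, h]
  simp only [fderiv_eq_frame]
  simp [Fin.removeNth]
  ring

theorem d_form2 (a b c : InvFun) : d 2 (form2 (a, b, c)) = form3 (dZ a - dY b + dX c) := by
  refine Form.ext_apply fun p v => ?_
  rw [d_apply, form3_apply]
  simp only [form2_apply]
  have h : ∀ u w w' : Heis, fderiv ℝ
      (fun q : Heis => a.1 q * (w 0 * w' 1 - w 1 * w' 0)
        + b.1 q * (w 0 * (w' 2 - q 0 * w' 1) - (w 2 - q 0 * w 1) * w' 0)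
        + c.1 q * (w 1 * w' 2 - w 2 * w' 1)) p u =
      fderiv ℝ a.1 p u * (w 0 * w' 1 - w 1 * w' 0)
        + fderiv ℝ b.1 p u * (w 0 * (w' 2 - p 0 * w' 1) - (w 2 - p 0 * w 1) * w' 0)
        + b.1 p * (u 0 * (w 1 * w' 0 - w 0 * w' 1))
        + fderiv ℝ c.1 p u * (w 1 * w' 2 - w 2 * w' 1) := fun u w w' => by
    have ha := (a.differentiable p).hasFDerivAt
    have hb := (b.differentiable p).hasFDerivAt
    have hc := (c.differentiable p).hasFDerivAt
    have hx := hasFDerivAt_coord_zero p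
    rw [(((ha.mul_const (w 0 * w' 1 - w 1 * w' 0)).fun_add
      (hb.fun_mul ((((hx.mul_const (w' 1)).const_sub (w' 2)).const_mul (w 0)).fun_sub
        (((hx.mul_const (w 1)).const_sub (w 2)).mul_const (w' 0))))).fun_add
      (hc.mul_const (w 1 * w' 2 - w 2 * w' 1))).fderiv]
    simp
    ring
  rw [Fin.sum_univ_three, h, h, h]
  simp only [fderiv_eq_frame]
  simp [Fin.removeNth, Fin.succAbove, Matrix.det_fin_three]
  ring

/-! ### The `L²` inner products, in terms of coefficients -/

theorem sum_fin_succ_fun {n : ℕ} (F : (Fin (n + 1) → Fin 3) → ℝ) :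
    ∑ I, F I = ∑ i, ∑ J : Fin n → Fin 3, F (Fin.cons i J) := by
  rw [← (Fin.consEquiv fun _ : Fin (n + 1) => Fin 3).sum_comp, Fintype.sum_prod_type]
  rfl

theorem sum_fin_three_fun (F : (Fin 3 → Fin 3) → ℝ) :
    ∑ I, F I = ∑ i, ∑ j, ∑ k, F ![i, j, k] := by
  simp only [sum_fin_succ_fun, Finset.univ_unique, Finset.sum_singleton]
  refine Finset.sum_congr rfl fun i _ => Finset.sum_congr rfl fun j _ =>
    Finset.sum_congr rfl fun k _ => congrArg F ?_
  ext l
  fin_cases l <;> rfl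

theorem innerAt_form0 (h : ℝ) (f f' : InvFun) (p : Heis) :
    innerAt h (form0 f) (form0 f') p = f.1 p * f'.1 p := by
  simp [innerAt, form0_apply]

/-- The orthonormal frame is X, hY, hZ, so each transverse index brings a factor h²; the same rule
gives the weights in degrees 2 and 3. -/
theorem innerAt_form1 (h : ℝ) (f g k f' g' k' : InvFun) (p : Heis) :
    innerAt h (form1 (f, g, k)) (form1 (f', g', k')) p =
      f.1 p * f'.1 p + h ^ 2 * (g.1 p * g'.1 p) + h ^ 2 * (k.1 p * k'.1 p) := by
  simp only [innerAt, sum_fin_succ_fun, Fin.sum_univ_three, Finset.univ_unique,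
    Finset.sum_singleton, form1_apply]
  simp [frame, leftField_eq]
  ring

theorem innerAt_form2 (h : ℝ) (a b c a' b' c' : InvFun) (p : Heis) :
    innerAt h (form2 (a, b, c)) (form2 (a', b', c')) p =
      h ^ 2 * (a.1 p * a'.1 p) + h ^ 2 * (b.1 p * b'.1 p) + h ^ 4 * (c.1 p * c'.1 p) := by
  simp only [innerAt, sum_fin_succ_fun, Fin.sum_univ_three, Finset.univ_unique,
    Finset.sum_singleton, form2_apply]
  simp [frame, leftField_eq, Nat.factorial]
  ring

theorem innerAt_form3 (h : ℝ) (w w' : InvFun) (p : Heis) :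
    innerAt h (form3 w) (form3 w') p = h ^ 4 * (w.1 p * w'.1 p) := by
  simp only [innerAt, sum_fin_three_fun, Fin.sum_univ_three, form3_apply, Matrix.det_fin_three]
  simp [frame, leftField_eq, Nat.factorial]
  ring

theorem innerL2_eq_integ {h : ℝ} {r : ℕ} {ξ η : Form r} {F : InvFun}
    (hF : ∀ p, innerAt h ξ η p = F.1 p) : innerL2 h ξ η = h⁻¹ ^ 2 * integ F := by
  unfold innerL2
  simp only [volDensity_eq, hF]
  rw [integral_mul_const, mul_comm]
  rfl

theorem innerL2_form0 (h : ℝ) (f f' : InvFun) :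
    innerL2 h (form0 f) (form0 f') = h⁻¹ ^ 2 * integ (f * f') :=
  innerL2_eq_integ fun p => innerAt_form0 h f f' p

theorem innerL2_form1 (h : ℝ) (f g k f' g' k' : InvFun) :
    innerL2 h (form1 (f, g, k)) (form1 (f', g', k')) =
      h⁻¹ ^ 2 * (integ (f * f') + h ^ 2 * integ (g * g') + h ^ 2 * integ (k * k')) := by
  rw [innerL2_eq_integ (F := f * f' + h ^ 2 • (g * g') + h ^ 2 • (k * k'))
    fun p => innerAt_form1 h f g k f' g' k' p]
  simp only [map_add, map_smul, smul_eq_mul]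

theorem innerL2_form2 (h : ℝ) (a b c a' b' c' : InvFun) :
    innerL2 h (form2 (a, b, c)) (form2 (a', b', c')) =
      h⁻¹ ^ 2 * (h ^ 2 * integ (a * a') + h ^ 2 * integ (b * b') + h ^ 4 * integ (c * c')) := by
  rw [innerL2_eq_integ (F := h ^ 2 • (a * a') + h ^ 2 • (b * b') + h ^ 4 • (c * c'))
    fun p => innerAt_form2 h a b c a' b' c' p]
  simp only [map_add, map_smul, smul_eq_mul]

theorem innerL2_form3 (h : ℝ) (w w' : InvFun) :
    innerL2 h (form3 w) (form3 w') = h⁻¹ ^ 2 * (h ^ 4 * integ (w * w')) := by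
  rw [innerL2_eq_integ (F := h ^ 4 • (w * w')) fun p => innerAt_form3 h w w' p]
  simp only [map_smul, smul_eq_mul]

theorem innerL2_comm (h : ℝ) {r : ℕ} (ξ η : Form r) : innerL2 h ξ η = innerL2 h η ξ := by
  simp only [innerL2, innerAt, mul_comm]

theorem innerL2_add_left (h : ℝ) {r : ℕ} (α β γ : Form r) :
    innerL2 h (α + β) γ = innerL2 h α γ + innerL2 h β γ := by
  rw [innerL2_comm, innerL2_add_right, innerL2_comm h γ, innerL2_comm h γ]

theorem innerL2_smul_left (h : ℝ) {r : ℕ} (c : ℝ) (α β : Form r) :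
    innerL2 h (c • α) β = c * innerL2 h α β := by
  rw [innerL2_comm, innerL2_smul_right, innerL2_comm]

theorem innerL2_zero_left (h : ℝ) {r : ℕ} (α : Form r) : innerL2 h 0 α = 0 := by
  rw [innerL2_comm, innerL2_zero_right]

theorem innerL2_self_nonneg (h : ℝ) {r : ℕ} (ξ : Form r) : 0 ≤ innerL2 h ξ ξ :=
  integral_nonneg fun p => mul_nonneg (mul_nonneg (by positivity)
    (Finset.sum_nonneg fun _ _ => mul_self_nonneg _)) (by rw [volDensity_eq]; positivity)

theorem eq_zero_of_innerL2 {h : ℝ} (hh : h ≠ 0) {r : ℕ} {ξ : Form r} (hξ : innerL2 h ξ ξ = 0) :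
    ξ = 0 := by
  have hpos : h⁻¹ ^ 2 ≠ 0 := by positivity
  have h2 : 0 < h ^ 2 := by positivity
  have h4 : 0 < h ^ 4 := by positivity
  match r, ξ with
  | 0, ξ =>
    obtain ⟨f, rfl⟩ := exists_form0 ξ
    rw [innerL2_form0, mul_eq_zero, or_iff_right hpos] at hξ
    rw [eq_zero_of_nsq hξ, map_zero]
  | 1, ξ =>
    obtain ⟨f, g, k, rfl⟩ := exists_form1 ξ
    rw [innerL2_form1, mul_eq_zero, or_iff_right hpos] at hξ
    have hf := nsq_nonneg f
    have hg := nsq_nonneg g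
    have hk := nsq_nonneg k
    unfold nsq at hf hg hk
    have hg' := mul_nonneg h2.le hg
    have hk' := mul_nonneg h2.le hk
    rw [eq_zero_of_nsq (f := f) (by unfold nsq; linarith),
      eq_zero_of_nsq (f := g) ((mul_eq_zero_iff_left h2.ne').1 (by unfold nsq; linarith)),
      eq_zero_of_nsq (f := k) ((mul_eq_zero_iff_left h2.ne').1 (by unfold nsq; linarith))]
    exact map_zero form1
  | 2, ξ =>
    obtain ⟨f, g, k, rfl⟩ := exists_form2 ξ
    rw [innerL2_form2, mul_eq_zero, or_iff_right hpos] at hξ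
    have hf' := mul_nonneg h2.le (nsq_nonneg f)
    have hg' := mul_nonneg h2.le (nsq_nonneg g)
    have hk' := mul_nonneg h4.le (nsq_nonneg k)
    unfold nsq at hf' hg' hk'
    rw [eq_zero_of_nsq (f := f) ((mul_eq_zero_iff_left h2.ne').1 (by unfold nsq; linarith)),
      eq_zero_of_nsq (f := g) ((mul_eq_zero_iff_left h2.ne').1 (by unfold nsq; linarith)),
      eq_zero_of_nsq (f := k) ((mul_eq_zero_iff_left h4.ne').1 (by unfold nsq; linarith))]
    exact map_zero form2
  | 3, ξ =>
    obtain ⟨w, rfl⟩ := exists_form3 ξ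
    rw [innerL2_form3, mul_eq_zero, or_iff_right hpos, mul_eq_zero, or_iff_right h4.ne'] at hξ
    rw [eq_zero_of_nsq hξ, map_zero]
  | r + 4, ξ => exact Form.eq_zero_of_three_lt (by omega) ξ

theorem innerL2_sq_le (h : ℝ) {r : ℕ} (ξ η : Form r) :
    innerL2 h ξ η ^ 2 ≤ innerL2 h ξ ξ * innerL2 h η η := by
  have key : ∀ t : ℝ, 0 ≤ innerL2 h ξ ξ * (t * t) + (2 * innerL2 h ξ η) * t + innerL2 h η η :=
    fun t => by
    have := innerL2_self_nonneg h (t • ξ + η)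
    simp only [innerL2_add_left, innerL2_add_right, innerL2_smul_left, innerL2_smul_right] at this
    rw [innerL2_comm h η ξ] at this
    linarith
  have := discrim_le_zero key
  unfold discrim at this
  linarith

/-! ### The codifferential, in terms of coefficients -/

theorem integ_mul_neg (f g : InvFun) : integ (f * -g) = -integ (f * g) := by
  rw [show f * -g = -(f * g) by ring]
  exact map_neg integ _

theorem isCodiff_form1 {h : ℝ} (f g k : InvFun) :
    IsCodiff h (form1 (f, g, k)) (form0 (-(dX f + h ^ 2 • dY g + h ^ 2 • dZ k))) := fun φ => by
  obtain ⟨φ, rfl⟩ := exists_form0 φ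
  rw [d_form0, innerL2_form1, innerL2_form0, integ_dX_mul, integ_dY_mul, integ_dZ_mul]
  simp only [integ_mul_neg, mul_add, map_add, mul_smul_comm, map_smul, smul_eq_mul]
  ring

/-- Integration by parts against `d_form1`; the undifferentiated `-a` is adjoint to the term `-k`
there. -/
theorem isCodiff_form2 {h : ℝ} (a b c : InvFun) :
    IsCodiff h (form2 (a, b, c)) (form1 (h ^ 2 • (dY a + dZ b), -dX a + h ^ 2 • dZ c,
      -a - dX b - h ^ 2 • dY c)) := fun φ => by
  obtain ⟨f, g, k, rfl⟩ := exists_form1 φ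
  rw [d_form1, innerL2_form2, innerL2_form1]
  simp only [sub_mul, map_sub, integ_dX_mul, integ_dY_mul, integ_dZ_mul]
  simp only [integ_mul_neg, mul_add, mul_sub, map_add, map_sub, mul_smul_comm, map_smul,
    smul_eq_mul, smul_add]
  ring

theorem isCodiff_form3 {h : ℝ} (w : InvFun) :
    IsCodiff h (form3 w) (form2 (-(h ^ 2 • dZ w), h ^ 2 • dY w, -dX w)) := fun φ => by
  obtain ⟨a, b, c, rfl⟩ := exists_form2 φ
  rw [d_form2, innerL2_form3, innerL2_form2]
  simp only [sub_mul, add_mul, map_sub, map_add, integ_dX_mul, integ_dY_mul, integ_dZ_mul]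
  simp only [integ_mul_neg, mul_smul_comm, map_smul, smul_eq_mul]
  ring

theorem isCodiff_zero (h : ℝ) {r : ℕ} : IsCodiff h (0 : Form (r + 1)) 0 := fun φ => by
  rw [innerL2_zero_right, innerL2_zero_right]

theorem d_d {r : ℕ} (ξ : Form r) : d (r + 1) (d r ξ) = 0 :=
  Subtype.ext (extDeriv_extDeriv ξ.contDiff
    (by simpa using WithTop.coe_le_coe.2 (le_top : (2 : ℕ∞) ≤ ⊤)))

/-! ### Exact forms and their primitives -/

/-- The periods that detect exactness of closed forms. -/
def periods : (r : ℕ) → Form r →ₗ[ℝ] ℝ × ℝ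
  | 0 => LinearMap.prod (integ ∘ₗ frameCoef ![]) 0
  | 1 => LinearMap.prod (integ ∘ₗ frameCoef ![0]) (integ ∘ₗ frameCoef ![1])
  | 2 => LinearMap.prod (integ ∘ₗ frameCoef ![0, 2]) (integ ∘ₗ frameCoef ![1, 2])
  | 3 => LinearMap.prod (integ ∘ₗ frameCoef ![0, 1, 2]) 0
  | _ + 4 => 0

theorem periods_form0 (f : InvFun) : periods 0 (form0 f) = (integ f, 0) := by
  change (integ (frameCoef ![] (form0 f)), (0 : ℝ)) = _
  rw [frameCoef_form0]

theorem periods_form1 (f g k : InvFun) : periods 1 (form1 (f, g, k)) = (integ f, integ g) := by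
  change (integ (frameCoef ![0] _), integ (frameCoef ![1] _)) = _
  rw [frameCoef_form1_zero, frameCoef_form1_one]

theorem periods_form2 (a b c : InvFun) : periods 2 (form2 (a, b, c)) = (integ b, integ c) := by
  change (integ (frameCoef ![0, 2] _), integ (frameCoef ![1, 2] _)) = _
  rw [frameCoef_form2_zero_two, frameCoef_form2_one_two]

theorem periods_form3 (w : InvFun) : periods 3 (form3 w) = (integ w, 0) := by
  change (integ (frameCoef ![0, 1, 2] _), (0 : ℝ)) = _
  rw [frameCoef_form3]

theorem periods_d (r : ℕ) (ξ : Form r) : periods (r + 1) (d r ξ) = 0 := by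
  match r, ξ with
  | 0, ξ =>
    obtain ⟨f, rfl⟩ := exists_form0 ξ
    rw [d_form0, periods_form1, integ_dX, integ_dY]
    rfl
  | 1, ξ =>
    obtain ⟨f, g, k, rfl⟩ := exists_form1 ξ
    rw [d_form1, periods_form2, map_sub, map_sub, integ_dX, integ_dY, integ_dZ, integ_dZ]
    simp
  | 2, ξ =>
    obtain ⟨f, g, k, rfl⟩ := exists_form2 ξ
    rw [d_form2, periods_form3, map_add, map_sub, integ_dX, integ_dY, integ_dZ]
    simp
  | r + 3, ξ => rfl

theorem form1_eq_zero {f g k : InvFun} : form1 (f, g, k) = 0 ↔ f = 0 ∧ g = 0 ∧ k = 0 := by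
  rw [← form1_inj]
  exact (map_zero form1) ▸ Iff.rfl

theorem form2_eq_zero {a b c : InvFun} : form2 (a, b, c) = 0 ↔ a = 0 ∧ b = 0 ∧ c = 0 := by
  rw [← form2_inj]
  exact (map_zero form2) ▸ Iff.rfl

theorem form3_eq_zero {w : InvFun} : form3 w = 0 ↔ w = 0 := by
  rw [← form3_inj, map_zero]

theorem form0_eq_zero {f : InvFun} : form0 f = 0 ↔ f = 0 := by
  rw [← form0_inj, map_zero]

theorem eq_const_of_d_eq_zero {ξ : Form 0} (hξ : d 0 ξ = 0) :
    ξ = (periods 0 ξ).1 • form0 1 := by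
  obtain ⟨f, rfl⟩ := exists_form0 ξ
  rw [d_form0, form1_eq_zero] at hξ
  rw [periods_form0, ← map_smul, form0_inj, ← Algebra.algebraMap_eq_smul_one]
  exact eq_algebraMap_integ hξ.1 hξ.2.1 hξ.2.2

/-- Closed forms without periods are exact, with a bound for the primitive which is uniform in
`h`. -/
theorem exists_primitive {r : ℕ} {η : Form (r + 1)} (hη : d (r + 1) η = 0)
    (hper : periods (r + 1) η = 0) :
    ∃ ζ, d r ζ = η ∧ (∀ h : ℝ, 0 < h → h ≤ 1 →
      h ^ 4 * innerL2 h ζ ζ ≤ 100 * innerL2 h η η ∧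
      (r ≠ 1 → h ^ 2 * innerL2 h ζ ζ ≤ 300 * innerL2 h η η)) := by
  match r, η with
  | 0, η =>
    obtain ⟨f, g, k, rfl⟩ := exists_form1 η
    rw [d_form1, form2_eq_zero] at hη
    rw [periods_form1, Prod.mk_eq_zero] at hper
    obtain ⟨φ, h1, h2, h3, hb⟩ := exists_primitive_one (sub_eq_zero.1 hη.1) (sub_eq_zero.1 hη.2.1)
      (sub_eq_zero.1 hη.2.2) hper.1 hper.2
    have hf := nsq_nonneg f
    have hg := nsq_nonneg g
    have hk := nsq_nonneg k
    have hφ := nsq_nonneg φ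
    refine ⟨form0 φ, by rw [d_form0, h1, h2, h3], fun h h0 hle => ?_⟩
    rw [innerL2_form1, innerL2_form0]
    simp only [← nsq.eq_1]
    have hh2 : h ^ 2 ≤ 1 := pow_le_one₀ h0.le hle
    have h20 : 0 < h ^ 2 := by positivity
    have h4 : h ^ 4 ≤ h ^ 2 := pow_le_pow_of_le_one h0.le hle (by norm_num)
    have e : h⁻¹ ^ 2 * h ^ 2 = 1 := by field_simp
    -- Functions have weight 1 and 1-forms have weights at least h²: the loss is h².
    have key : h ^ 2 * nsq φ ≤ 100 * (nsq f + h ^ 2 * nsq g + h ^ 2 * nsq k) := by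
      have := mul_le_mul_of_nonneg_left hb h20.le
      nlinarith
    have hinv : 0 ≤ h⁻¹ ^ 2 := by positivity
    have key2 : h ^ 4 * nsq φ ≤ 100 * (nsq f + h ^ 2 * nsq g + h ^ 2 * nsq k) :=
      (mul_le_mul_of_nonneg_right h4 hφ).trans key
    have k1 := mul_le_mul_of_nonneg_left key hinv
    have k2 := mul_le_mul_of_nonneg_left key2 hinv
    have k3 : 0 ≤ h⁻¹ ^ 2 * (nsq f + h ^ 2 * nsq g + h ^ 2 * nsq k) := by positivity
    exact ⟨by linarith, fun _ => by linarith⟩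
  | 1, η =>
    obtain ⟨a, b, c, rfl⟩ := exists_form2 η
    rw [d_form2, form3_eq_zero] at hη
    rw [periods_form2, Prod.mk_eq_zero] at hper
    obtain ⟨f, g, k, h1, h2, h3, hb⟩ := exists_primitive_two hη hper.1 hper.2
    have ha := nsq_nonneg a
    have hbn := nsq_nonneg b
    have hc := nsq_nonneg c
    have hf := nsq_nonneg f
    have hg := nsq_nonneg g
    have hk := nsq_nonneg k
    refine ⟨form1 (f, g, k), by rw [d_form1, h1, h2, h3], fun h h0 hle => ⟨?_, by simp⟩⟩
    rw [innerL2_form2, innerL2_form1]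
    simp only [← nsq.eq_1]
    have hh2 : h ^ 2 ≤ 1 := pow_le_one₀ h0.le hle
    have h4 : h ^ 4 ≤ h ^ 2 := pow_le_pow_of_le_one h0.le hle (by norm_num)
    have h40 : 0 < h ^ 4 := by positivity
    have hinv : 0 ≤ h⁻¹ ^ 2 := by positivity
    -- 1-forms have weights at most 1 while β ∧ θ has weight h⁴: only here is the loss h⁴.
    have k0 : nsq f + h ^ 2 * nsq g + h ^ 2 * nsq k ≤ nsq f + nsq g + nsq k := by
      nlinarith
    have k1 := mul_le_mul_of_nonneg_left (k0.trans hb) h40.le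
    have k2 : h ^ 4 * (nsq a + nsq b + nsq c) ≤ h ^ 2 * nsq a + h ^ 2 * nsq b + h ^ 4 * nsq c := by
      nlinarith
    have k3 : h ^ 4 * (nsq f + h ^ 2 * nsq g + h ^ 2 * nsq k) ≤
      100 * (h ^ 2 * nsq a + h ^ 2 * nsq b + h ^ 4 * nsq c) := by linarith
    have k4 := mul_le_mul_of_nonneg_left k3 hinv
    linarith
  | 2, η =>
    obtain ⟨w, rfl⟩ := exists_form3 η
    rw [periods_form3, Prod.mk_eq_zero] at hper
    obtain ⟨a, b, c, h1, h2, h3, h4⟩ := exists_primitive_three hper.1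
    have hw := nsq_nonneg w
    have ha := nsq_nonneg a
    have hb := nsq_nonneg b
    have hc := nsq_nonneg c
    refine ⟨form2 (a, b, c), by rw [d_form2, h1], fun h h0 hle => ?_⟩
    rw [innerL2_form2, innerL2_form3]
    simp only [← nsq.eq_1]
    have hh2 : h ^ 2 ≤ 1 := pow_le_one₀ h0.le hle
    have h20 : 0 < h ^ 2 := by positivity
    have h42 : h ^ 4 ≤ h ^ 2 := pow_le_pow_of_le_one h0.le hle (by norm_num)
    have h40 : 0 < h ^ 4 := by positivity
    have hinv : 0 ≤ h⁻¹ ^ 2 := by positivity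
    -- 2-forms have weights at most h² and 3-forms have weight h⁴: the loss is h² again.
    have k0 : h ^ 2 * nsq a + h ^ 2 * nsq b + h ^ 4 * nsq c ≤ 3 * (h ^ 2 * nsq w) := by
      nlinarith
    have k1 : h ^ 2 * (h ^ 2 * nsq a + h ^ 2 * nsq b + h ^ 4 * nsq c) ≤ 3 * (h ^ 4 * nsq w) := by
      have := mul_le_mul_of_nonneg_left k0 h20.le
      nlinarith
    have k1' := mul_le_mul_of_nonneg_left k1 hinv
    have k3 : 0 ≤ h⁻¹ ^ 2 * (h ^ 2 * nsq a + h ^ 2 * nsq b + h ^ 4 * nsq c) := by positivity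
    have k4 := mul_le_mul_of_nonneg_right h42 k3
    have k5 : 0 ≤ h⁻¹ ^ 2 * (h ^ 4 * nsq w) := by positivity
    exact ⟨by linarith, fun _ => by linarith⟩
  | r + 3, η =>
    refine ⟨0, by rw [map_zero, Form.eq_zero_of_three_lt (by omega) η], fun h _ _ => ?_⟩
    rw [innerL2_zero_left, Form.eq_zero_of_three_lt (by omega) η, innerL2_zero_left]
    simp

/-! ### The spectral gap -/

theorem innerL2_closed_eq_zero {h : ℝ} {r : ℕ} {ξ : Form (r + 1)} {β φ : Form r}
    (hβ : IsCodiff h ξ β) (hφ : d r φ = 0) : innerL2 h φ β = 0 := by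
  rw [← hβ φ, hφ, innerL2_zero_left]

/-- A bound for some primitive of every closed form without periods bounds the primitives which
are orthogonal to the closed forms. -/
theorem mul_innerL2_le_of_orthogonal {h κ : ℝ} (h0 : 0 < h) (hle : h ≤ 1) {r : ℕ}
    (hκ : κ ≤ h ^ 4 / 100 ∨ r ≠ 1 ∧ κ ≤ h ^ 2 / 300) {β : Form r}
    (hβ : ∀ φ, d r φ = 0 → innerL2 h φ β = 0) :
    κ * innerL2 h β β ≤ innerL2 h (d r β) (d r β) := by
  obtain ⟨ζ, hζ, hb⟩ := exists_primitive (d_d β) (periods_d r β)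
  have hb := hb h h0 hle
  have hζ0 := innerL2_self_nonneg h ζ
  have hβ0 := innerL2_self_nonneg h β
  have h1 : κ * innerL2 h ζ ζ ≤ innerL2 h (d r β) (d r β) := by
    rcases hκ with hκ | ⟨hr, hκ⟩
    · have := mul_le_mul_of_nonneg_right hκ hζ0
      linarith [hb.1]
    · have := mul_le_mul_of_nonneg_right hκ hζ0
      linarith [hb.2 hr]
  -- The difference β - ζ is closed, hence orthogonal to β. By Cauchy–Schwarz β is then no longer
  -- than ζ.
  have h2 : innerL2 h β β = innerL2 h ζ β := by
    have := hβ (β + (-1 : ℝ) • ζ) (by rw [map_add, map_smul, hζ]; simp)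
    rw [innerL2_add_left, innerL2_smul_left] at this
    linarith
  have h3 := innerL2_sq_le h ζ β
  rw [← h2, sq] at h3
  have h4 : innerL2 h β β ≤ innerL2 h ζ ζ := by
    rcases hβ0.eq_or_lt with h5 | h5
    · rw [← h5]
      exact hζ0
    · exact le_of_mul_le_mul_right h3 h5
  rcases le_or_gt 0 κ with h5 | h5
  · exact (mul_le_mul_of_nonneg_left h4 h5).trans h1
  · exact (mul_nonpos_of_nonpos_of_nonneg h5.le hβ0).trans (innerL2_self_nonneg _ _)

theorem innerL2_isLaplacian_nonneg {h : ℝ} {r : ℕ} {ξ η : Form r} (hξ : IsLaplacian h r ξ η) :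
    0 ≤ innerL2 h ξ η := by
  cases r with
  | zero => rw [← hξ ξ]; exact innerL2_self_nonneg _ _
  | succ r =>
    obtain ⟨α, β, hα, hβ, rfl⟩ := hξ
    rw [innerL2_add_right, ← hβ ξ, innerL2_comm, hα α]
    exact add_nonneg (innerL2_self_nonneg _ _) (innerL2_self_nonneg _ _)

theorem eigenspace_eq_bot_of_neg {h : ℝ} (hh : h ≠ 0) {r : ℕ} {s : ℝ} (hs : s < 0) :
    eigenspace h r s = ⊥ := by
  refine (Submodule.eq_bot_iff _).2 fun ξ hξ => eq_zero_of_innerL2 hh ?_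
  have h1 := innerL2_isLaplacian_nonneg (show IsLaplacian h r ξ (s • ξ) from hξ)
  rw [innerL2_smul_right] at h1
  nlinarith [innerL2_self_nonneg h ξ]

/-- With D the square norm of dξ, adjointness gives the square norm of β as s D, while that of dβ is
s² D. The gap inequality reads κ s D ≤ s² D, which for s < κ leaves only D = 0 or s = 0. -/
theorem d_eq_zero_of_codiff {h κ s : ℝ} (h0 : 0 < h) (hle : h ≤ 1) {r : ℕ}
    (hκ : κ ≤ h ^ 4 / 100 ∨ r ≠ 1 ∧ κ ≤ h ^ 2 / 300) (hs : s < κ) {ξ β : Form r}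
    (hβ : IsCodiff h (d r ξ) β) (hd : d r β = s • d r ξ) : d r ξ = 0 ∧ β = 0 := by
  have h1 := mul_innerL2_le_of_orthogonal h0 hle hκ fun φ hφ => innerL2_closed_eq_zero hβ hφ
  have h2 : innerL2 h β β = s * innerL2 h (d r ξ) (d r ξ) := by
    rw [← hβ β, hd, innerL2_smul_left]
  rw [hd, innerL2_smul_left, innerL2_smul_right, h2] at h1
  have hD := innerL2_self_nonneg h (d r ξ)
  have hB := innerL2_self_nonneg h β
  rcases eq_or_ne s 0 with rfl | hs0
  · rw [zero_mul] at h2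
    have hβ0 := eq_zero_of_innerL2 h0.ne' h2
    refine ⟨eq_zero_of_innerL2 h0.ne' ?_, hβ0⟩
    rw [hβ ξ, hβ0, innerL2_zero_right]
  · have hD0 : innerL2 h (d r ξ) (d r ξ) = 0 := by
      by_contra hne
      have hpos : 0 < innerL2 h (d r ξ) (d r ξ) := lt_of_le_of_ne hD (Ne.symm hne)
      have hs1 : 0 < s := by
        rcases lt_or_gt_of_ne hs0 with h3 | h3
        · nlinarith
        · exact h3
      have := mul_pos hs1 hpos
      nlinarith
    exact ⟨eq_zero_of_innerL2 h0.ne' hD0, eq_zero_of_innerL2 h0.ne' (by rw [h2, hD0, mul_zero])⟩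

/-- Below the spectral gap, all eigenforms are harmonic. -/
theorem harmonic_of_lt_gap {h κ s : ℝ} (h0 : 0 < h) (hle : h ≤ 1) {r : ℕ}
    (hκ : κ ≤ h ^ 4 / 100 ∨ (r = 0 ∨ r = 3) ∧ κ ≤ h ^ 2 / 300) (hs : s < κ) {ξ : Form r}
    (hξ : IsLaplacian h r ξ (s • ξ)) :
    d r ξ = 0 ∧ s • ξ = 0 ∧ ∀ ζ : Form (r - 1), ∀ hr : r - 1 + 1 = r,
      innerL2 h (d (r - 1) ζ) (hr ▸ ξ) = 0 := by
  cases r with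
  | zero =>
    have h1 := d_eq_zero_of_codiff h0 hle (hκ.imp_right fun h => ⟨by simp, h.2⟩) hs hξ
      (map_smul _ _ _)
    -- In degree zero the last clause is vacuous, because truncated subtraction makes `r - 1 + 1 =
    -- r` false.
    exact ⟨h1.1, h1.2, fun _ hr => absurd hr (by simp)⟩
  | succ r =>
    obtain ⟨α, β, hα, hβ, hsum⟩ := hξ
    -- Applying `d` to the eigenvalue equation removes the exact summand and isolates the coexact
    -- one.
    have hd : d (r + 1) β = s • d (r + 1) ξ := by
      rw [← map_smul, hsum, map_add, d_d, zero_add]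
    have h1 := d_eq_zero_of_codiff h0 hle
      (hκ.imp_right fun h => ⟨by have := h.1; omega, h.2⟩) hs hβ hd
    rw [h1.2, add_zero] at hsum
    -- The exact part is handled one degree lower: α is a codifferential, hence orthogonal to closed
    -- forms.
    have h2 := mul_innerL2_le_of_orthogonal h0 hle (r := r)
      (hκ.imp_right fun h => ⟨by have := h.1; omega, h.2⟩)
      fun φ hφ => innerL2_closed_eq_zero hα hφ
    have h3 : innerL2 h (d r α) (d r α) = s * innerL2 h α α := by
      rw [← hα α, ← innerL2_smul_right, hsum]
    have h4 : α = 0 := by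
      refine eq_zero_of_innerL2 h0.ne' ?_
      have := innerL2_self_nonneg h α
      nlinarith
    refine ⟨h1.1, by rw [hsum, h4, map_zero], fun ζ _ => ?_⟩
    change innerL2 h (d r ζ) ξ = 0
    rw [hα ζ, h4, innerL2_zero_right]

/-- A harmonic form without periods is exact and orthogonal to all exact forms; in degree zero it is
a constant of integral zero. -/
theorem eq_zero_of_harmonic {h : ℝ} (h0 : 0 < h) (hle : h ≤ 1) {r : ℕ} {ξ : Form r}
    (hξ : ξ ∈ eigenspace h r 0) (hper : periods r ξ = 0) : ξ = 0 := by
  obtain ⟨h1, -, h2⟩ := harmonic_of_lt_gap (κ := h ^ 4 / 100) h0 hle (Or.inl le_rfl)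
    (by positivity) (show IsLaplacian h r ξ ((0 : ℝ) • ξ) from hξ)
  cases r with
  | zero =>
    rw [eq_const_of_d_eq_zero h1, hper]
    simp
  | succ r =>
    obtain ⟨ζ, rfl, -⟩ := exists_primitive h1 hper
    exact eq_zero_of_innerL2 h0.ne' (h2 ζ rfl)

theorem rank_harmonic_le_two {h : ℝ} (h0 : 0 < h) (hle : h ≤ 1) (r : ℕ) :
    Module.rank ℝ (eigenspace h r 0) ≤ 2 := by
  have h1 : Function.Injective (periods r ∘ₗ (eigenspace h r 0).subtype) :=
    (injective_iff_map_eq_zero _).2 fun ξ hξ => Subtype.ext (eq_zero_of_harmonic h0 hle ξ.2 hξ)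
  refine (LinearMap.rank_le_of_injective _ h1).trans ?_
  rw [rank_prod', Module.rank_self, one_add_one_eq_two]

theorem rank_harmonic_le_one {h : ℝ} (h0 : 0 < h) (hle : h ≤ 1) {r : ℕ} (hr : r = 0 ∨ r = 3) :
    Module.rank ℝ (eigenspace h r 0) ≤ 1 := by
  have h1 : Function.Injective
      (LinearMap.fst ℝ ℝ ℝ ∘ₗ periods r ∘ₗ (eigenspace h r 0).subtype) := by
    refine (injective_iff_map_eq_zero _).2 fun ξ hξ =>
      Subtype.ext (eq_zero_of_harmonic h0 hle ξ.2 (Prod.ext hξ ?_))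
    rcases hr with rfl | rfl <;> rfl
  refine (LinearMap.rank_le_of_injective _ h1).trans ?_
  rw [Module.rank_self]

/-! ### Counting eigenvalues -/

/-- Below the gap every nonzero eigenform has eigenvalue 0, so all the eigenspaces counted lie in
the harmonic space. -/
theorem countingFunction_le_of_lt_gap {h κ t : ℝ} (h0 : 0 < h) (hle : h ≤ 1) {r : ℕ}
    (hκ : κ ≤ h ^ 4 / 100 ∨ (r = 0 ∨ r = 3) ∧ κ ≤ h ^ 2 / 300) (ht : t < κ) :
    countingFunction h r t ≤ Module.rank ℝ (eigenspace h r 0) := by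
  refine Submodule.rank_mono (iSup_le fun s ξ hξ => ?_)
  have h1 := (harmonic_of_lt_gap h0 hle hκ (lt_of_le_of_lt s.2 ht)
    (show IsLaplacian h r ξ (s.1 • ξ) from hξ)).2.1
  rcases smul_eq_zero.1 h1 with h2 | h2
  · rwa [h2] at hξ
  · rw [h2]
    exact zero_mem _

theorem le_countingFunction {h t : ℝ} {r n : ℕ} {v : Fin n → Form r} (hv : LinearIndependent ℝ v)
    {s : Fin n → ℝ} (hs : ∀ i, s i ≤ t) (hvs : ∀ i, v i ∈ eigenspace h r (s i)) :
    (n : Cardinal) ≤ countingFunction h r t := by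
  have hmem : ∀ i, v i ∈ (⨆ s : Set.Iic t, eigenspace h r s : Submodule ℝ (Form r)) := fun i =>
    (le_iSup (fun s : Set.Iic t => eigenspace h r s) ⟨s i, hs i⟩) (hvs i)
  have h1 : LinearIndependent ℝ fun i =>
      (⟨v i, hmem i⟩ : (⨆ s : Set.Iic t, eigenspace h r s : Submodule ℝ (Form r))) :=
    LinearIndependent.of_comp (Submodule.subtype _) hv
  have := h1.cardinal_le_rank
  rwa [Cardinal.mk_fin] at this

theorem countingFunction_of_neg {h t : ℝ} (hh : h ≠ 0) {r : ℕ} (ht : t < 0) :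
    countingFunction h r t = 0 := by
  have : (⨆ s : Set.Iic t, eigenspace h r s : Submodule ℝ (Form r)) = ⊥ :=
    iSup_eq_bot.2 fun s => eigenspace_eq_bot_of_neg hh (lt_of_le_of_lt s.2 ht)
  rw [countingFunction, this, rank_bot]

theorem eigenvalueBranch_le {h t : ℝ} {r i : ℕ}
    (ht : ((i + 1 : ℕ) : Cardinal) ≤ countingFunction h r t) : eigenvalueBranch r i h ≤ t :=
  sInf_le ⟨t, rfl, ht⟩

theorem le_eigenvalueBranch {h κ : ℝ} {r i : ℕ}
    (ht : ∀ t < κ, countingFunction h r t < ((i + 1 : ℕ) : Cardinal)) :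
    (κ : EReal) ≤ eigenvalueBranch r i h := by
  refine le_sInf ?_
  rintro x ⟨t, rfl, hx⟩
  by_contra hlt
  exact absurd hx (not_le.2 (ht t (EReal.coe_lt_coe_iff.1 (not_le.1 hlt))))

theorem eigenvalueBranch_nonneg {h : ℝ} (hh : h ≠ 0) (r i : ℕ) : 0 ≤ eigenvalueBranch r i h := by
  refine le_eigenvalueBranch (κ := 0) fun t ht => ?_
  rw [countingFunction_of_neg hh ht]
  exact_mod_cast Nat.succ_pos i

theorem isBigOPow_of_le {lam : ℝ → EReal} {C : ℝ} {m : ℕ}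
    (hlam : ∀ h : ℝ, 0 < h → h ≤ 1 → 0 ≤ lam h ∧ lam h ≤ (C * h ^ m : ℝ)) : IsBigOPow lam m := by
  refine ⟨C, ?_⟩
  filter_upwards [Ioc_mem_nhdsGT one_pos] with h hh
  obtain ⟨h1, h2⟩ := hlam h hh.1 hh.2
  induction hx : lam h with
  | bot => simp [hx] at h1
  | top =>
    rw [hx, top_le_iff] at h2
    exact absurd h2 (EReal.coe_ne_top _)
  | coe x =>
    rw [hx] at h1 h2
    have h1' : 0 ≤ x := EReal.coe_nonneg.1 h1
    rw [EReal.abs_def, abs_of_nonneg h1']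
    exact ENNReal.ofReal_le_ofReal (EReal.coe_le_coe_iff.1 h2)

theorem not_isBigOPow_of_le {lam : ℝ → EReal} {c : ℝ} (hc : 0 < c) {n m : ℕ} (hnm : n < m)
    (hlam : ∀ h : ℝ, 0 < h → h ≤ 1 → (c * h ^ n : ℝ) ≤ lam h) : ¬ IsBigOPow lam m := by
  rintro ⟨C, hC⟩
  have hlim : Tendsto (fun h : ℝ => C * h ^ (m - n)) (𝓝[>] 0) (𝓝 0) := by
    have : Continuous fun h : ℝ => C * h ^ (m - n) := by fun_prop
    have h2 := this.tendsto 0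
    rw [zero_pow (by omega), mul_zero] at h2
    exact h2.mono_left nhdsWithin_le_nhds
  obtain ⟨h, h1, h2, h3⟩ := (hC.and ((hlim.eventually_lt_const hc).and
    (Ioc_mem_nhdsGT one_pos))).exists
  have hpos : 0 < h ^ n := pow_pos h3.1 n
  have h4 := hlam h h3.1 h3.2
  have h5 : ENNReal.ofReal (c * h ^ n) ≤ (lam h).abs := by
    induction hx : lam h with
    | bot =>
      rw [hx, le_bot_iff] at h4
      exact absurd h4 (EReal.coe_ne_bot _)
    | top => simp
    | coe x =>
      rw [hx, EReal.coe_le_coe_iff] at h4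
      rw [EReal.abs_def]
      exact ENNReal.ofReal_le_ofReal (h4.trans (le_abs_self x))
  have h6 : c * h ^ n ≤ C * h ^ m := by
    have h7 := h5.trans h1
    by_contra hlt
    exact absurd h7 (not_le.2 (ENNReal.ofReal_lt_ofReal_iff (mul_pos hc hpos) |>.2 (not_le.1 hlt)))
  have h8 : C * h ^ m = (C * h ^ (m - n)) * h ^ n := by
    rw [mul_assoc, ← pow_add, Nat.sub_add_cancel hnm.le]
  rw [h8] at h6
  have := le_of_mul_le_mul_right h6 hpos
  linarith

/-! ### Harmonic forms -/

theorem lieDer_one (v : Heis) : lieDer v 1 = 0 := by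
  simpa using lieDer_algebraMap v 1

theorem mem_eigenspace_zero_of_codiff {h : ℝ} {r : ℕ} {ξ : Form (r + 1)} (h1 : d (r + 1) ξ = 0)
    (h2 : IsCodiff h ξ 0) : ξ ∈ eigenspace h (r + 1) 0 :=
  ⟨0, 0, h2, h1 ▸ isCodiff_zero h, by simp⟩

theorem form0_one_mem (h : ℝ) : form0 1 ∈ eigenspace h 0 0 := by
  change IsCodiff h (d 0 (form0 1)) ((0 : ℝ) • form0 1)
  rw [d_form0, lieDer_one, lieDer_one, lieDer_one, zero_smul]
  exact (map_zero form1) ▸ isCodiff_zero h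

theorem form1_one_mem (h s t : ℝ) : form1 (s • 1, t • 1, 0) ∈ eigenspace h 1 0 := by
  refine mem_eigenspace_zero_of_codiff ?_ ?_
  · rw [d_form1]
    simp only [map_smul, lieDer_one, map_zero, smul_zero, sub_zero]
    exact map_zero form2
  · have := isCodiff_form1 (h := h) (s • 1) (t • 1) 0
    simpa only [map_smul, lieDer_one, map_zero, smul_zero, add_zero, neg_zero] using this

theorem form2_one_mem (h s t : ℝ) : form2 (0, s • 1, t • 1) ∈ eigenspace h 2 0 := by
  refine mem_eigenspace_zero_of_codiff ?_ ?_
  · rw [d_form2]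
    simp only [map_smul, lieDer_one, map_zero, smul_zero, sub_zero, add_zero]
  · have := isCodiff_form2 (h := h) 0 (s • 1) (t • 1)
    simp only [map_smul, lieDer_one, map_zero, smul_zero, add_zero, neg_zero, sub_zero] at this
    exact (map_zero form1) ▸ this

theorem form3_one_mem (h : ℝ) : form3 1 ∈ eigenspace h 3 0 := by
  refine mem_eigenspace_zero_of_codiff (Form.eq_zero_of_three_lt (by norm_num) _) ?_
  have := isCodiff_form3 (h := h) 1
  simp only [lieDer_one, smul_zero, neg_zero] at this
  exact (map_zero form2) ▸ this

theorem InvFun.one_ne_zero : (1 : InvFun) ≠ 0 := fun h => by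
  have := integ_one
  rw [h, map_zero] at this
  exact zero_ne_one this

theorem one_le_countingFunction_zero (h : ℝ) {r : ℕ} (hr : r = 0 ∨ r = 3) :
    ((1 : ℕ) : Cardinal) ≤ countingFunction h r 0 := by
  rcases hr with rfl | rfl
  · exact le_countingFunction (v := fun _ => form0 1) (s := fun _ => 0)
      (LinearIndependent.of_subsingleton 0 (form0_eq_zero.not.2 InvFun.one_ne_zero))
      (fun _ => le_rfl) fun _ => form0_one_mem h
  · exact le_countingFunction (v := fun _ => form3 1) (s := fun _ => 0)
      (LinearIndependent.of_subsingleton 0 (form3_eq_zero.not.2 InvFun.one_ne_zero))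
      (fun _ => le_rfl) fun _ => form3_one_mem h

theorem two_le_countingFunction_zero (h : ℝ) {r : ℕ} (hr : r = 1 ∨ r = 2) :
    ((2 : ℕ) : Cardinal) ≤ countingFunction h r 0 := by
  rcases hr with rfl | rfl
  · refine le_countingFunction (s := fun _ => 0)
      (v := ![form1 ((1 : ℝ) • 1, (0 : ℝ) • 1, 0), form1 ((0 : ℝ) • 1, (1 : ℝ) • 1, 0)]) ?_
      (fun _ => le_rfl) fun i => by fin_cases i <;> exact form1_one_mem h _ _
    rw [LinearIndependent.pair_iff]
    intro s t hst
    rw [← map_smul, ← map_smul, ← map_add] at hst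
    have := congrArg (periods 1) hst
    simp only [Prod.smul_mk, Prod.mk_add_mk, periods_form1, map_add, map_smul, integ_one,
      map_zero, Prod.mk_eq_zero] at this
    simpa using this
  · refine le_countingFunction (s := fun _ => 0)
      (v := ![form2 (0, (1 : ℝ) • 1, (0 : ℝ) • 1), form2 (0, (0 : ℝ) • 1, (1 : ℝ) • 1)]) ?_
      (fun _ => le_rfl) fun i => by fin_cases i <;> exact form2_one_mem h _ _
    rw [LinearIndependent.pair_iff]
    intro s t hst
    rw [← map_smul, ← map_smul, ← map_add] at hst
    have := congrArg (periods 2) hst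
    simp only [Prod.smul_mk, Prod.mk_add_mk, periods_form2, map_add, map_smul, integ_one,
      map_zero, Prod.mk_eq_zero] at this
    simpa using this

theorem eigenvalueBranch_eq_zero {h : ℝ} (hh : h ≠ 0) {r i : ℕ}
    (hi : ((i + 1 : ℕ) : Cardinal) ≤ countingFunction h r 0) : eigenvalueBranch r i h = 0 :=
  le_antisymm (eigenvalueBranch_le hi) (eigenvalueBranch_nonneg hh r i)

theorem isBigOPow_zero {lam : ℝ → EReal} (hlam : ∀ h : ℝ, 0 < h → lam h = 0) (m : ℕ) :
    IsBigOPow lam m :=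
  isBigOPow_of_le (C := 0) fun h h0 _ => by simp [hlam h h0]

theorem smallCount_eq_one {r k : ℕ} (hr : r = 0 ∨ r = 3) (hk : 2 ≤ k) :
    smallCount r (2 * k) = 1 := by
  have : {i : ℕ | IsBigOPow (eigenvalueBranch r i) (2 * k)} = {0} := by
    ext i
    simp only [Set.mem_ofPred_eq, Set.mem_singleton_iff]
    constructor
    · intro hi
      by_contra hne
      -- Beyond the single harmonic form, every branch lies above a multiple of h², and 2 < 2k.
      refine not_isBigOPow_of_le (c := 1 / 300) (n := 2) (by norm_num) (by omega)
        (fun h h0 hle => le_eigenvalueBranch fun t ht => ?_) hi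
      refine (countingFunction_le_of_lt_gap h0 hle
        (Or.inr ⟨hr, (by linarith : 1 / 300 * h ^ 2 ≤ h ^ 2 / 300)⟩) ht).trans_lt
        ((rank_harmonic_le_one h0 hle hr).trans_lt ?_)
      exact_mod_cast (by omega : 1 < i + 1)
    · rintro rfl
      exact isBigOPow_zero (fun h h0 =>
        eigenvalueBranch_eq_zero h0.ne' (one_le_countingFunction_zero h hr)) _
  rw [smallCount, this, Set.encard_singleton]

theorem eigenvalueBranch_eq_zero_of_le_one {h : ℝ} (hh : h ≠ 0) {r i : ℕ} (hr : r = 1 ∨ r = 2)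
    (hi : i ≤ 1) : eigenvalueBranch r i h = 0 :=
  eigenvalueBranch_eq_zero hh (le_trans (by exact_mod_cast (by omega : i + 1 ≤ 2))
    (two_le_countingFunction_zero h hr))

theorem smallCount_eq_two {r k : ℕ} (hr : r = 1 ∨ r = 2) (hk : 3 ≤ k) :
    smallCount r (2 * k) = 2 := by
  have : {i : ℕ | IsBigOPow (eigenvalueBranch r i) (2 * k)} = {0, 1} := by
    ext i
    simp only [Set.mem_ofPred_eq, Set.mem_insert_iff, Set.mem_singleton_iff]
    constructor
    · intro hi
      by_contra hne
      -- The gap now has order h⁴, and 4 < 2k is where k ≥ 3 enters.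
      refine not_isBigOPow_of_le (c := 1 / 100) (n := 4) (by norm_num) (by omega)
        (fun h h0 hle => le_eigenvalueBranch fun t ht => ?_) hi
      refine (countingFunction_le_of_lt_gap h0 hle
        (Or.inl (by linarith : 1 / 100 * h ^ 4 ≤ h ^ 4 / 100)) ht).trans_lt
        ((rank_harmonic_le_two h0 hle r).trans_lt ?_)
      exact_mod_cast (by omega : 2 < i + 1)
    · intro hi
      exact isBigOPow_zero (fun h h0 =>
        eigenvalueBranch_eq_zero_of_le_one h0.ne' hr (by omega)) _
  rw [smallCount, this, Set.encard_pair (by norm_num)]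

/-! ### Small eigenvalues -/

/-- The frequency `2π(n + 1)`. -/
def freq (n : ℕ) : ℝ := 2 * Real.pi * (n + 1)

theorem freq_pos (n : ℕ) : 0 < freq n := by
  have := Real.pi_pos
  unfold freq
  positivity

theorem freq_mono {n m : ℕ} (h : n ≤ m) : freq n ≤ freq m := by
  have := Real.pi_pos
  have h' : (n : ℝ) ≤ m := by exact_mod_cast h
  unfold freq
  gcongr

/-- `cos (2π(n + 1)y)` as a function on the circle. -/
def cosFun (n : ℕ) : circleFunctions :=
  ⟨fun t => Real.cos (freq n * t), by fun_prop, fun t => by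
    beta_reduce
    rw [show freq n * (t + 1) = freq n * t + (n + 1 : ℕ) * (2 * Real.pi) by
      push_cast [freq]; ring, Real.cos_add_nat_mul_two_pi]⟩

/-- `sin (2π(n + 1)y)` as a function on the circle. -/
def sinFun (n : ℕ) : circleFunctions :=
  ⟨fun t => Real.sin (freq n * t), by fun_prop, fun t => by
    beta_reduce
    rw [show freq n * (t + 1) = freq n * t + (n + 1 : ℕ) * (2 * Real.pi) by
      push_cast [freq]; ring, Real.sin_add_nat_mul_two_pi]⟩

theorem circleDeriv_cosFun (n : ℕ) : circleDeriv (cosFun n) = -freq n • sinFun n :=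
  Subtype.ext <| funext fun t => by
    have h : HasDerivAt (fun t => Real.cos (freq n * t))
        (-Real.sin (freq n * t) * (freq n * 1)) t := ((hasDerivAt_id t).const_mul (freq n)).cos
    refine h.deriv.trans ?_
    change _ = -freq n * Real.sin (freq n * t)
    ring

theorem circleDeriv_sinFun (n : ℕ) : circleDeriv (sinFun n) = freq n • cosFun n :=
  Subtype.ext <| funext fun t => by
    have h : HasDerivAt (fun t => Real.sin (freq n * t))
        (Real.cos (freq n * t) * (freq n * 1)) t := ((hasDerivAt_id t).const_mul (freq n)).sin
    refine h.deriv.trans ?_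
    change _ = freq n * Real.cos (freq n * t)
    ring

/-- These are eigenfunctions of the second derivative for distinct eigenvalues. -/
theorem linearIndependent_cosFun : LinearIndependent ℝ cosFun := by
  refine Module.End.eigenvectors_linearIndependent' (circleDeriv ∘ₗ circleDeriv)
    (fun n => -freq n ^ 2) (fun n m hnm => ?_) cosFun fun n => ⟨?_, fun h0 => ?_⟩
  · have h1 : freq n = freq m :=
      (pow_left_inj₀ (freq_pos n).le (freq_pos m).le two_ne_zero).1 (neg_inj.1 hnm)
    have h2 := mul_left_cancel₀ (by positivity) h1
    exact_mod_cast add_right_cancel h2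
  · rw [Module.End.mem_eigenspace_iff, LinearMap.comp_apply, circleDeriv_cosFun, map_smul,
      circleDeriv_sinFun, smul_smul]
    ring_nf
  · have := congrFun (congrArg Subtype.val h0) 0
    simp [cosFun] at this

/-- `cos (2π(n + 1)y)` as a function on `M`. -/
def cosY (n : ℕ) : InvFun := circlePull (cosFun n)
/-- `sin (2π(n + 1)y)` as a function on `M`. -/
def sinY (n : ℕ) : InvFun := circlePull (sinFun n)

theorem dX_cosY (n : ℕ) : dX (cosY n) = 0 := dX_circlePull _
theorem dZ_cosY (n : ℕ) : dZ (cosY n) = 0 := dZ_circlePull _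
theorem dX_sinY (n : ℕ) : dX (sinY n) = 0 := dX_circlePull _
theorem dZ_sinY (n : ℕ) : dZ (sinY n) = 0 := dZ_circlePull _
theorem dY_cosY (n : ℕ) : dY (cosY n) = -freq n • sinY n := by
  rw [cosY, dY_circlePull, circleDeriv_cosFun, map_smul, sinY]

theorem dY_sinY (n : ℕ) : dY (sinY n) = freq n • cosY n := by
  rw [sinY, dY_circlePull, circleDeriv_sinFun, map_smul, cosY]

theorem linearIndependent_cosY : LinearIndependent ℝ cosY :=
  linearIndependent_cosFun.map' circlePull (LinearMap.ker_eq_bot.2 circlePull_injective)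

theorem linearIndependent_cosY_fin (m : ℕ) : LinearIndependent ℝ fun n : Fin m => cosY n :=
  linearIndependent_cosY.comp _ Fin.val_injective

theorem smallCount_eq_top {r m : ℕ}
    (hbound : ∀ i : ℕ, ∃ C : ℝ, ∀ h : ℝ, 0 < h → h ≤ 1 →
      ((i + 1 : ℕ) : Cardinal) ≤ countingFunction h r (C * h ^ m)) : smallCount r m = ⊤ := by
  have : {i : ℕ | IsBigOPow (eigenvalueBranch r i) m} = Set.univ :=
    Set.eq_univ_of_forall fun i => by
      obtain ⟨C, hC⟩ := hbound i
      exact isBigOPow_of_le fun h h0 hle =>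
        ⟨eigenvalueBranch_nonneg h0.ne' r i, eigenvalueBranch_le (hC h h0 hle)⟩
  rw [smallCount, this, Set.encard_univ]
  simp

theorem countingFunction_mono (h : ℝ) (r : ℕ) {t t' : ℝ} (ht : t ≤ t') :
    countingFunction h r t ≤ countingFunction h r t' :=
  Submodule.rank_mono (iSup_le fun s => le_iSup (fun s : Set.Iic t' => eigenspace h r s)
    ⟨s.1, le_trans s.2 ht⟩)

theorem form0_cosY_mem (h : ℝ) (n : ℕ) :
    form0 (cosY n) ∈ eigenspace h 0 (freq n ^ 2 * h ^ 2) := by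
  change IsCodiff h (d 0 (form0 (cosY n))) ((freq n ^ 2 * h ^ 2) • form0 (cosY n))
  have := isCodiff_form1 (h := h) (dX (cosY n)) (dY (cosY n)) (dZ (cosY n))
  rw [d_form0]
  convert this using 1
  rw [dX_cosY, dZ_cosY, dY_cosY, map_zero, map_zero, map_smul, dY_sinY, ← map_smul, smul_zero,
    add_zero, zero_add, smul_smul, smul_smul, ← neg_smul]
  congr 2
  ring

theorem form3_cosY_mem (h : ℝ) (n : ℕ) :
    form3 (cosY n) ∈ eigenspace h 3 (freq n ^ 2 * h ^ 2) := by
  refine ⟨_, 0, isCodiff_form3 (cosY n), ?_, ?_⟩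
  · rw [Form.eq_zero_of_three_lt (by norm_num) (d 3 _)]
    exact isCodiff_zero h
  · rw [dZ_cosY, dX_cosY, d_form2, dY_cosY]
    simp only [smul_zero, neg_zero, map_zero, map_smul, dY_sinY, zero_sub, add_zero]
    rw [← map_smul, smul_smul, smul_smul, ← neg_smul]
    congr 2
    ring

/-! ### Eigenforms of order h⁴ in degrees one and two. -/

/-- The positive root of `h² q² + q = m²`. -/
theorem exists_root (h : ℝ) {m : ℝ} (hm : 0 < m) :
    ∃ q : ℝ, 0 < q ∧ h ^ 2 * q ^ 2 + q = m ^ 2 := by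
  set S := Real.sqrt (1 + 4 * h ^ 2 * m ^ 2) with hS
  have hS2 : S ^ 2 = 1 + 4 * h ^ 2 * m ^ 2 := Real.sq_sqrt (by positivity)
  have hS0 : 0 ≤ S := Real.sqrt_nonneg _
  have hS1 : 1 + S ≠ 0 := by positivity
  -- The quadratic formula (S - 1) / (2h²), rationalised so that nothing is divided by h.
  refine ⟨2 * m ^ 2 / (1 + S), by positivity, ?_⟩
  field_simp
  linear_combination -hS2

theorem form1_cosY_codiff (h : ℝ) (n : ℕ) (q : ℝ) :
    IsCodiff h (form1 (freq n • cosY n, 0, q • sinY n)) 0 := by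
  have := isCodiff_form1 (h := h) (freq n • cosY n) 0 (q • sinY n)
  simpa only [map_smul, dX_cosY, dZ_sinY, map_zero, smul_zero, add_zero, neg_zero] using this

theorem d_form1_cosY (n : ℕ) (q : ℝ) : d 1 (form1 (freq n • cosY n, 0, q • sinY n)) =
    form2 ((freq n ^ 2 - q) • sinY n, 0, (q * freq n) • cosY n) := by
  rw [d_form1]
  simp only [map_smul, dX_sinY, dZ_cosY, dY_cosY, dY_sinY, map_zero, smul_zero, sub_zero, zero_sub,
    smul_smul]
  congr 2
  module

/-- On the span of cos(my) α and sin(my) θ this is a two-dimensional eigenvalue problem. The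
α-component gives the eigenvalue h²(m² - q); the θ-component agrees with it exactly when h²q² + q =
m², and then the eigenvalue equals h⁴q². -/
theorem codiff_d_form1_cosY {h : ℝ} {n : ℕ} {q : ℝ} (hq : h ^ 2 * q ^ 2 + q = freq n ^ 2) :
    IsCodiff h (d 1 (form1 (freq n • cosY n, 0, q • sinY n)))
      ((h ^ 4 * q ^ 2) • form1 (freq n • cosY n, 0, q • sinY n)) := by
  have := isCodiff_form2 (h := h) ((freq n ^ 2 - q) • sinY n) 0 ((q * freq n) • cosY n)
  rw [d_form1_cosY]
  convert this using 1
  rw [← map_smul, Prod.smul_mk, Prod.smul_mk]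
  have h1 : freq n ^ 2 - q = h ^ 2 * q ^ 2 := by linarith
  simp only [map_smul, dX_sinY, dZ_cosY, dY_cosY, dY_sinY, map_zero, smul_zero, sub_zero, neg_zero,
    add_zero, smul_smul]
  congr 2
  · rw [h1]
    congr 1
    ring
  · congr 1
    rw [← neg_smul, ← sub_smul]
    congr 1
    linear_combination (-q * h ^ 2 + 1) * h1

theorem linearIndependent_form1_cosY (m : ℕ) (q : Fin m → ℝ) :
    LinearIndependent ℝ fun n : Fin m => form1 (freq n • cosY n, 0, q n • sinY n) := by
  refine LinearIndependent.of_comp (frameCoef ![0]) ?_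
  convert (linearIndependent_cosY_fin m).units_smul
    (fun n => Units.mk0 (freq n) (freq_pos n).ne') using 1
  funext n
  exact frameCoef_form1_zero _ _ _

theorem linearIndependent_form2_cosY (m : ℕ) {q : Fin m → ℝ} (hq : ∀ n, 0 < q n) :
    LinearIndependent ℝ fun n : Fin m =>
      form2 ((freq n ^ 2 - q n) • sinY n, 0, (q n * freq n) • cosY n) := by
  refine LinearIndependent.of_comp (frameCoef ![1, 2]) ?_
  convert (linearIndependent_cosY_fin m).units_smul
    (fun n => Units.mk0 (q n * freq n) (mul_pos (hq n) (freq_pos n)).ne') using 1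
  funext n
  exact frameCoef_form2_one_two _ _ _

theorem le_countingFunction_sq {r : ℕ} (hr : r = 0 ∨ r = 3) (i : ℕ) (h : ℝ) :
    ((i + 1 : ℕ) : Cardinal) ≤ countingFunction h r (freq i ^ 2 * h ^ 2) := by
  have hle : ∀ n : Fin (i + 1), freq n ^ 2 * h ^ 2 ≤ freq i ^ 2 * h ^ 2 := fun n => by
    have := freq_pos n
    gcongr
    exact freq_mono (Nat.lt_succ_iff.1 n.2)
  rcases hr with rfl | rfl
  · exact le_countingFunction ((linearIndependent_cosY_fin (i + 1)).map' form0
      (LinearMap.ker_eq_bot.2 fun _ _ h => form0_inj.1 h)) hle fun n => form0_cosY_mem h n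
  · exact le_countingFunction ((linearIndependent_cosY_fin (i + 1)).map' form3
      (LinearMap.ker_eq_bot.2 fun _ _ h => form3_inj.1 h)) hle fun n => form3_cosY_mem h n

theorem le_countingFunction_four {r : ℕ} (hr : r = 1 ∨ r = 2) (i : ℕ) (h : ℝ) :
    ((i + 1 : ℕ) : Cardinal) ≤ countingFunction h r (freq i ^ 4 * h ^ 4) := by
  choose q hq0 hq using fun n : Fin (i + 1) => exists_root h (freq_pos n)
  have hle : ∀ n : Fin (i + 1), h ^ 4 * q n ^ 2 ≤ freq i ^ 4 * h ^ 4 := fun n => by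
    -- Dropping the nonnegative term h²q² bounds q uniformly in h, so the eigenvalue h⁴q² is O(h⁴).
    have h1 : q n ≤ freq i ^ 2 := by
      have h2 := hq n
      have h3 : 0 ≤ h ^ 2 * q n ^ 2 := by positivity
      have h4 : freq n ^ 2 ≤ freq i ^ 2 :=
        pow_le_pow_left₀ (freq_pos n).le (freq_mono (Nat.lt_succ_iff.1 n.2)) 2
      linarith
    have h2 : q n ^ 2 ≤ freq i ^ 4 := by
      have := pow_le_pow_left₀ (hq0 n).le h1 2
      rwa [← pow_mul] at this
    rw [mul_comm]
    gcongr
  rcases hr with rfl | rfl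
  · refine le_countingFunction (linearIndependent_form1_cosY (i + 1) q) hle fun n => ?_
    exact ⟨0, _, form1_cosY_codiff h n (q n), codiff_d_form1_cosY (hq n), by simp⟩
  · refine le_countingFunction (linearIndependent_form2_cosY (i + 1) hq0) hle fun n => ?_
    -- The differential of a coclosed eigenform is an exact eigenform with the same eigenvalue.
    rw [← d_form1_cosY]
    exact ⟨_, 0, codiff_d_form1_cosY (hq n), by rw [d_d]; exact isCodiff_zero h, by simp⟩

theorem smallCount_two_eq_top {r : ℕ} (hr : r = 0 ∨ r = 3) : smallCount r 2 = ⊤ :=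
  smallCount_eq_top fun i => ⟨freq i ^ 2, fun h _ _ => le_countingFunction_sq hr i h⟩

theorem smallCount_four_eq_top {r : ℕ} (hr : r = 1 ∨ r = 2) : smallCount r 4 = ⊤ :=
  smallCount_eq_top fun i => ⟨freq i ^ 4, fun h _ _ => le_countingFunction_four hr i h⟩

theorem smallCount_two_eq_top' {r : ℕ} (hr : r = 1 ∨ r = 2) : smallCount r 2 = ⊤ :=
  smallCount_eq_top fun i => ⟨freq i ^ 4, fun h h0 hle =>
    (le_countingFunction_four hr i h).trans (countingFunction_mono h r
      (mul_le_mul_of_nonneg_left (pow_le_pow_of_le_one h0.le hle (by norm_num))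
        (pow_nonneg (freq_pos i).le 4)))⟩

/-! ### The filtration -/

theorem mem_leafTangent {p v : Heis} : v ∈ leafTangent p ↔ v 1 = 0 ∧ v 2 = 0 := by
  rw [leafTangent, Submodule.mem_span_singleton, leafField, leftField_eq]
  constructor
  · rintro ⟨c, rfl⟩
    simp
  · rintro ⟨h1, h2⟩
    refine ⟨v 0, ?_⟩
    ext i
    fin_cases i <;> simp [h1, h2]

/-- Any set of tangential arguments may be used instead of the full one, so it can be exhibited by
hand. -/
theorem mem_filt {k : ℤ} {r : ℕ} {ξ : Form r} : ξ ∈ filt k r ↔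
    ∀ (p : Heis) (v : Fin r → Heis) (s : Finset (Fin r)), (∀ j ∈ s, v j ∈ leafTangent p) →
      (r : ℤ) - k + 1 ≤ s.card → ξ.toFun p v = 0 := by
  classical
  constructor
  · intro h p v s hs hk
    refine h p v (hk.trans ?_)
    exact_mod_cast Finset.card_le_card fun j hj => Finset.mem_filter.2 ⟨Finset.mem_univ j, hs j hj⟩
  · intro h p v hk
    refine h p v (Finset.univ.filter fun j => v j ∈ leafTangent p)
      (fun j hj => (Finset.mem_filter.1 hj).2) ?_
    convert hk

/-- Besides the formal case r < k, the codimension 2 enters: a nonzero 3-form on H involves the leaf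
direction. -/
theorem filt_eq_bot {k : ℤ} {r : ℕ} (h : (r : ℤ) < k ∨ 3 ≤ r ∧ 3 ≤ k ∨ 3 < r) :
    filt k r = ⊥ := by
  refine (Submodule.eq_bot_iff _).2 fun ξ hξ => ?_
  rw [mem_filt] at hξ
  rcases h with h | ⟨hr, hk⟩ | hr
  · exact Form.ext_apply fun p v => hξ p v ∅ (by simp) (by simp; omega)
  · rcases hr.eq_or_lt with rfl | hr
    · obtain ⟨w, rfl⟩ := exists_form3 ξ
      rw [form3_eq_zero]
      refine Subtype.ext <| funext fun p => ?_
      have := hξ p (fun j => leftField (Pi.single j 1) p) {0}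
        (by simp [mem_leafTangent, leftField_eq]) (by simp; omega)
      rw [form3_apply] at this
      simpa [leftField_eq, Matrix.det_fin_three] using this
    · exact Form.eq_zero_of_three_lt hr ξ
  · exact Form.eq_zero_of_three_lt hr ξ

/-- Leaves are one-dimensional, so two tangential arguments are dependent and every form vanishes on
them. -/
theorem filt_eq_top {k : ℤ} {r : ℕ} (h : k ≤ 0 ∨ k + 1 ≤ r) : filt k r = ⊤ := by
  refine (Submodule.eq_top_iff').2 fun ξ => mem_filt.2 fun p v s hs hk => ?_
  have hcard : s.card ≤ r := by simpa using Finset.card_le_univ s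
  rcases h with h | h
  · omega
  · obtain ⟨i, hi, j, hj, hij⟩ := Finset.one_lt_card.1 (by omega : 1 < s.card)
    refine (ξ.toFun p).toAlternatingMap.map_linearDependent v fun hv => ?_
    have h1 := mem_leafTangent.1 (hs i hi)
    have h2 := mem_leafTangent.1 (hs j hj)
    have h3 : v j 0 • v i + (-v i 0) • v j = 0 := by
      ext l
      fin_cases l <;> simp [h1, h2]
      ring
    have h4 : LinearIndependent ℝ ![v i, v j] := by
      have h5 : v ∘ ![i, j] = ![v i, v j] := by
        ext l
        fin_cases l <;> rfl
      rw [← h5]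
      exact hv.comp ![i, j]
        (by simpa [Function.Injective, Fin.forall_fin_two] using ⟨hij, hij.symm⟩)
    have h5 := (LinearIndependent.pair_iff.1 h4 _ _ h3).2
    refine hv.ne_zero i (funext fun l => ?_)
    fin_cases l <;> simp [h1, neg_eq_zero.1 h5]

theorem form1_mem_filt {f g k : InvFun} : form1 (f, g, k) ∈ filt 1 1 ↔ f = 0 := by
  rw [mem_filt]
  constructor
  · intro h
    refine Subtype.ext <| funext fun p => ?_
    have := h p (fun _ => leftField (Pi.single 0 1) p) {0}
      (by simp [mem_leafTangent, leftField_eq]) (by simp)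
    rw [form1_apply] at this
    simpa [leftField_eq] using this
  · rintro rfl p v s hs hk
    obtain ⟨j, hj⟩ := Finset.card_pos.1 (by push_cast at hk; omega : 0 < s.card)
    have h1 := mem_leafTangent.1 (hs j hj)
    rw [Subsingleton.elim j 0] at h1
    rw [form1_apply, h1.1, h1.2]
    simp

theorem form2_mem_filt {a b c : InvFun} : form2 (a, b, c) ∈ filt 2 2 ↔ a = 0 ∧ b = 0 := by
  rw [mem_filt]
  constructor
  · intro h
    constructor
    · refine Subtype.ext <| funext fun p => ?_
      have := h p ![leftField (Pi.single 0 1) p, leftField (Pi.single 1 1) p] {0}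
        (by simp [mem_leafTangent, leftField_eq]) (by simp)
      rw [form2_apply] at this
      simpa [leftField_eq] using this
    · refine Subtype.ext <| funext fun p => ?_
      have := h p ![leftField (Pi.single 0 1) p, leftField (Pi.single 2 1) p] {0}
        (by simp [mem_leafTangent, leftField_eq]) (by simp)
      rw [form2_apply] at this
      simpa [leftField_eq] using this
  · rintro ⟨rfl, rfl⟩ p v s hs hk
    obtain ⟨j, hj⟩ := Finset.card_pos.1 (by push_cast at hk; omega : 0 < s.card)
    have h1 := mem_leafTangent.1 (hs j hj)
    rw [form2_apply]
    fin_cases j <;> simp at h1 <;> simp [h1]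

/-! ### Degeneration -/

theorem ssZ_eq_ssZInf {k u : ℤ} {r : ℕ} (h : (r : ℤ) + 1 < u + k ∨ 2 ≤ r ∧ 3 ≤ u + k ∨ 3 ≤ r) :
    ssZ k u r = ssZInf u r := by
  rw [ssZ, ssZInf, filt_eq_bot (k := u + k) (r := r + 1) (by push_cast; omega)]
  rfl

theorem ssZ_eq_bot {k u : ℤ} {r : ℕ} (h : (r : ℤ) < u ∨ 3 ≤ r ∧ 3 ≤ u ∨ 3 < r) : ssZ k u r = ⊥ := by
  rw [ssZ, filt_eq_bot h, bot_inf_eq]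

theorem ssZInf_eq_bot {u : ℤ} {r : ℕ} (h : (r : ℤ) < u ∨ 3 ≤ r ∧ 3 ≤ u ∨ 3 < r) :
    ssZInf u r = ⊥ := by
  rw [ssZInf, filt_eq_bot h, bot_inf_eq]

theorem ssB_eq_ssBInf {k u : ℤ} {r : ℕ} (hk : 0 ≤ k)
    (h : u - k ≤ 0 ∨ u - k + 2 ≤ r ∨ (r : ℤ) < u ∨ 3 ≤ r ∧ 3 ≤ u ∨ 3 < r) :
    ssB k u r = ssBInf u r := by
  cases r with
  | zero => rfl
  | succ r =>
    rw [ssB, ssBInf, if_neg (by omega)]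
    by_cases h' : ((r + 1 : ℕ) : ℤ) < u ∨ 3 ≤ r + 1 ∧ 3 ≤ u ∨ 3 < r + 1
    · rw [filt_eq_bot h', bot_inf_eq, bot_inf_eq]
    · rw [filt_eq_top (k := u - k) (by push_cast at h h'; omega), Submodule.map_top]

/-- Once u + k ≥ 3 the target filtration space of `d` is zero, so Z_k consists of closed forms; for
B, either the source space is everything or the ambient space is zero. Degrees 0 and 3, and the term
(1, 0), already stabilise at k = 2. -/
theorem degeneration {k u : ℤ} {r : ℕ} (hu : 0 ≤ u)
    (hk : 3 ≤ k ∨ 2 ≤ k ∧ (r = 0 ∨ r = 3 ∨ r = 1 ∧ u = 1)) :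
    ssZ k u r = ssZInf u r ∧ ssDen k u r = ssDenInf u r := by
  refine ⟨ssZ_eq_ssZInf (by omega), ?_⟩
  rw [ssDen, ssDenInf, ssZ_eq_ssZInf (by omega), ssB_eq_ssBInf (by omega) (by omega)]

/-! ### Dimensions of the terms of the spectral sequence -/

section Quotients

variable {V : Type*} [AddCommGroup V] [Module ℝ V] {Z D : Submodule ℝ V}

theorem rank_quotient_eq_zero (h : Z ≤ D) : Module.rank ℝ (Z ⧸ D.comap Z.subtype) = 0 := by
  have : D.comap Z.subtype = ⊤ := Submodule.eq_top_iff'.2 fun x => h x.2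
  rw [this]
  exact rank_subsingleton' _ _

theorem rank_quotient_eq_one (l : V →ₗ[ℝ] ℝ) (h : ∀ x ∈ Z, x ∈ D ↔ l x = 0) {z : V} (hz : z ∈ Z)
    (hlz : l z ≠ 0) : Module.rank ℝ (Z ⧸ D.comap Z.subtype) = 1 := by
  have h1 : D.comap Z.subtype = LinearMap.ker (l ∘ₗ Z.subtype) := by
    ext x
    exact h x.1 x.2
  have h2 : Function.Surjective (l ∘ₗ Z.subtype) := fun t =>
    ⟨(t / l z) • ⟨z, hz⟩, by simp [hlz]⟩
  rw [h1]
  exact Module.rank_eq_one_iff_finrank_eq_one.2 ((((l ∘ₗ Z.subtype).quotKerEquivOfSurjective h2).finrank_eq).trans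
    (Module.finrank_self ℝ))

theorem aleph0_le_rank_circleFunctions : Cardinal.aleph0 ≤ Module.rank ℝ circleFunctions := by
  simpa using linearIndependent_cosFun.cardinal_le_rank

end Quotients

/-- A continuous functional vanishing on the denominator descends to E_k and has closed kernel
there, so it kills the closure of zero; what it detects survives in the Hausdorff quotient. -/
theorem aleph0_le_rank_ssEHat {k u : ℤ} {r : ℕ} (j : circleFunctions →ₗ[ℝ] Form r)
    (hj : ∀ f, j f ∈ ssZ k u r)
    (hl : ∀ f, f = 0 ∨ ∃ l : Form r →ₗ[ℝ] ℝ, Continuous l ∧ (∀ ξ ∈ ssDen k u r, l ξ = 0) ∧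
      l (j f) ≠ 0) :
    Cardinal.aleph0 ≤ Module.rank ℝ (ssEHat k u r) := by
  refine aleph0_le_rank_circleFunctions.trans (LinearMap.rank_le_of_injective
    (Submodule.mkQ _ ∘ₗ Submodule.mkQ _ ∘ₗ j.codRestrict _ hj)
    ((injective_iff_map_eq_zero _).2 fun f hf => ?_))
  refine (hl f).resolve_right ?_
  rintro ⟨l, hc, hD, hne⟩
  have hmem := (Submodule.Quotient.mk_eq_zero _).1 hf
  let L : ssE k u r →ₗ[ℝ] ℝ := Submodule.liftQ _ (l ∘ₗ (ssZ k u r).subtype) fun ξ hξ => hD _ hξ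
  have hL : Continuous L := Continuous.quotient_lift (hc.comp continuous_subtype_val) _
  have hle : (⊥ : Submodule ℝ (ssE k u r)).topologicalClosure ≤ LinearMap.ker L :=
    Submodule.topologicalClosure_minimal _ bot_le (isClosed_singleton.preimage hL)
  exact hne (hle hmem)

theorem dimE_eq_top {k : ℤ} {r u : ℕ} (hu : u ≤ r)
    (h : Cardinal.aleph0 ≤ Module.rank ℝ (ssE k u r)) : dimE k r = ⊤ :=
  top_le_iff.1 ((Cardinal.toENat_eq_top.2 h).symm.le.trans
    (Finset.single_le_sum (f := fun u : ℕ => Cardinal.toENat (Module.rank ℝ (ssE k u r)))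
      (fun _ _ => zero_le) (Finset.mem_range.2 (by omega))))

theorem dimEHat_eq_top {k : ℤ} {r u : ℕ} (hu : u ≤ r)
    (h : Cardinal.aleph0 ≤ Module.rank ℝ (ssEHat k u r)) : dimEHat k r = ⊤ :=
  top_le_iff.1 ((Cardinal.toENat_eq_top.2 h).symm.le.trans
    (Finset.single_le_sum (f := fun u : ℕ => Cardinal.toENat (Module.rank ℝ (ssEHat k u r)))
      (fun _ _ => zero_le) (Finset.mem_range.2 (by omega))))

/-! ### Continuous functionals on forms. -/

/-- Pairing of a coefficient with a function. -/
def coefPairing {r : ℕ} (I : Fin r → Fin 3) (φ : InvFun) : Form r →ₗ[ℝ] ℝ :=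
  integ ∘ₗ LinearMap.mulRight ℝ φ ∘ₗ frameCoef I

theorem coefPairing_apply {r : ℕ} (I : Fin r → Fin 3) (φ : InvFun) (ξ : Form r) :
    coefPairing I φ ξ = integ (frameCoef I ξ * φ) := rfl

/-- The functional is bounded by the supremum of the form over the unit cube, which the zeroth
derivative already controls. -/
theorem continuous_coefPairing {r : ℕ} (I : Fin r → Fin 3) (φ : InvFun) :
    Continuous (coefPairing I φ) := by
  have hcont : Continuous fun p : Heis =>
      (∏ k, ‖leftField (Pi.single (I k) 1) p‖) * ‖φ.1 p‖ :=
    (continuous_finsetProd _ fun k _ => (contDiff_leftField _).continuous.norm).mul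
      φ.continuous.norm
  obtain ⟨C, hC⟩ := (isCompact_Icc (a := (0 : Heis)) (b := 1)).exists_bound_of_continuousOn
    hcont.continuousOn
  have hC0 : 0 ≤ C := (norm_nonneg _).trans (hC 0 ⟨le_rfl, zero_le_one⟩)
  have hbound : ∀ (ξ : Form r) (ε : ℝ), (∀ p ∈ Set.Icc (0 : Heis) 1, ‖ξ.toFun p‖ ≤ ε) →
      ‖coefPairing I φ ξ‖ ≤ ε * C := fun ξ ε hε => by
    have h1 : ‖coefPairing I φ ξ‖ ≤ ε * C * (volume (Set.Icc (0 : Heis) 1)).toReal := by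
      refine norm_setIntegral_le_of_norm_le_const (by simp [Real.volume_Icc_pi]) fun p hp => ?_
      have h2 := (ξ.toFun p).le_opNorm fun k => leftField (Pi.single (I k) 1) p
      have h3 := (le_abs_self _).trans (hC p hp)
      have h4 := hε p hp
      change ‖(ξ.toFun p fun k => leftField (Pi.single (I k) 1) p) * φ.1 p‖ ≤ _
      rw [norm_mul]
      calc _ ≤ ‖ξ.toFun p‖ * (∏ k, ‖leftField (Pi.single (I k) 1) p‖) * ‖φ.1 p‖ := by gcongr
        _ = ‖ξ.toFun p‖ * ((∏ k, ‖leftField (Pi.single (I k) 1) p‖) * ‖φ.1 p‖) := by ring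
        _ ≤ ε * C := mul_le_mul h4 h3 (by positivity) ((norm_nonneg _).trans h4)
    simpa [Real.volume_Icc_pi] using h1
  refine continuous_of_continuousAt_zero (coefPairing I φ) ?_
  rw [ContinuousAt, map_zero, Metric.tendsto_nhds]
  intro ε hε
  have h1 : Continuous (iterD r 0) := continuous_iInf_dom (i := 0) continuous_induced_dom
  have h2 := h1.tendsto 0
  rw [UniformOnFun.tendsto_iff_tendstoUniformlyOn] at h2
  have h3 := h2 (Set.Icc 0 1) isCompact_Icc _ (Metric.dist_mem_uniformity
    (α := Heis [×0]→L[ℝ] (Heis [⋀^Fin r]→L[ℝ] ℝ)) (by positivity : 0 < ε / (C + 1)))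
  filter_upwards [h3] with ξ hξ
  rw [dist_zero_right]
  refine (hbound ξ (ε / (C + 1)) fun p hp => ?_).trans_lt ?_
  · have h4 := (hξ p hp).le
    have h5 : ‖ξ.toFun p‖ = dist (iteratedFDeriv ℝ 0 (Form.toFun (0 : Form r)) p)
        (iteratedFDeriv ℝ 0 ξ.toFun p) := by
      have h6 : iteratedFDeriv ℝ 0 (Form.toFun (0 : Form r)) p = 0 :=
        norm_eq_zero.1 (by rw [norm_iteratedFDeriv_zero, map_zero]; exact norm_zero)
      rw [h6, dist_zero_left, norm_iteratedFDeriv_zero]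
    rw [h5]
    exact h4
  · rw [div_mul_eq_mul_div, div_lt_iff₀ (by positivity)]
    nlinarith

/-! ### Infinite-dimensional terms -/

/-- Pairing the coefficient f with f itself gives its square norm, nonzero unless f = 0. -/
theorem aleph0_le_rank_ssEHat_of_frameCoef {k u : ℤ} {r : ℕ} (j : circleFunctions →ₗ[ℝ] Form r)
    (hj : ∀ f, j f ∈ ssZ k u r) (I : Fin r → Fin 3) (hI : ∀ f, frameCoef I (j f) = circlePull f)
    (hD : ∀ f, ∀ ξ ∈ ssDen k u r, coefPairing I (circlePull f) ξ = 0) :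
    Cardinal.aleph0 ≤ Module.rank ℝ (ssEHat k u r) := by
  refine aleph0_le_rank_ssEHat j hj fun f => or_iff_not_imp_left.2 fun hf =>
    ⟨_, continuous_coefPairing I (circlePull f), hD f, fun h => hf ?_⟩
  rw [coefPairing_apply, hI] at h
  exact circlePull_injective ((eq_zero_of_nsq h).trans (map_zero _).symm)

theorem ssDen_le {k u : ℤ} {r : ℕ} {V : Submodule ℝ (Form (r + 1))}
    (hZ : ssZ (k - 1) (u + 1) (r + 1) ≤ V)
    (hB : ∀ ζ ∈ filt (u - (k - 1)) r, d r ζ ∈ filt u (r + 1) → d r ζ ∈ V) :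
    ssDen k u (r + 1) ≤ V := by
  refine sup_le hZ ?_
  rw [ssB]
  split_ifs
  · exact bot_le
  · rintro _ ⟨h1, ζ, h2, rfl⟩
    exact hB ζ h2 h1

/-- For u = r both Z_0 one step deeper and the source of B_0 have filtration degree exceeding form
degree. -/
theorem ssDen_one_self (r : ℕ) : ssDen 1 r r = ⊥ := by
  cases r with
  | zero =>
    rw [ssDen, ssZ_eq_bot (by omega), ssB, sup_bot_eq]
  | succ r =>
    refine eq_bot_iff.2 (ssDen_le (ssZ_eq_bot (by omega)).le fun ζ hζ _ => ?_)
    rw [filt_eq_bot (by push_cast; omega), Submodule.mem_bot] at hζ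
    simp [hζ]

/-- If d(g β + k θ) has only a β ∧ θ component, then Xg = k and Xk = 0; hence k = 0, so Xg = 0, so
Zg = 0, and the differential vanishes. -/
theorem ssDen_two_two : ssDen 2 2 2 = ⊥ := by
  refine eq_bot_iff.2 (ssDen_le (ssZ_eq_bot (by norm_num)).le fun ζ hζ h => ?_)
  obtain ⟨f, g, k, rfl⟩ := exists_form1 ζ
  obtain rfl := form1_mem_filt.1 hζ
  rw [d_form1, form2_mem_filt] at h
  have h1 : dX k = 0 := by simpa using h.2
  have h2 : dX g = k := by simpa [sub_eq_zero] using h.1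
  obtain rfl := eq_zero_of_dX_eq h1 h2
  rw [Submodule.mem_bot, d_form1, form2_eq_zero]
  simp [h2, dZ_eq_zero_of_dX_eq_zero h2]

theorem aleph0_le_rank_ssEHat_zero : Cardinal.aleph0 ≤ Module.rank ℝ (ssEHat 1 0 0) := by
  refine aleph0_le_rank_ssEHat_of_frameCoef (form0 ∘ₗ circlePull) (fun f => ⟨?_, ?_⟩) ![]
    (fun f => frameCoef_form0 _) fun f ξ hξ => ?_
  · rw [filt_eq_top (by norm_num)]
    trivial
  · change d 0 (form0 (circlePull f)) ∈ filt 1 1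
    rw [d_form0, form1_mem_filt, dX_circlePull]
  · rw [(show ssDen 1 0 0 = ⊥ from ssDen_one_self 0), Submodule.mem_bot] at hξ
    rw [hξ, map_zero]

theorem aleph0_le_rank_ssEHat_one : Cardinal.aleph0 ≤ Module.rank ℝ (ssEHat 1 1 1) := by
  refine aleph0_le_rank_ssEHat_of_frameCoef
    (form1 ∘ₗ (LinearMap.inr ℝ _ _ ∘ₗ LinearMap.inl ℝ _ _ ∘ₗ circlePull)) (fun f => ⟨?_, ?_⟩) ![1]
    (fun f => frameCoef_form1_one _ _ _) fun f ξ hξ => ?_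
  · exact form1_mem_filt.2 rfl
  · change d 1 (form1 (0, circlePull f, 0)) ∈ filt 2 2
    rw [d_form1, form2_mem_filt]
    simp [dX_circlePull]
  · rw [(show ssDen 1 1 1 = ⊥ from ssDen_one_self 1), Submodule.mem_bot] at hξ
    rw [hξ, map_zero]

/-- The basic form `f(y) dy ∧ dz`. -/
def basicForm : circleFunctions →ₗ[ℝ] Form 2 :=
  form2 ∘ₗ (LinearMap.inr ℝ _ _ ∘ₗ LinearMap.inr ℝ _ _ ∘ₗ circlePull)

theorem basicForm_eq (f : circleFunctions) : basicForm f = form2 (0, 0, circlePull f) := rfl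

theorem basicForm_mem_ssZ (k : ℤ) (f : circleFunctions) : basicForm f ∈ ssZ k 2 2 := by
  refine ⟨form2_mem_filt.2 ⟨rfl, rfl⟩, ?_⟩
  have : d 2 (basicForm f) = 0 := by
    rw [basicForm_eq, d_form2, dX_circlePull]
    simp
  rw [SetLike.mem_coe, Submodule.mem_comap, this]
  exact zero_mem _

theorem aleph0_le_rank_ssEHat_two {k : ℤ} (hD : ssDen k 2 2 = ⊥) :
    Cardinal.aleph0 ≤ Module.rank ℝ (ssEHat k 2 2) := by
  refine aleph0_le_rank_ssEHat_of_frameCoef basicForm (basicForm_mem_ssZ k) ![1, 2]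
    (fun f => frameCoef_form2_one_two _ _ _) fun f ξ hξ => ?_
  rw [hD, Submodule.mem_bot] at hξ
  rw [hξ, map_zero]

theorem aleph0_le_rank_ssEHat_three : Cardinal.aleph0 ≤ Module.rank ℝ (ssEHat 1 2 3) := by
  refine aleph0_le_rank_ssEHat_of_frameCoef (form3 ∘ₗ circlePull) (fun f => ?_) ![0, 1, 2]
    (fun f => frameCoef_form3 _) fun f => ?_
  · rw [ssZ_eq_ssZInf (by norm_num), ssZInf, filt_eq_top (by norm_num)]
    exact ⟨trivial, Form.eq_zero_of_three_lt (by norm_num) _⟩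
  · refine ssDen_le (V := LinearMap.ker (coefPairing ![0, 1, 2] (circlePull f))) ?_ ?_
    · rw [ssZ_eq_bot (by norm_num)]
      exact bot_le
    · intro ζ hζ _
      obtain ⟨a, b, c, rfl⟩ := exists_form2 ζ
      obtain ⟨rfl, rfl⟩ := form2_mem_filt.1 hζ
      rw [LinearMap.mem_ker, coefPairing_apply, d_form2, frameCoef_form3]
      -- The denominator contributes only Xc α ∧ β ∧ θ, which integrates to zero against functions
      -- constant along the leaves.
      simp [integ_dX_mul, dX_circlePull]

/-- The classes are those of f α - f' θ: the correction -f' θ cancels the α ∧ β component of d(f α),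
leaving -f'' β ∧ θ. In the denominator the α-coefficient is zero or an X-derivative, so pairing it
with f detects them. -/
theorem aleph0_le_rank_ssEHat_two_zero : Cardinal.aleph0 ≤ Module.rank ℝ (ssEHat 2 0 1) := by
  refine aleph0_le_rank_ssEHat_of_frameCoef
    (form1 ∘ₗ (circlePull.prod (LinearMap.inr ℝ _ _ ∘ₗ (-circlePull ∘ₗ circleDeriv))))
    (fun f => ⟨?_, ?_⟩) ![0] (fun f => frameCoef_form1_zero _ _ _) fun f => ?_
  · rw [filt_eq_top (by norm_num)]
    trivial
  · change d 1 (form1 (circlePull f, 0, -circlePull (circleDeriv f))) ∈ filt 2 2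
    rw [d_form1, form2_mem_filt]
    simp [dX_circlePull, dY_circlePull, dZ_circlePull]
  · refine ssDen_le (V := LinearMap.ker (coefPairing ![0] (circlePull f))) ?_ ?_
    · intro ξ hξ
      obtain ⟨a, b, c, rfl⟩ := exists_form1 ξ
      obtain rfl := form1_mem_filt.1 hξ.1
      rw [LinearMap.mem_ker, coefPairing_apply, frameCoef_form1_zero]
      simp
    · intro ζ _ _
      obtain ⟨a, rfl⟩ := exists_form0 ζ
      rw [LinearMap.mem_ker, coefPairing_apply, d_form0, frameCoef_form1_zero]
      simp [integ_dX_mul, dX_circlePull]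

theorem dimEHat_one_eq_top {r : ℕ} (hr : r ≤ 3) : dimEHat 1 r = ⊤ := by
  interval_cases r
  · exact dimEHat_eq_top (u := 0) le_rfl aleph0_le_rank_ssEHat_zero
  · exact dimEHat_eq_top (u := 1) le_rfl aleph0_le_rank_ssEHat_one
  · exact dimEHat_eq_top (u := 2) le_rfl (aleph0_le_rank_ssEHat_two (ssDen_one_self 2))
  · exact dimEHat_eq_top (u := 2) (by norm_num) aleph0_le_rank_ssEHat_three

theorem dimE_two_eq_top {r : ℕ} (hr : r = 1 ∨ r = 2) : dimE 2 r = ⊤ := by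
  obtain rfl | rfl := hr
  · exact dimE_eq_top (u := 0) (by norm_num)
      (aleph0_le_rank_ssEHat_two_zero.trans (rank_quotient_le _))
  · exact dimE_eq_top (u := 2) le_rfl
      ((aleph0_le_rank_ssEHat_two ssDen_two_two).trans (rank_quotient_le _))

/-- The isomorphism `f ↦ [f(y) dy ∧ dz]` of `C^∞(S¹)` onto `E_2^{2,0}`. -/
def basicEquiv : circleFunctions ≃ₗ[ℝ] ssE 2 2 2 :=
  LinearEquiv.ofBijective (Submodule.mkQ _ ∘ₗ basicForm.codRestrict _ (basicForm_mem_ssZ 2)) <| by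
    constructor
    · refine (injective_iff_map_eq_zero _).2 fun f hf => ?_
      have h : basicForm f ∈ ssDen 2 2 2 :=
        show basicForm.codRestrict _ (basicForm_mem_ssZ 2) f ∈
          (ssDen 2 2 2).comap (ssZ 2 2 2).subtype from (Submodule.Quotient.mk_eq_zero _).1 hf
      rw [ssDen_two_two, Submodule.mem_bot, basicForm_eq, form2_eq_zero] at h
      exact circlePull_injective (h.2.2.trans (map_zero _).symm)
    · intro e
      obtain ⟨⟨ξ, hξ⟩, rfl⟩ := Submodule.Quotient.mk_surjective _ e
      obtain ⟨a, b, c, rfl⟩ := exists_form2 ξ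
      obtain ⟨rfl, rfl⟩ := form2_mem_filt.1 hξ.1
      have h : d 2 (form2 (0, 0, c)) ∈ filt (2 + 2) (2 + 1) := hξ.2
      -- The target filtration space is zero, so c β ∧ θ is closed, Xc = 0, and c is a function of
      -- y.
      rw [filt_eq_bot (by norm_num), Submodule.mem_bot, d_form2, form3_eq_zero] at h
      obtain ⟨f, rfl⟩ := exists_circlePull_eq (f := c) (by simpa using h)
      exact ⟨f, rfl⟩

/-! ### Finite-dimensional terms -/

theorem filt_succ_le (u : ℤ) (r : ℕ) : filt (u + 1) r ≤ filt u r := fun ξ hξ => by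
  rw [mem_filt] at hξ ⊢
  exact fun p v s hs hk => hξ p v s hs (by omega)

/-- The difference ξ - w is closed without periods, hence exact. -/
theorem mem_ssDenInf {u : ℤ} {r : ℕ} {ξ w : Form (r + 1)} (hξ : ξ ∈ ssZInf u (r + 1))
    (hw : w ∈ ssZInf (u + 1) (r + 1)) (h : periods (r + 1) w = periods (r + 1) ξ) :
    ξ ∈ ssDenInf u (r + 1) := by
  obtain ⟨ζ, hζ, -⟩ := exists_primitive (η := ξ - w)
    (by rw [map_sub, LinearMap.mem_ker.1 hξ.2, LinearMap.mem_ker.1 hw.2, sub_zero])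
    (by rw [map_sub, h, sub_self])
  exact Submodule.mem_sup.2 ⟨w, hw, ξ - w,
    ⟨sub_mem hξ.1 (filt_succ_le _ _ hw.1), ζ, hζ⟩, by abel⟩

/-- The functional `q` singles out the one period lost when the filtration degree of closed forms
goes up by one; it identifies the quotient with ℝ. -/
theorem rank_ssEInf_eq_one {u : ℤ} {r : ℕ} (q : ℝ × ℝ →ₗ[ℝ] ℝ)
    (h1 : ∀ w ∈ ssZInf (u + 1) (r + 1), q (periods (r + 1) w) = 0)
    (h2 : ∀ ξ ∈ ssZInf u (r + 1), q (periods (r + 1) ξ) = 0 →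
      ∃ w ∈ ssZInf (u + 1) (r + 1), periods (r + 1) w = periods (r + 1) ξ)
    {z : Form (r + 1)} (hz : z ∈ ssZInf u (r + 1)) (hqz : q (periods (r + 1) z) ≠ 0) :
    Module.rank ℝ
      (ssZInf u (r + 1) ⧸ (ssDenInf u (r + 1)).comap (ssZInf u (r + 1)).subtype) = 1 := by
  refine rank_quotient_eq_one (q ∘ₗ periods (r + 1)) (fun ξ hξ => ⟨fun h => ?_, fun h => ?_⟩) hz hqz
  · refine (sup_le h1 ?_ : ssDenInf u (r + 1) ≤ LinearMap.ker (q ∘ₗ periods (r + 1))) h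
    rintro _ ⟨-, ζ, rfl⟩
    rw [LinearMap.mem_ker, LinearMap.comp_apply, periods_d, map_zero]
  · obtain ⟨w, hw, hper⟩ := h2 ξ hξ h
    exact mem_ssDenInf hξ hw hper

theorem rank_ssE_eq {k u : ℤ} {r : ℕ} (hu : 0 ≤ u)
    (hk : 3 ≤ k ∨ 2 ≤ k ∧ (r = 0 ∨ r = 3 ∨ r = 1 ∧ u = 1)) :
    Module.rank ℝ (ssE k u r) =
      Module.rank ℝ (ssZInf u r ⧸ (ssDenInf u r).comap (ssZInf u r).subtype) := by
  obtain ⟨h1, h2⟩ := degeneration hu hk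
  rw [← h1, ← h2]

theorem rank_ssE_eq_zero {k u : ℤ} {r : ℕ} (hu : 0 ≤ u) (hk : 3 ≤ k ∨ 2 ≤ k ∧ r = 3)
    (h : u + 2 ≤ r ∨ 3 ≤ r ∧ 3 ≤ u) : Module.rank ℝ (ssE k u r) = 0 := by
  rw [rank_ssE_eq hu (by omega)]
  refine rank_quotient_eq_zero ?_
  rcases h with h | h
  · refine le_sup_of_le_left ?_
    rw [ssZInf, ssZInf, filt_eq_top (k := u + 1) (by omega), top_inf_eq]
    exact inf_le_right
  · rw [ssZInf_eq_bot (by omega)]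
    exact bot_le

theorem rank_ssE_zero_zero {k : ℤ} (hk : 2 ≤ k) : Module.rank ℝ (ssE k 0 0) = 1 := by
  rw [rank_ssE_eq le_rfl (by omega)]
  refine rank_quotient_eq_one (LinearMap.fst ℝ ℝ ℝ ∘ₗ periods 0) (fun ξ hξ => ?_)
    (z := form0 1) ?_ ?_
  · rw [ssDenInf, ssZInf_eq_bot (by norm_num), ssBInf, sup_bot_eq, Submodule.mem_bot]
    refine ⟨fun h => by rw [h, map_zero], fun h => ?_⟩
    rw [eq_const_of_d_eq_zero hξ.2]
    change (periods 0 ξ).1 = 0 at h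
    rw [h, zero_smul]
  · refine ⟨by rw [filt_eq_top (by norm_num)]; trivial, ?_⟩
    rw [SetLike.mem_coe, LinearMap.mem_ker, d_form0, form1_eq_zero]
    simp [lieDer_one]
  · simp [periods_form0, integ_one]

theorem rank_ssE_zero_one {k : ℤ} (hk : 3 ≤ k) : Module.rank ℝ (ssE k 0 1) = 1 := by
  rw [rank_ssE_eq le_rfl (by omega)]
  refine rank_ssEInf_eq_one (LinearMap.fst ℝ ℝ ℝ) (fun w hw => ?_) (fun ξ hξ h => ?_)
    (z := form1 (1, 0, 0)) ?_ ?_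
  · obtain ⟨f, g, k, rfl⟩ := exists_form1 w
    obtain rfl := form1_mem_filt.1 hw.1
    simp [periods_form1]
  · refine ⟨(periods 1 ξ).2 • form1 (0, 1, 0), Submodule.smul_mem _ _ ⟨form1_mem_filt.2 rfl, ?_⟩,
      ?_⟩
    · rw [SetLike.mem_coe, LinearMap.mem_ker, d_form1, form2_eq_zero]
      simp [lieDer_one]
    · change (periods 1 ξ).1 = 0 at h
      rw [map_smul, periods_form1]
      ext <;> simp [h, integ_one]
  · refine ⟨by rw [filt_eq_top (by norm_num)]; trivial, ?_⟩
    rw [SetLike.mem_coe, LinearMap.mem_ker, d_form1, form2_eq_zero]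
    simp [lieDer_one]
  · simp [periods_form1, integ_one]

theorem rank_ssE_one_one {k : ℤ} (hk : 2 ≤ k) : Module.rank ℝ (ssE k 1 1) = 1 := by
  rw [rank_ssE_eq (by norm_num) (by omega)]
  refine rank_ssEInf_eq_one (LinearMap.snd ℝ ℝ ℝ) (fun w hw => ?_) (fun ξ hξ h => ?_)
    (z := form1 (0, 1, 0)) ?_ ?_
  · rw [ssZInf_eq_bot (by norm_num), Submodule.mem_bot] at hw
    rw [hw, map_zero, map_zero]
  · obtain ⟨f, g, k, rfl⟩ := exists_form1 ξ
    obtain rfl := form1_mem_filt.1 hξ.1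
    refine ⟨0, zero_mem _, ?_⟩
    rw [periods_form1] at h ⊢
    rw [map_zero]
    ext
    · simp
    · exact h.symm
  · refine ⟨form1_mem_filt.2 rfl, ?_⟩
    rw [SetLike.mem_coe, LinearMap.mem_ker, d_form1, form2_eq_zero]
    simp [lieDer_one]
  · simp [periods_form1, integ_one]

theorem rank_ssE_one_two {k : ℤ} (hk : 3 ≤ k) : Module.rank ℝ (ssE k 1 2) = 1 := by
  rw [rank_ssE_eq (by norm_num) (by omega)]
  refine rank_ssEInf_eq_one (LinearMap.fst ℝ ℝ ℝ) (fun w hw => ?_) (fun ξ hξ h => ?_)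
    (z := form2 (0, 1, 0)) ?_ ?_
  · obtain ⟨a, b, c, rfl⟩ := exists_form2 w
    obtain ⟨rfl, rfl⟩ := form2_mem_filt.1 hw.1
    simp [periods_form2]
  · refine ⟨(periods 2 ξ).2 • form2 (0, 0, 1),
      Submodule.smul_mem _ _ ⟨form2_mem_filt.2 ⟨rfl, rfl⟩, ?_⟩, ?_⟩
    · rw [SetLike.mem_coe, LinearMap.mem_ker, d_form2, form3_eq_zero]
      simp [lieDer_one]
    · change (periods 2 ξ).1 = 0 at h
      rw [map_smul, periods_form2]
      ext <;> simp [h, integ_one]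
  · refine ⟨by rw [filt_eq_top (by norm_num)]; trivial, ?_⟩
    rw [SetLike.mem_coe, LinearMap.mem_ker, d_form2, form3_eq_zero]
    simp [lieDer_one]
  · simp [periods_form2, integ_one]

theorem rank_ssE_two_two {k : ℤ} (hk : 3 ≤ k) : Module.rank ℝ (ssE k 2 2) = 1 := by
  rw [rank_ssE_eq (by norm_num) (by omega)]
  refine rank_ssEInf_eq_one (LinearMap.snd ℝ ℝ ℝ) (fun w hw => ?_) (fun ξ hξ h => ?_)
    (z := form2 (0, 0, 1)) ?_ ?_
  · rw [ssZInf_eq_bot (by norm_num), Submodule.mem_bot] at hw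
    rw [hw, map_zero, map_zero]
  · obtain ⟨a, b, c, rfl⟩ := exists_form2 ξ
    obtain ⟨rfl, rfl⟩ := form2_mem_filt.1 hξ.1
    refine ⟨0, zero_mem _, ?_⟩
    rw [periods_form2] at h ⊢
    rw [map_zero]
    ext
    · simp
    · exact h.symm
  · refine ⟨form2_mem_filt.2 ⟨rfl, rfl⟩, ?_⟩
    rw [SetLike.mem_coe, LinearMap.mem_ker, d_form2, form3_eq_zero]
    simp [lieDer_one]
  · simp [periods_form2, integ_one]

theorem rank_ssE_two_three {k : ℤ} (hk : 2 ≤ k) : Module.rank ℝ (ssE k 2 3) = 1 := by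
  rw [rank_ssE_eq (by norm_num) (by omega)]
  refine rank_ssEInf_eq_one (LinearMap.fst ℝ ℝ ℝ) (fun w hw => ?_) (fun ξ hξ h => ?_)
    (z := form3 1) ?_ ?_
  · rw [ssZInf_eq_bot (by norm_num), Submodule.mem_bot] at hw
    rw [hw, map_zero, map_zero]
  · obtain ⟨w, rfl⟩ := exists_form3 ξ
    refine ⟨0, zero_mem _, ?_⟩
    rw [periods_form3] at h ⊢
    rw [map_zero]
    ext
    · exact h.symm
    · rfl
  · exact ⟨by rw [filt_eq_top (by norm_num)]; trivial, Form.eq_zero_of_three_lt (by norm_num) _⟩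
  · simp [periods_form3, integ_one]

theorem dimE_eq_one {k : ℤ} {r : ℕ} (hr : r = 0 ∨ r = 3) (hk : 2 ≤ k) : dimE k r = 1 := by
  obtain rfl | rfl := hr
  · have h0 : Module.rank ℝ (ssE k (0 : ℕ) 0) = 1 := rank_ssE_zero_zero hk
    rw [dimE, Finset.sum_range_one, h0, map_one]
  · have h0 : Module.rank ℝ (ssE k (0 : ℕ) 3) = 0 :=
      rank_ssE_eq_zero (by norm_num) (by omega) (by norm_num)
    have h1 : Module.rank ℝ (ssE k (1 : ℕ) 3) = 0 :=
      rank_ssE_eq_zero (by norm_num) (by omega) (by norm_num)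
    have h2 : Module.rank ℝ (ssE k (2 : ℕ) 3) = 1 := rank_ssE_two_three hk
    have h3 : Module.rank ℝ (ssE k (3 : ℕ) 3) = 0 :=
      rank_ssE_eq_zero (by norm_num) (by omega) (by norm_num)
    rw [dimE, Finset.sum_range_succ, Finset.sum_range_succ, Finset.sum_range_succ,
      Finset.sum_range_one, h0, h1, h2, h3]
    simp

theorem dimE_eq_two {k : ℤ} {r : ℕ} (hr : r = 1 ∨ r = 2) (hk : 3 ≤ k) : dimE k r = 2 := by
  obtain rfl | rfl := hr
  · have h0 : Module.rank ℝ (ssE k (0 : ℕ) 1) = 1 := rank_ssE_zero_one hk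
    have h1 : Module.rank ℝ (ssE k (1 : ℕ) 1) = 1 := rank_ssE_one_one (by omega)
    rw [dimE, Finset.sum_range_succ, Finset.sum_range_one, h0, h1, map_one, one_add_one_eq_two]
  · have h0 : Module.rank ℝ (ssE k (0 : ℕ) 2) = 0 :=
      rank_ssE_eq_zero (by norm_num) (by omega) (by norm_num)
    have h1 : Module.rank ℝ (ssE k (1 : ℕ) 2) = 1 := rank_ssE_one_two hk
    have h2 : Module.rank ℝ (ssE k (2 : ℕ) 2) = 1 := rank_ssE_two_two hk
    rw [dimE, Finset.sum_range_succ, Finset.sum_range_succ, Finset.sum_range_one, h0, h1, h2,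
      map_zero, map_one, zero_add, one_add_one_eq_two]

end HeisenbergFoliation

end

open HeisenbergFoliation in
theorem mainTheorem9 :
    -- degrees 0 and 3
    (∀ r : ℕ, r = 0 ∨ r = 3 →
      (∀ h : ℝ, 0 < h → eigenvalueBranch r 0 h = 0) ∧
      (smallCount r 2 = ⊤ ∧ dimEHat 1 r = ⊤) ∧
      (∀ k : ℕ, 2 ≤ k → smallCount r (2 * k) = 1 ∧ dimE k r = 1)) ∧
    -- degrees 1 and 2
    (∀ r : ℕ, r = 1 ∨ r = 2 →
      (∀ h : ℝ, 0 < h → eigenvalueBranch r 0 h = 0 ∧ eigenvalueBranch r 1 h = 0) ∧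
      (smallCount r 2 = ⊤ ∧ dimEHat 1 r = ⊤) ∧
      (smallCount r 4 = ⊤ ∧ dimE 2 r = ⊤) ∧
      (∀ k : ℕ, 3 ≤ k → smallCount r (2 * k) = 2 ∧ dimE k r = 2)) ∧
    -- degeneration at the third term
    (∀ (k u : ℤ) (r : ℕ), 3 ≤ k → 0 ≤ u →
      ssZ k u r = ssZInf u r ∧ ssDen k u r = ssDenInf u r) ∧
    -- basic cohomology
    Module.rank ℝ (ssE 2 0 0) = 1 ∧
    Module.rank ℝ (ssE 2 1 1) = 1 ∧
    (∃ e : circleFunctions ≃ₗ[ℝ] ssE 2 2 2, ∀ f : circleFunctions, ∃ ξ : ssZ 2 2 2,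
      e f = Submodule.Quotient.mk ξ ∧
      ∀ (p : Heis) (v : Fin 2 → Heis),
        ξ.1.toFun p v = f.1 (p 1) * (v 0 1 * v 1 2 - v 0 2 * v 1 1)) := by
  refine ⟨fun r hr => ⟨fun h hh => ?_, ⟨smallCount_two_eq_top hr, dimEHat_one_eq_top (by omega)⟩,
      fun k hk => ⟨smallCount_eq_one hr hk, dimE_eq_one hr (by exact_mod_cast hk)⟩⟩,
    fun r hr => ⟨fun h hh => ⟨?_, ?_⟩, ⟨smallCount_two_eq_top' hr, dimEHat_one_eq_top (by omega)⟩,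
      ⟨smallCount_four_eq_top hr, dimE_two_eq_top hr⟩,
      fun k hk => ⟨smallCount_eq_two hr hk, dimE_eq_two hr (by exact_mod_cast hk)⟩⟩,
    fun k u r hk hu => degeneration hu (Or.inl hk), rank_ssE_zero_zero le_rfl,
    rank_ssE_one_one le_rfl, basicEquiv,
    fun f => ⟨⟨basicForm f, basicForm_mem_ssZ 2 f⟩, rfl, fun p v => ?_⟩⟩
  · exact eigenvalueBranch_eq_zero hh.ne' (by simpa using one_le_countingFunction_zero h hr)
  · exact eigenvalueBranch_eq_zero_of_le_one hh.ne' hr zero_le_one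
  · exact eigenvalueBranch_eq_zero_of_le_one hh.ne' hr le_rfl
  · change (basicForm f).toFun p v = _
    rw [basicForm_eq, form2_apply, circlePull_apply]
    simp
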